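/- For an even integer $k$ let $C_k$ be the space of holomorphic cusp forms of weight $k$ for $SL_2(\mathbb{Z})$, with Petersson inner product $\langle f,g\rangle=\int_{SL_2(\mathbb{Z})\backslash\mathbb{H}}\overline{f(z)}\,g(z)\,y^{k}\,\frac{dx\,dy}{y^2}$ and Petersson norm $\|f\|=\langle f,f\rangle^{1/2}$. For $n\ge 1$ let $$(T_nf)(z)=\frac{1}{\sqrt n}\sum_{ad=n}\Big(\frac ad\Big)^{k/2}\sum_{b\ (\mathrm{mod}\ d)}f\Big(\frac{az+b}{d}\Big)$$ be the normalized Hecke operators on $C_k$. Let $S_k$ be the Hecke basis of $C_k$: the orthogonal basis consisting of eigenfunctions of all $T_n$, normalized to have first Fourier coefficient $1$. For $f\in S_k$ write $T_nf=\lambda_f(n)f$, and for $h>0$ put $$A_f(n,h)=\sum_{\substack{n-h\le p\le n\\ p\ \mathrm{prime}}}\lambda_f(p)^2 .$$ Let $\pi(x)$ be the number of primes $p\le x$. **Proposition 3.1.** Let $\epsilon>0$ and $\eta>0$ be fixed. Let $N$ be a sufficiently large real number, let $y=\eta\log N$, and let $k$ be an even positive integer such that $N^{2+\epsilon}=o(k)$.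 Then $$\sum_{f\in S_k}\frac1{\|f\|^2}\sum_{n\le N}A_f(n,y)^2=\sum_{f\in S_k}\frac1{\|f\|^2}\sum_{n\le N}\Big(\big(\pi(n)-\pi(n-y)\big)^2+\eta+o(1)\Big).$$ Precisely: for every $\delta>0$ there are $c>0$ and $N_0\ge 1$, depending only on $\epsilon,\eta,\delta$, such that for every real $N\ge N_0$ and every even $k$ with $N^{2+\epsilon}\le c\,k$, the displayed equality holds with $o(1)$ replaced by some real number $r=r(N,k)$ with $|r|\le\delta$. -/

import Mathlib

open scoped MatrixGroups Modular

noncomputable section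

namespace PeterssonAverage

/-- The Petersson inner product of two cusp forms of weight `k` for `SL(2, ℤ)`:
the integral of `conj (f z) * g z * y ^ k` over the standard fundamental domain with respect to
the invariant measure `dx dy / y ^ 2` (which is the volume measure on the upper half-plane). -/
def peterssonInner (k : ℕ) (f g : CuspForm 𝒮ℒ (k : ℤ)) : ℂ :=
  ∫ z in 𝒟, UpperHalfPlane.petersson (k : ℤ) f g z

/-- The Petersson norm `‖f‖ = ⟨f, f⟩ ^ (1 / 2)`. -/
def peterssonNorm (k : ℕ) (f : CuspForm 𝒮ℒ (k : ℤ)) : ℝ :=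
  Real.sqrt (peterssonInner k f f).re

/-- The normalized `n`-th Hecke operator in weight `k`,
`(T_n f)(z) = n ^ (-1/2) * ∑_{a d = n} (a / d) ^ (k / 2) * ∑_{b mod d} f ((a z + b) / d)`.
With this normalization, `T_n f = λ f` means that the `n`-th Fourier coefficient of `f` is
`λ * n ^ ((k - 1) / 2)` times its first one. The numbers `(a z + b) / d` lie in the upper
half-plane, on which `UpperHalfPlane.ofComplex` is the identity. -/
def heckeOp (k n : ℕ) (f : UpperHalfPlane → ℂ) (z : UpperHalfPlane) : ℂ :=
  (((n : ℝ) ^ (-(1 / 2) : ℝ) : ℝ) : ℂ) *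
    ∑ x ∈ n.divisorsAntidiagonal,
      ((((x.1 : ℝ) / (x.2 : ℝ)) ^ ((k : ℝ) / 2) : ℝ) : ℂ) *
        ∑ b ∈ Finset.range x.2,
          f (UpperHalfPlane.ofComplex (((x.1 : ℂ) * (z : ℂ) + (b : ℂ)) / (x.2 : ℂ)))

/-- `f` is an eigenfunction of all Hecke operators `T_n`, `n ≥ 1`. -/
def IsHeckeEigenfunction (k : ℕ) (f : CuspForm 𝒮ℒ (k : ℤ)) : Prop :=
  ∀ n : ℕ, 1 ≤ n → ∃ c : ℂ, ∀ z : UpperHalfPlane, heckeOp k n f z = c * f z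

open Classical in
/-- The eigenvalue `λ_f(n)` of the `n`-th Hecke operator on `f`
(it is determined by `f` as soon as `f ≠ 0` is an eigenfunction). -/
def heckeEigenvalue (k : ℕ) (f : CuspForm 𝒮ℒ (k : ℤ)) (n : ℕ) : ℂ :=
  if h : ∃ c : ℂ, ∀ z : UpperHalfPlane, heckeOp k n f z = c * f z then h.choose else 0

/-- `S` is the Hecke basis of the space of cusp forms of weight `k` for `SL(2, ℤ)`: an orthogonal
basis for the Petersson inner product that consists of eigenfunctions of all Hecke operators, each
normalized so that its first Fourier coefficient is `1`. (Orthogonality of these nonzero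
vectors gives linear independence.) -/
structure IsHeckeBasis (k : ℕ) (S : Finset (CuspForm 𝒮ℒ (k : ℤ))) : Prop where
  eigen : ∀ f ∈ S, IsHeckeEigenfunction k f
  normalized : ∀ f ∈ S, (UpperHalfPlane.qExpansion 1 f).coeff 1 = 1
  orthogonal : ∀ f ∈ S, ∀ g ∈ S, f ≠ g → peterssonInner k f g = 0
  span_eq_top : Submodule.span ℂ (S : Set (CuspForm 𝒮ℒ (k : ℤ))) = ⊤

/-- `A_f(n, h) = ∑_{n - h ≤ p ≤ n} λ_f(p) ^ 2`, the sum being over primes `p`. -/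
def shortSum (k : ℕ) (f : CuspForm 𝒮ℒ (k : ℤ)) (n : ℕ) (h : ℝ) : ℂ :=
  ∑ p ∈ (Finset.Icc 1 n).filter (fun p : ℕ => p.Prime ∧ (n : ℝ) - h ≤ (p : ℝ)),
    heckeEigenvalue k f p ^ 2

/-- `π(x)`, the number of primes `p ≤ x`, for real `x` (it is `0` for negative `x`). -/
def primePi (x : ℝ) : ℝ := (Nat.primeCounting ⌊x⌋₊ : ℝ)

end PeterssonAverage

end

noncomputable section

namespace PeterssonAverage

open MeasureTheory Filter Topology Set

/-! ### A Tauberian theorem with the Fejér kernel -/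

/-! Divide by the total weight `W = ∑ 1/‖f‖²`: the claim is then about the harmonic average of
`A_f(n, y)²`. Expand the square over pairs of primes `(p, q)` in the window `[n - y, n]`. By the
Hecke relations `λ(p)²λ(q)²` is `1` plus normalized Fourier coefficients at `p²`, `q²`, `p²q²` when
`p ≠ q`, and `2` plus coefficients at `p²`, `p⁴` when `p = q`. If all coefficients at `1 < m ≤ N⁴`
average to almost zero, what remains is `M² + M`, where `M` is the number of primes in the window.
The diagonal term `M` has mean `η` by the prime number theorem.

The coefficients are controlled by the Petersson formula (`poincareConst_mul_sum_coeff`). Unfolding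
shows that the inner product of the first Poincaré series `P` with `g` is a constant times the first
coefficient of `g`; expanding `P` in the Hecke basis makes the harmonic average of `m`-th
coefficients a multiple of the `m`-th coefficient of `P`. No Kloosterman sums or Bessel functions
are needed. One has `P = 2e(z) + tail`, the tail is `O(y^{-(k-3)}(1 + y^{-3}))` at height `y`, and
integrating at height `k/(2πm)` gives a normalized coefficient `O(e^{-k})` for `1 < m` as long as
`2πe³√m ≤ k`. For `m ≤ N⁴` this asks for `N² ≪ k` (`harmonic_average`).

The prime number theorem is derived by a Wiener–Ikehara argument with the Fejér kernel
(`tendsto_fejer_mean`, `tendsto_one_of_fejer_mean`). One more point concerns the closed window: it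
may contain a prime at `n - y`, which `π(n) - π(n - y)` does not count. This affects at most `π(N)`
values of `n`, and a sieve bound `M = o(y)` makes the effect on the squares negligible
(`tendsto_average_primeWindow`). -/

/-- The Fejér kernel, without a value of interest at `0`. -/
def fejer (w : ℝ) : ℝ := 2 * (1 - Real.cos w) / w ^ 2

lemma fejer_nonneg (w : ℝ) : 0 ≤ fejer w := by
  unfold fejer
  have := Real.cos_le_one w
  apply div_nonneg <;> nlinarith [sq_nonneg w]

/-- Combines `1 - cos w ≤ w²/2`, for small `w`, with `1 - cos w ≤ 2`, for large `w`. At `0` division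
by zero gives the value `0`. -/
lemma fejer_le (w : ℝ) : fejer w ≤ 8 * (1 + w ^ 2)⁻¹ := by
  rcases eq_or_ne w 0 with rfl | hw
  · simp [fejer]
  have h2 : 0 < w ^ 2 := by positivity
  unfold fejer
  rw [← div_eq_mul_inv, div_le_div_iff₀ h2 (by positivity)]
  have h1 := Real.one_sub_sq_div_two_le_cos (x := w)
  have h3 := Real.neg_one_le_cos w
  nlinarith

lemma measurable_fejer : Measurable fejer := by unfold fejer; fun_prop

lemma integrable_fejer : Integrable fejer := by
  refine (integrable_inv_one_add_sq.const_mul 8).mono' measurable_fejer.aestronglyMeasurable ?_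
  exact .of_forall fun w => by
    rw [Real.norm_of_nonneg (fejer_nonneg w)]; exact fejer_le w

/-- The exact mass `2π` is never needed, because it appears on both sides of the Tauberian limit. -/
lemma integral_fejer_pos : 0 < ∫ w, fejer w := by
  rw [integral_pos_iff_support_of_nonneg fejer_nonneg integrable_fejer]
  refine lt_of_lt_of_le ?_ (measure_mono (s := Ioo (0:ℝ) 1) ?_)
  · simp
  · intro w hw
    have hc : Real.cos w < 1 := by
      rw [← Real.cos_zero]
      exact Real.cos_lt_cos_of_nonneg_of_le_pi le_rfl (by linarith [hw.2, Real.pi_gt_three]) hw.1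
    have : 0 < w := hw.1
    have : 0 < fejer w := by unfold fejer; apply div_pos <;> [linarith; positivity]
    exact this.ne'

/-- The Fourier transform of the triangle function is the Fejér kernel. -/
lemma integral_triangle_mul_exp {l : ℝ} (hl : 0 < l) {w : ℝ} (hw : w ≠ 0) :
    ∫ t in -l..l, ((1 - |t| / l : ℝ) : ℂ) * Complex.exp (Complex.I * w * t) =
      ((l * fejer (l * w) : ℝ) : ℂ) := by
  have hw' : (w : ℂ) ≠ 0 := by exact_mod_cast hw
  have hl' : (l : ℂ) ≠ 0 := by exact_mod_cast hl.ne'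
  have hI := Complex.I_ne_zero
  have hcont : Continuous fun t : ℝ =>
      ((1 - |t| / l : ℝ) : ℂ) * Complex.exp (Complex.I * w * t) := by fun_prop
  rw [← intervalIntegral.integral_add_adjacent_intervals (hcont.intervalIntegrable (-l) 0)
    (hcont.intervalIntegrable 0 l)]
  -- An explicit antiderivative. The sign `s` is `-1` on the left half and `1` on the right half, so
  -- that `s * t = |t|`.
  have key (s : ℝ) (a b : ℝ) : ∫ t in a..b, ((1 - s * t / l : ℝ) : ℂ)
      * Complex.exp (Complex.I * w * t) =
      ((1 - s * b / l : ℝ) / (Complex.I * w) + s / l / (Complex.I * w) ^ 2)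
        * Complex.exp (Complex.I * w * b) -
      ((1 - s * a / l : ℝ) / (Complex.I * w) + s / l / (Complex.I * w) ^ 2)
        * Complex.exp (Complex.I * w * a) := by
    have hd (t : ℝ) : HasDerivAt (fun t : ℝ => ((1 - s * t / l : ℝ) / (Complex.I * w)
        + s / l / (Complex.I * w) ^ 2) * Complex.exp (Complex.I * w * t))
        (((1 - s * t / l : ℝ) : ℂ) * Complex.exp (Complex.I * w * t)) t := by
      have h1 : HasDerivAt (fun t : ℝ => (((1 - s * t / l : ℝ) : ℂ) / (Complex.I * w)
          + s / l / (Complex.I * w) ^ 2)) (((-(s * 1 / l) : ℝ) : ℂ) / (Complex.I * w)) t := by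
        have h0 : HasDerivAt (fun t : ℝ => (1 - s * t / l : ℝ)) (-(s * 1 / l)) t :=
          (((hasDerivAt_id t).const_mul s).div_const l).const_sub 1
        exact (h0.ofReal_comp.div_const _).add_const _
      have h2 : HasDerivAt (fun t : ℝ => Complex.exp (Complex.I * w * t))
          (Complex.exp (Complex.I * w * t) * (Complex.I * w * 1)) t :=
        (((hasDerivAt_id (t : ℂ)).const_mul (Complex.I * w)).cexp).comp_ofReal
      refine (h1.mul h2).congr_deriv ?_
      push_cast
      field_simp
      ring
    rw [intervalIntegral.integral_eq_sub_of_hasDerivAt (fun t _ => hd t)]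
    exact (by fun_prop : Continuous _).intervalIntegrable _ _
  have e1 : ∫ t in -l..0, ((1 - |t| / l : ℝ) : ℂ) * Complex.exp (Complex.I * w * t) =
      ∫ t in -l..0, ((1 - (-1) * t / l : ℝ) : ℂ) * Complex.exp (Complex.I * w * t) := by
    refine intervalIntegral.integral_congr fun t ht => ?_
    rw [uIcc_of_le (by linarith)] at ht
    simp only [abs_of_nonpos ht.2, neg_mul, one_mul]
  have e2 : ∫ t in 0..l, ((1 - |t| / l : ℝ) : ℂ) * Complex.exp (Complex.I * w * t) =
      ∫ t in 0..l, ((1 - 1 * t / l : ℝ) : ℂ) * Complex.exp (Complex.I * w * t) := by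
    refine intervalIntegral.integral_congr fun t ht => ?_
    rw [uIcc_of_le (by linarith)] at ht
    simp only [abs_of_nonneg ht.1, one_mul]
  rw [e1, e2, key, key]
  have hcos : ((Real.cos (l * w) : ℝ) : ℂ) =
      (Complex.exp (Complex.I * w * l) + Complex.exp (Complex.I * w * (-l : ℝ))) / 2 := by
    rw [Complex.ofReal_cos, Complex.cos]
    congr 3 <;> push_cast <;> ring
  unfold fejer
  push_cast [-Complex.ofReal_cos]
  rw [hcos]
  push_cast
  simp only [mul_zero, Complex.exp_zero]
  field_simp
  simp only [Complex.I_sq]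
  ring

/-- If the Laplace transform of a bounded function extends continuously to the closed
half-plane, then the Fejér means of the function tend to zero. -/
theorem tendsto_fejer_mean {B : ℝ → ℝ} (hB : Measurable B) {C : ℝ} (hC : ∀ v, |B v| ≤ C)
    (hB0 : ∀ v < 0, B v = 0) {G : ℂ → ℂ} (hG : ContinuousOn G {s | 0 ≤ s.re})
    (hBG : ∀ s : ℂ, 0 < s.re → ∫ v, (B v : ℂ) * Complex.exp (-s * v) = G s)
    {l : ℝ} (hl : 0 < l) :
    Tendsto (fun u : ℝ => ∫ v, B v * (l * fejer (l * (u - v)))) atTop (𝓝 0) := by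
  have hC0 : 0 ≤ C := (abs_nonneg _).trans (hC 0)
  have hint {σ : ℝ} (hσ : 0 < σ) : Integrable fun v : ℝ => (B v : ℂ) * Complex.exp (-σ * v) := by
    have h1 : IntegrableOn (fun v => C * Real.exp (-σ * v)) (Ici 0) :=
      ((exp_neg_integrableOn_Ioi 0 hσ).congr_set_ae Ioi_ae_eq_Ici.symm).const_mul C
    rw [← integrable_indicator_iff measurableSet_Ici] at h1
    refine h1.mono' (by fun_prop) (.of_forall fun v => ?_)
    by_cases hv : 0 ≤ v
    · rw [indicator_of_mem (show v ∈ Ici (0:ℝ) from hv), norm_mul, Complex.norm_real, Complex.norm_exp]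
      have : (-(σ : ℂ) * v).re = -σ * v := by simp
      rw [this]
      exact mul_le_mul_of_nonneg_right (hC v) (Real.exp_pos _).le
    · rw [hB0 v (not_le.mp hv)]
      simp [indicator_of_notMem (show v ∉ Ici (0:ℝ) from hv)]
  -- For `σ > 0` the Laplace integral converges absolutely. Insert it for `G` and exchange the
  -- integrals: the inner one is the Fourier transform of the triangle.
  have hfub (u : ℝ) {σ : ℝ} (hσ : 0 < σ) :
      ∫ t in -l..l, ((1 - |t| / l : ℝ) : ℂ) * G (σ + t * Complex.I)
          * Complex.exp (Complex.I * u * t) =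
        ∫ v, ((B v : ℂ) * Complex.exp (-σ * v)) * ((l * fejer (l * (u - v)) : ℝ) : ℂ) := by
    have hle : -l ≤ l := by linarith
    have hI : Integrable (Function.uncurry fun (t v : ℝ) =>
        (((1 - |t| / l : ℝ) : ℂ) * Complex.exp (Complex.I * (u - v : ℝ) * t)) *
          (((B v : ℂ) * Complex.exp (-σ * v))))
        ((volume.restrict (Ioc (-l) l)).prod volume) := by
      have h0 : Integrable (fun z : ℝ × ℝ => (1 : ℂ) * ((B z.2 : ℂ) * Complex.exp (-σ * z.2)))
          ((volume.restrict (Ioc (-l) l)).prod volume) :=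
        Integrable.mul_prod (f := fun _ : ℝ => (1 : ℂ)) (integrable_const _) (hint hσ)
      -- Truncating the triangle at `0` bounds this factor by `1` everywhere and changes nothing on
      -- the domain of integration.
      have hm : AEStronglyMeasurable (fun z : ℝ × ℝ => (max (1 - |z.1| / l) 0 : ℝ) *
          Complex.exp (Complex.I * (u - z.2 : ℝ) * z.1))
          ((volume.restrict (Ioc (-l) l)).prod volume) :=
        (by fun_prop : Continuous _).aestronglyMeasurable
      have h1 := h0.bdd_mul hm (c := 1) (.of_forall fun z => by
          rw [norm_mul, Complex.norm_real, Complex.norm_exp]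
          have : (Complex.I * (u - z.2 : ℝ) * z.1).re = 0 := by simp
          rw [this, Real.exp_zero, mul_one, Real.norm_of_nonneg (le_max_right _ _)]
          exact max_le (by have := abs_nonneg z.1; linarith [div_nonneg this hl.le]) zero_le_one)
      refine h1.congr ?_
      have hae : ∀ᵐ z ∂((volume.restrict (Ioc (-l) l)).prod (volume : Measure ℝ)),
          z.1 ∈ Ioc (-l) l := by
        have := ae_restrict_mem (μ := (volume : Measure ℝ)) (measurableSet_Ioc (a := -l) (b := l))
        exact Measure.quasiMeasurePreserving_fst.ae this
      filter_upwards [hae] with z hz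
      have : 0 ≤ 1 - |z.1| / l := by
        rw [sub_nonneg, div_le_one hl, abs_le]; exact ⟨hz.1.le, hz.2⟩
      simp only [Function.uncurry, max_eq_left this, one_mul]
    have h2 := integral_integral_swap hI
    rw [intervalIntegral.integral_of_le hle]
    calc _ = ∫ t in Ioc (-l) l, ∫ v, (((1 - |t| / l : ℝ) : ℂ) *
            Complex.exp (Complex.I * (u - v : ℝ) * t)) *
            (((B v : ℂ) * Complex.exp (-σ * v))) := by
          refine integral_congr_ae (.of_forall fun t => ?_)
          dsimp only
          rw [← hBG _ (by simpa using hσ), ← integral_const_mul, ← integral_mul_const]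
          refine integral_congr_ae (.of_forall fun v => ?_)
          dsimp only
          have : Complex.exp (-(σ + t * Complex.I) * v) * Complex.exp (Complex.I * u * t) =
              Complex.exp (Complex.I * (u - v : ℝ) * t) * Complex.exp (-σ * v) := by
            rw [← Complex.exp_add, ← Complex.exp_add]; congr 1; push_cast; ring
          linear_combination ((1 - |t| / l : ℝ) : ℂ) * B v * this
      _ = _ := by
          rw [h2]
          refine integral_congr_ae ?_
          have : ∀ᵐ v : ℝ, v ≠ u := by simp [ae_iff]
          filter_upwards [this] with v hv
          rw [integral_mul_const, mul_comm]
          congr 1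
          rw [← intervalIntegral.integral_of_le hle]
          exact integral_triangle_mul_exp hl (sub_ne_zero.mpr hv.symm)
  -- Let `σ → 0+` on both sides. On the left `G` is bounded on a compact rectangle; on the right `C`
  -- times the Fejér kernel dominates.
  have hlim (u : ℝ) : ∫ t in -l..l, ((1 - |t| / l : ℝ) : ℂ) * G (t * Complex.I)
          * Complex.exp (Complex.I * u * t) =
        ((∫ v, B v * (l * fejer (l * (u - v))) : ℝ) : ℂ) := by
    have hL : Tendsto (fun σ : ℝ => ∫ t in -l..l, ((1 - |t| / l : ℝ) : ℂ) * G (σ + t * Complex.I)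
          * Complex.exp (Complex.I * u * t)) (𝓝[>] 0)
        (𝓝 (∫ t in -l..l, ((1 - |t| / l : ℝ) : ℂ) * G (t * Complex.I)
          * Complex.exp (Complex.I * u * t))) := by
      have hK : IsCompact (Icc (0:ℝ) 1 ×ℂ Icc (-l) l) := isCompact_Icc.reProdIm isCompact_Icc
      obtain ⟨M, hM⟩ := hK.exists_bound_of_continuousOn
        (hG.mono (fun s hs => (Complex.mem_reProdIm.mp hs).1.1))
      have hmap (σ : ℝ) (hσ : 0 ≤ σ) : Continuous fun t : ℝ => G (σ + t * Complex.I) :=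
        hG.comp_continuous (by fun_prop) fun t => by simpa using hσ
      refine intervalIntegral.tendsto_integral_filter_of_dominated_convergence (fun _ => 2 * M)
        ?_ ?_ (by simp) ?_
      · filter_upwards [self_mem_nhdsWithin] with σ hσ
        have h1 : Continuous fun t : ℝ => ((1 - |t| / l : ℝ) : ℂ) := by fun_prop
        have h2 : Continuous fun t : ℝ => Complex.exp (Complex.I * u * t) := by fun_prop
        exact ((h1.mul (hmap σ (le_of_lt hσ))).mul h2).aestronglyMeasurable
      · filter_upwards [Ioc_mem_nhdsGT (show (0:ℝ) < 1 by norm_num)] with σ hσ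
        refine .of_forall fun t ht => ?_
        rw [uIoc_of_le (by linarith)] at ht
        have h1 := hM (σ + t * Complex.I) (Complex.mem_reProdIm.mpr (by
          simpa using ⟨⟨hσ.1.le, hσ.2⟩, ht.1.le, ht.2⟩))
        have h2 : |t| / l ≤ 1 := by rw [div_le_one hl, abs_le]; exact ⟨ht.1.le, ht.2⟩
        have h3 : 0 ≤ |t| / l := by positivity
        rw [norm_mul, norm_mul, Complex.norm_real, Complex.norm_exp]
        have : (Complex.I * u * t).re = 0 := by simp
        rw [this, Real.exp_zero, mul_one]
        refine mul_le_mul ?_ h1 (norm_nonneg _) (by norm_num)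
        rw [Real.norm_of_nonneg (by linarith)]; linarith
      · refine .of_forall fun t _ => ?_
        refine (Tendsto.const_mul _ ?_).mul_const _
        have hc : ContinuousWithinAt G {s | 0 ≤ s.re} (t * Complex.I) :=
          hG _ (by simp)
        refine hc.tendsto.comp (tendsto_nhdsWithin_iff.mpr ⟨?_, ?_⟩)
        · have : Tendsto (fun σ : ℝ => (σ : ℂ) + t * Complex.I) (𝓝 0)
              (𝓝 (((0:ℝ) : ℂ) + t * Complex.I)) := by
            exact (by fun_prop : Continuous fun σ : ℝ => (σ : ℂ) + t * Complex.I).tendsto 0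
          rw [Complex.ofReal_zero, zero_add] at this
          exact this.mono_left nhdsWithin_le_nhds
        · filter_upwards [self_mem_nhdsWithin] with σ hσ
          simpa using le_of_lt hσ
    have hKu : Integrable fun v => l * fejer (l * (u - v)) := by
      have := (integrable_fejer.comp_mul_left' hl.ne').comp_sub_left u
      exact this.const_mul l
    have hR : Tendsto (fun σ : ℝ => ∫ v, ((B v : ℂ) * Complex.exp (-σ * v)) *
          ((l * fejer (l * (u - v)) : ℝ) : ℂ)) (𝓝[>] 0)
        (𝓝 (∫ v, (B v : ℂ) * ((l * fejer (l * (u - v)) : ℝ) : ℂ))) := by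
      refine tendsto_integral_filter_of_dominated_convergence
        (fun v => C * (l * fejer (l * (u - v)))) ?_ ?_ (hKu.const_mul C) ?_
      · have := measurable_fejer
        exact .of_forall fun σ => by fun_prop
      · filter_upwards [self_mem_nhdsWithin] with σ hσ
        refine .of_forall fun v => ?_
        have hk : 0 ≤ l * fejer (l * (u - v)) := mul_nonneg hl.le (fejer_nonneg _)
        rw [norm_mul, Complex.norm_real (l * _), Real.norm_of_nonneg hk]
        refine mul_le_mul_of_nonneg_right ?_ hk
        by_cases hv : 0 ≤ v
        · rw [norm_mul, Complex.norm_real, Complex.norm_exp]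
          have h1 : (-(σ : ℂ) * v).re = -(σ * v) := by simp
          have h2 : Real.exp (-(σ * v)) ≤ 1 :=
            Real.exp_le_one_iff.mpr (by have := mul_nonneg (le_of_lt hσ) hv; linarith)
          rw [h1]
          calc _ ≤ C * 1 := mul_le_mul (hC v) h2 (Real.exp_pos _).le hC0
            _ = C := mul_one C
        · rw [hB0 v (not_le.mp hv)]; simpa using hC0
      · refine .of_forall fun v => ?_
        refine Tendsto.mul_const _ ?_
        have : Tendsto (fun σ : ℝ => (B v : ℂ) * Complex.exp (-σ * v)) (𝓝 0)
            (𝓝 ((B v : ℂ) * Complex.exp (-((0:ℝ) : ℂ) * v))) :=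
          (by fun_prop : Continuous fun σ : ℝ => (B v : ℂ) * Complex.exp (-σ * v)).tendsto 0
        simp only [Complex.ofReal_zero, neg_zero, zero_mul, Complex.exp_zero, mul_one] at this
        exact this.mono_left nhdsWithin_le_nhds
    have hLR := hL.congr' (by
      filter_upwards [self_mem_nhdsWithin] with σ hσ
      exact hfub u hσ)
    have := tendsto_nhds_unique hLR hR
    rw [this, ← integral_complex_ofReal]
    push_cast
    rfl
  -- Riemann–Lebesgue, for the product of `G` on the imaginary axis with the triangle.
  have hRL : Tendsto (fun u : ℝ => ∫ t in -l..l, ((1 - |t| / l : ℝ) : ℂ) * G (t * Complex.I)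
          * Complex.exp (Complex.I * u * t)) atTop (𝓝 0) := by
    have h0 := Real.tendsto_integral_exp_smul_cocompact
      ((Ioc (-l) l).indicator fun t : ℝ => ((1 - |t| / l : ℝ) : ℂ) * G (t * Complex.I))
    have h1 : Tendsto (fun u : ℝ => -u / (2 * Real.pi)) atTop (cocompact ℝ) := by
      refine Tendsto.mono_right ?_ atBot_le_cocompact
      exact (tendsto_neg_atTop_atBot).atBot_div_const (by positivity)
    refine (h0.comp h1).congr fun u => ?_
    rw [intervalIntegral.integral_of_le (by linarith), ← integral_indicator measurableSet_Ioc]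
    refine integral_congr_ae (.of_forall fun t => ?_)
    by_cases ht : t ∈ Ioc (-l) l
    · simp only [indicator_of_mem ht, Circle.smul_def, Real.fourierChar_apply, smul_eq_mul]
      rw [mul_comm]
      congr 2
      push_cast
      have : (Real.pi : ℂ) ≠ 0 := by exact_mod_cast Real.pi_ne_zero
      field_simp
    · simp only [indicator_of_notMem ht, smul_zero]
  have hfin : Tendsto (fun u : ℝ => ((∫ v, B v * (l * fejer (l * (u - v))) : ℝ) : ℂ))
      atTop (𝓝 ((0 : ℝ) : ℂ)) := by
    rw [Complex.ofReal_zero]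
    exact hRL.congr hlim
  exact tendsto_ofReal_iff.mp hfin

end PeterssonAverage

end

noncomputable section

namespace PeterssonAverage

open MeasureTheory Filter Topology Set

/-! ### From convergence of Fejér means to pointwise convergence. -/

/-- The part of the mass of the Fejér kernel on `[-A, A]`. -/
lemma tendsto_integral_fejer_Icc :
    Tendsto (fun A : ℝ => ∫ w in Icc (-A) A, fejer w) atTop (𝓝 (∫ w, fejer w)) :=
  (aecover_Icc tendsto_neg_atTop_atBot tendsto_id).integral_tendsto_of_countably_generated
    integrable_fejer

/-- A bounded function `S` with `exp t * S t` monotone converges as soon as its Fejér means do. -/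
theorem tendsto_one_of_fejer_mean {S : ℝ → ℝ} (hS : Measurable S) {C : ℝ} (h0 : ∀ v, 0 ≤ S v)
    (hC : ∀ v, S v ≤ C) (hmono : Monotone fun t => Real.exp t * S t)
    (hmean : ∀ l : ℝ, 0 < l → Tendsto (fun u : ℝ => ∫ w, S (u - w / l) * fejer w) atTop
      (𝓝 (∫ w, fejer w))) :
    Tendsto S atTop (𝓝 1) := by
  set J := ∫ w, fejer w with hJ
  have hJ0 : 0 < J := integral_fejer_pos
  set I : ℝ → ℝ := fun A => ∫ w in Icc (-A) A, fejer w with hI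
  have hIJ (A : ℝ) : I A ≤ J :=
    setIntegral_le_integral integrable_fejer (.of_forall fejer_nonneg)
  have hIt : Tendsto I atTop (𝓝 J) := tendsto_integral_fejer_Icc
  -- The Tauberian condition: `S` cannot drop faster than exponentially.
  have hcomp {s t : ℝ} (h : s ≤ t) : S s ≤ Real.exp (t - s) * S t := by
    have := hmono h
    simp only at this
    rw [Real.exp_sub, div_mul_eq_mul_div, le_div_iff₀ (Real.exp_pos _)]
    linarith
  have hint (u l : ℝ) : Integrable fun w => S (u - w / l) * fejer w := by
    have hm : AEStronglyMeasurable (fun w => S (u - w / l)) volume :=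
      (hS.comp (by fun_prop : Measurable fun w : ℝ => u - w / l)).aestronglyMeasurable
    exact integrable_fejer.bdd_mul hm (c := C) (.of_forall fun w => by
      rw [Real.norm_of_nonneg (h0 _)]; exact hC _)
  -- With the centre moved right to `u + A/l`, the mass on `|w| ≤ A` samples `S` only on `[u, u +
  -- 2A/l]`, where `S` is not much smaller than `S u`.
  have hupper {A l : ℝ} (hl : 0 < l) (u : ℝ) :
      S u * (Real.exp (-(2 * A / l)) * I A) ≤ ∫ w, S ((u + A / l) - w / l) * fejer w := by
    have h1 : ∫ w in Icc (-A) A, (S u * Real.exp (-(2 * A / l))) * fejer w ≤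
        ∫ w in Icc (-A) A, S ((u + A / l) - w / l) * fejer w := by
      refine setIntegral_mono_on (integrable_fejer.const_mul _).integrableOn
        (hint _ _).integrableOn measurableSet_Icc fun w hw => ?_
      refine mul_le_mul_of_nonneg_right ?_ (fejer_nonneg w)
      have hle : u ≤ u + A / l - w / l := by
        have : w / l ≤ A / l := div_le_div_of_nonneg_right hw.2 hl.le
        linarith
      have h2 := hcomp hle
      have h3 : Real.exp (u + A / l - w / l - u) ≤ Real.exp (2 * A / l) := by
        apply Real.exp_le_exp.mpr
        have : (-A) / l ≤ w / l := div_le_div_of_nonneg_right hw.1 hl.le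
        have h4 : (-A) / l = -(A / l) := neg_div _ _
        have h5 : 2 * A / l = 2 * (A / l) := by ring
        linarith
      have h4 := h2.trans (mul_le_mul_of_nonneg_right h3 (h0 _))
      rw [Real.exp_neg, ← div_eq_mul_inv, div_le_iff₀ (Real.exp_pos _)]
      linarith
    rw [integral_const_mul] at h1
    calc _ = S u * Real.exp (-(2 * A / l)) * I A := by ring
      _ ≤ _ := h1
      _ ≤ _ := setIntegral_le_integral (hint _ _) (.of_forall fun w =>
          mul_nonneg (h0 _) (fejer_nonneg w))
  -- With the centre moved left, the mass on `|w| ≤ A` samples `[u - 2A/l, u]`, where `S` is not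
  -- much larger than `S u`. The remaining mass is charged at the bound `C`.
  have hlower {A l : ℝ} (hl : 0 < l) (u : ℝ) :
      ∫ w, S ((u - A / l) - w / l) * fejer w ≤ S u * Real.exp (2 * A / l) * J + C * (J - I A) := by
    have hs := integral_add_compl (measurableSet_Icc (a := -A) (b := A)) (hint (u - A / l) l)
    have hs' := integral_add_compl (measurableSet_Icc (a := -A) (b := A)) integrable_fejer
    have h1 : ∫ w in Icc (-A) A, S ((u - A / l) - w / l) * fejer w ≤
        ∫ w in Icc (-A) A, (S u * Real.exp (2 * A / l)) * fejer w := by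
      refine setIntegral_mono_on (hint _ _).integrableOn
        (integrable_fejer.const_mul _).integrableOn measurableSet_Icc fun w hw => ?_
      refine mul_le_mul_of_nonneg_right ?_ (fejer_nonneg w)
      have hA : (-A) / l ≤ w / l := div_le_div_of_nonneg_right hw.1 hl.le
      have h4 : (-A) / l = -(A / l) := neg_div _ _
      have hA' : w / l ≤ A / l := div_le_div_of_nonneg_right hw.2 hl.le
      have h2 := hcomp (show u - A / l - w / l ≤ u by linarith)
      have h3 : Real.exp (u - (u - A / l - w / l)) ≤ Real.exp (2 * A / l) := by
        apply Real.exp_le_exp.mpr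
        have h5 : 2 * A / l = 2 * (A / l) := by ring
        linarith
      have h4 := h2.trans (mul_le_mul_of_nonneg_right h3 (h0 _))
      linarith
    have h2 : ∫ w in (Icc (-A) A)ᶜ, S ((u - A / l) - w / l) * fejer w ≤
        ∫ w in (Icc (-A) A)ᶜ, C * fejer w :=
      setIntegral_mono_on (hint _ _).integrableOn
        (integrable_fejer.const_mul _).integrableOn measurableSet_Icc.compl fun w _ =>
          mul_le_mul_of_nonneg_right (hC _) (fejer_nonneg w)
    rw [integral_const_mul] at h1 h2
    have h3 : ∫ w in (Icc (-A) A)ᶜ, fejer w = J - I A := by rw [hJ, hI]; linarith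
    have h4 : S u * Real.exp (2 * A / l) * I A ≤ S u * Real.exp (2 * A / l) * J :=
      mul_le_mul_of_nonneg_left (hIJ A) (mul_nonneg (h0 _) (Real.exp_pos _).le)
    rw [h3] at h2
    rw [← hs]
    linarith
  have hinv : Tendsto (fun A : ℝ => 1 / A) atTop (𝓝 0) := by
    simpa using tendsto_inv_atTop_zero (𝕜 := ℝ)
  have hexp (c : ℝ) : Tendsto (fun A : ℝ => Real.exp (c * (1 / A))) atTop (𝓝 1) := by
    have h1 : Tendsto (fun A : ℝ => c * (1 / A)) atTop (𝓝 (c * 0)) :=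
      hinv.const_mul c
    rw [mul_zero] at h1
    have := (Real.continuous_exp.tendsto 0).comp h1
    rwa [Real.exp_zero] at this
  have hU : Tendsto (fun A : ℝ => (J + 1 / A) / (Real.exp ((-2) * (1 / A)) * I A)) atTop (𝓝 1) := by
    have := (tendsto_const_nhds (x := J)).add hinv |>.div ((hexp (-2)).mul hIt)
      (by simpa using hJ0.ne')
    simpa [hJ0.ne'] using! this
  have hLo : Tendsto (fun A : ℝ => ((J - 1 / A) - C * (J - I A)) / (Real.exp (2 * (1 / A)) * J))
      atTop (𝓝 1) := by
    have := (((tendsto_const_nhds (x := J)).sub hinv).sub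
      (((tendsto_const_nhds (x := J)).sub hIt).const_mul C)).div ((hexp 2).mul_const J)
      (by simpa using hJ0.ne')
    simpa [hJ0.ne'] using! this
  -- The parameters are coupled by `l = A ^ 2`: as `A` grows, the sampled interval shrinks like
  -- `1/A` while `I A` exhausts the whole mass.
  have hquot {A : ℝ} (hA : 0 < A) : A / A ^ 2 = 1 / A := by field_simp
  rw [tendsto_order]
  constructor
  · intro a ha
    obtain ⟨A, hA, hA0⟩ := ((hLo.eventually (lt_mem_nhds ha)).and (eventually_gt_atTop 0)).exists
    have hl : 0 < A ^ 2 := by positivity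
    have hm := (hmean (A ^ 2) hl).comp (tendsto_atTop_add_const_right _ (-(A / A ^ 2)) tendsto_id)
    have hm' := hm.eventually (lt_mem_nhds (show J - 1 / A < J by
      have : 0 < 1 / A := by positivity
      linarith))
    filter_upwards [hm'] with u hu
    have h1 := hlower (A := A) hl u
    simp only [Function.comp, id, ← sub_eq_add_neg] at hu
    have h2 : 2 * A / A ^ 2 = 2 * (1 / A) := by rw [← hquot hA0]; ring
    rw [h2] at h1
    refine hA.trans_le ?_
    rw [div_le_iff₀ (by positivity)]
    linarith
  · intro a ha
    obtain ⟨A, hA, hA0, hAI⟩ := ((hU.eventually (gt_mem_nhds ha)).and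
      ((eventually_gt_atTop 0).and (hIt.eventually (lt_mem_nhds hJ0)))).exists
    have hl : 0 < A ^ 2 := by positivity
    have hm := (hmean (A ^ 2) hl).comp (tendsto_atTop_add_const_right _ (A / A ^ 2) tendsto_id)
    have hm' := hm.eventually (gt_mem_nhds (show J < J + 1 / A by
      have : 0 < 1 / A := by positivity
      linarith))
    filter_upwards [hm'] with u hu
    have h1 := hupper (A := A) hl u
    simp only [Function.comp, id] at hu
    have h2 : -(2 * A / A ^ 2) = (-2) * (1 / A) := by rw [← hquot hA0]; ring
    rw [h2] at h1
    refine lt_of_le_of_lt ?_ hA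
    rw [le_div_iff₀ (by positivity)]
    linarith

/-! ### The prime number theorem -/

/-- The normalized Chebyshev function `ψ (exp t) / exp t`. -/
def psiExp (t : ℝ) : ℝ := Chebyshev.psi (Real.exp t) * Real.exp (-t)

lemma measurable_psiExp : Measurable psiExp :=
  (Chebyshev.psi_mono.measurable.comp Real.measurable_exp).mul (by fun_prop)

lemma psiExp_nonneg (t : ℝ) : 0 ≤ psiExp t :=
  mul_nonneg (Chebyshev.psi_nonneg _) (Real.exp_pos _).le

lemma psiExp_le (t : ℝ) : psiExp t ≤ Real.log 4 + 4 := by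
  have h := Chebyshev.psi_le_const_mul_self (Real.exp_pos t).le
  unfold psiExp
  rw [Real.exp_neg, ← div_eq_mul_inv, div_le_iff₀ (Real.exp_pos t)]
  exact h

lemma psiExp_of_neg {t : ℝ} (ht : t < 0) : psiExp t = 0 := by
  unfold psiExp
  rw [Chebyshev.psi_eq_zero_of_le_one (Real.exp_le_one_iff.mpr ht.le), zero_mul]

lemma monotone_exp_mul_psiExp : Monotone fun t => Real.exp t * psiExp t := by
  have : (fun t => Real.exp t * psiExp t) = fun t => Chebyshev.psi (Real.exp t) := by
    funext t
    unfold psiExp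
    rw [mul_left_comm, ← Real.exp_add, add_neg_cancel, Real.exp_zero, mul_one]
  rw [this]
  exact fun a b h => Chebyshev.psi_mono (Real.exp_le_exp.mpr h)

open ArithmeticFunction.vonMangoldt in
/-- The regularized Laplace transform of `psiExp`, on the closed half-plane. -/
lemma laplace_psiExp {s : ℂ} (hs : 0 < s.re) :
    ∫ v in Ioi (0:ℝ), (psiExp v : ℂ) * Complex.exp (-s * v) =
      (LFunctionResidueClassAux (1 : ZMod 1) (1 + s) + 1 / s) / (1 + s) := by
  have hs1 : 1 < (1 + s).re := by simpa using hs
  have hne : (1 + s) ≠ 0 := fun h => by rw [h] at hs1; norm_num at hs1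
  have hpsi (x : ℝ) : ∑ k ∈ Finset.Icc 1 ⌊x⌋₊, ArithmeticFunction.vonMangoldt k = Chebyshev.psi x := rfl
  -- The Dirichlet series of `Λ` as a Mellin transform of `ψ`; Chebyshev's bound supplies the growth
  -- condition.
  have hL := LSeries_eq_mul_integral_of_nonneg (fun n => ArithmeticFunction.vonMangoldt n) zero_le_one (s := 1 + s) hs1
    (by
      have := Asymptotics.IsBigO.of_bound (Real.log 4 + 4) (f := fun n : ℕ =>
        ∑ k ∈ Finset.Icc 1 n, ArithmeticFunction.vonMangoldt k) (g := fun n : ℕ => (n:ℝ) ^ (1:ℝ)) (l := atTop)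
        (.of_forall fun n => ?_)
      · exact this
      · have h := Chebyshev.psi_le_const_mul_self (Nat.cast_nonneg (α := ℝ) n)
        have h' := Chebyshev.psi_nonneg (n : ℝ)
        rw [← hpsi, Nat.floor_natCast] at h h'
        rw [Real.norm_of_nonneg h', Real.rpow_one, Real.norm_of_nonneg (by positivity)]
        exact h) (fun n => ArithmeticFunction.vonMangoldt_nonneg)
  have hA := eqOn_LFunctionResidueClassAux (q := 1) (a := 1) isUnit_one hs1
  -- Modulo `1` there is a single residue class, so the restricted von Mangoldt function is `Λ`
  -- itself.
  have hres : (fun n : ℕ => ((residueClass (1 : ZMod 1) n : ℝ) : ℂ)) = fun n => ((ArithmeticFunction.vonMangoldt n : ℝ) : ℂ) := by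
    funext n
    have : ((n : ZMod 1)) = 1 := Subsingleton.elim _ _
    simp [residueClass, this]
  simp only [hres, Nat.totient_one, Nat.cast_one, inv_one, add_sub_cancel_left] at hA
  have hcv := integral_comp_exp_Ioi (fun x : ℝ => ((Chebyshev.psi x : ℝ) : ℂ) * (x : ℂ) ^ (-(1 + s + 1))) 0
  rw [Real.exp_zero] at hcv
  have e1 : ∫ t in Ioi (1:ℝ), (∑ k ∈ Finset.Icc 1 ⌊t⌋₊, ((ArithmeticFunction.vonMangoldt k : ℝ) : ℂ)) * (t:ℂ) ^ (-(1 + s + 1)) =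
      ∫ v in Ioi (0:ℝ), (psiExp v : ℂ) * Complex.exp (-s * v) := by
    simp only [← Complex.ofReal_sum, hpsi]
    rw [← hcv]
    refine integral_congr_ae (.of_forall fun v => ?_)
    simp only [psiExp]
    rw [Complex.ofReal_exp, Complex.cpow_def_of_ne_zero (Complex.exp_ne_zero _),
      ← Complex.ofReal_exp, ← Complex.ofReal_log (Real.exp_pos _).le, Real.log_exp]
    rw [Complex.real_smul]
    push_cast
    have : Complex.exp v * Complex.exp (v * (-(1 + s + 1))) =
      Complex.exp (-v) * Complex.exp (-s * v) := by
      rw [← Complex.exp_add, ← Complex.exp_add]; congr 1; ring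
    linear_combination (Chebyshev.psi (Real.exp v) : ℂ) * this
  rw [e1] at hL
  rw [hA, sub_add_cancel, hL, mul_div_cancel_left₀ _ hne]

lemma integral_mul_fejer_scaled (X : ℝ → ℝ) {l : ℝ} (hl : 0 < l) (u : ℝ) :
    ∫ v, X v * (l * fejer (l * (u - v))) = ∫ w, X (u - w / l) * fejer w := by
  have h1 := integral_sub_left_eq_self (fun v => X (u - v) * (l * fejer (l * v))) volume u
  simp only [sub_sub_cancel] at h1
  have h2 := Measure.integral_comp_mul_left (fun w => l * (X (u - w / l) * fejer w)) l
  rw [smul_eq_mul, abs_of_pos (inv_pos.mpr hl), integral_const_mul (μ := volume) l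
    (fun w => X (u - w / l) * fejer w), ← mul_assoc, inv_mul_cancel₀ hl.ne', one_mul] at h2
  rw [h1, ← h2]
  refine integral_congr_ae (.of_forall fun v => ?_)
  simp only [mul_div_cancel_left₀ _ hl.ne']
  ring

/-- The Tauberian theorem is applied to `psiExp` minus the indicator of `(0, ∞)`. The indicator has
Laplace transform `1/s`, which cancels the pole at `s = 0`, and its own Fejér means tend to the full
mass. -/
lemma tendsto_psiExp : Tendsto psiExp atTop (𝓝 1) := by
  refine tendsto_one_of_fejer_mean measurable_psiExp psiExp_nonneg psiExp_le
    monotone_exp_mul_psiExp fun l hl => ?_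
  set E : ℝ → ℝ := (Ioi (0:ℝ)).indicator fun _ => 1 with hE
  have hEm : Measurable E := measurable_const.indicator measurableSet_Ioi
  have hE0 (v : ℝ) : 0 ≤ E v := indicator_nonneg (fun _ _ => zero_le_one) v
  have hE1 (v : ℝ) : E v ≤ 1 := indicator_le_self' (fun _ _ => zero_le_one) v
  have hmean := tendsto_fejer_mean (B := fun v => psiExp v - E v)
    (C := Real.log 4 + 4 + 1) (measurable_psiExp.sub hEm) (fun v => by
      have h1 := psiExp_nonneg v
      have h2 := psiExp_le v
      have h3 := hE0 v
      have h4 := hE1 v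
      rw [abs_le]; constructor <;> linarith)
    (fun v hv => by
      simp only [psiExp_of_neg hv, hE]
      rw [indicator_of_notMem (by simpa using hv.le), sub_zero])
    (G := fun s => (ArithmeticFunction.vonMangoldt.LFunctionResidueClassAux (1 : ZMod 1) (1 + s)
      - 1) / (1 + s)) ?_ ?_ hl
  · have hb (X : ℝ → ℝ) (hX : Measurable X) (c : ℝ) (h0 : ∀ v, 0 ≤ X v) (hc : ∀ v, X v ≤ c)
        (u : ℝ) : Integrable fun w => X (u - w / l) * fejer w := by
      have hm : AEStronglyMeasurable (fun w => X (u - w / l)) volume :=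
        (hX.comp (by fun_prop : Measurable fun w : ℝ => u - w / l)).aestronglyMeasurable
      exact integrable_fejer.bdd_mul hm (c := c) (.of_forall fun w => by
        rw [Real.norm_of_nonneg (h0 _)]; exact hc _)
    have hEt : Tendsto (fun u : ℝ => ∫ w, E (u - w / l) * fejer w) atTop (𝓝 (∫ w, fejer w)) := by
      refine tendsto_integral_filter_of_dominated_convergence fejer
        (.of_forall fun u => (hb E hEm 1 hE0 hE1 u).aestronglyMeasurable) ?_ integrable_fejer ?_
      · refine .of_forall fun u => .of_forall fun w => ?_
        rw [norm_mul, Real.norm_of_nonneg (hE0 _), Real.norm_of_nonneg (fejer_nonneg _)]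
        exact mul_le_of_le_one_left (fejer_nonneg _) (hE1 _)
      · refine .of_forall fun w => tendsto_const_nhds.congr' ?_
        filter_upwards [eventually_gt_atTop (w / l)] with u hu
        rw [hE, indicator_of_mem (show u - w / l ∈ Ioi 0 by simpa using hu), one_mul]
    have := hmean.add hEt
    rw [zero_add] at this
    refine this.congr fun u => ?_
    rw [integral_mul_fejer_scaled _ hl, ← integral_add _ (hb E hEm 1 hE0 hE1 u)]
    · refine integral_congr_ae (.of_forall fun w => ?_)
      simp only; ring
    · have := (hb psiExp measurable_psiExp _ psiExp_nonneg psiExp_le u).sub (hb E hEm 1 hE0 hE1 u)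
      refine this.congr (.of_forall fun w => ?_)
      simp only [Pi.sub_apply]; ring
  -- This continuity up to `Re s = 1` is where the non-vanishing of `ζ` on that line enters.
  · have hc := ArithmeticFunction.vonMangoldt.continuousOn_LFunctionResidueClassAux (1 : ZMod 1)
    refine ContinuousOn.div (ContinuousOn.sub (hc.comp (by fun_prop) fun s hs => ?_)
      continuousOn_const) (by fun_prop) fun s hs h => ?_
    · simpa using hs
    · have : (1 + s).re = 0 := by rw [h]; rfl
      simp only [Complex.add_re, Complex.one_re] at this
      have : 0 ≤ s.re := hs
      linarith
  · intro s hs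
    have hs0 : s ≠ 0 := fun h => by rw [h] at hs; simp at hs
    have hs1 : 1 + s ≠ 0 := fun h => by
      have : (1 + s).re = 0 := by rw [h]; rfl
      simp only [Complex.add_re, Complex.one_re] at this
      linarith
    have hi : IntegrableOn (fun v : ℝ => Complex.exp (-s * v)) (Ioi 0) :=
      integrableOn_exp_mul_complex_Ioi (by simpa using hs) 0
    have hi2 : IntegrableOn (fun v : ℝ => (psiExp v : ℂ) * Complex.exp (-s * v)) (Ioi 0) := by
      refine hi.bdd_mul (c := Real.log 4 + 4)
        (Complex.measurable_ofReal.comp measurable_psiExp).aestronglyMeasurable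
        (.of_forall fun v => ?_)
      rw [Complex.norm_real, Real.norm_of_nonneg (psiExp_nonneg v)]
      exact psiExp_le v
    have e : ∀ v : ℝ, ((psiExp v - E v : ℝ) : ℂ) * Complex.exp (-s * v) =
        (Ioi (0:ℝ)).indicator (fun v : ℝ => (psiExp v : ℂ) * Complex.exp (-s * v)
          - Complex.exp (-s * v)) v := by
      intro v
      by_cases hv : 0 < v
      · rw [indicator_of_mem (show v ∈ Ioi (0:ℝ) from hv), hE,
          indicator_of_mem (show v ∈ Ioi (0:ℝ) from hv)]
        push_cast; ring
      · rw [indicator_of_notMem (show v ∉ Ioi (0:ℝ) from hv), hE,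
          indicator_of_notMem (show v ∉ Ioi (0:ℝ) from hv)]
        have : psiExp v = 0 := by
          unfold psiExp
          rw [Chebyshev.psi_eq_zero_of_le_one (Real.exp_le_one_iff.mpr (not_lt.mp hv)), zero_mul]
        rw [this]; simp
    rw [integral_congr_ae (.of_forall e), integral_indicator measurableSet_Ioi,
      integral_sub hi2 hi, laplace_psiExp hs, integral_exp_mul_complex_Ioi (by simpa using hs)]
    simp only [Complex.ofReal_zero, mul_zero, Complex.exp_zero]
    field_simp
    ring

/-- The prime number theorem for Chebyshev's function `ψ`. -/
theorem tendsto_psi_div : Tendsto (fun x : ℝ => Chebyshev.psi x / x) atTop (𝓝 1) := by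
  refine (tendsto_psiExp.comp Real.tendsto_log_atTop).congr' ?_
  filter_upwards [eventually_gt_atTop 0] with x hx
  simp only [Function.comp, psiExp, Real.exp_neg, Real.exp_log hx, div_eq_mul_inv]

/-- The prime number theorem. -/
theorem tendsto_primeCounting_mul_log_div :
    Tendsto (fun x : ℝ => (Nat.primeCounting ⌊x⌋₊ : ℝ) * Real.log x / x) atTop (𝓝 1) := by
  have hlog : Tendsto (fun x : ℝ => 1 / Real.log x) atTop (𝓝 0) := by
    simpa using! tendsto_inv_atTop_zero.comp Real.tendsto_log_atTop
  have h1 : Tendsto (fun x : ℝ => (Chebyshev.psi x - Chebyshev.theta x) / x) atTop (𝓝 0) := by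
    have ho : (Chebyshev.psi - Chebyshev.theta) =o[atTop] (fun x : ℝ => x) := by
      refine Chebyshev.isBigO_psi_sub_theta_sqrt.trans_isLittleO ?_
      rw [Asymptotics.isLittleO_iff_tendsto' (by
        filter_upwards [eventually_gt_atTop 0] with x hx h using absurd h hx.ne')]
      refine (tendsto_inv_atTop_zero.comp Real.tendsto_sqrt_atTop).congr fun x => ?_
      rw [Real.sqrt_div_self, Function.comp]
    exact ho.tendsto_div_nhds_zero
  have h2 : Tendsto (fun x : ℝ => Chebyshev.theta x / x) atTop (𝓝 1) := by
    have := tendsto_psi_div.sub h1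
    rw [sub_zero] at this
    exact this.congr fun x => by ring
  have h3 : Tendsto (fun x : ℝ => ((Nat.primeCounting ⌊x⌋₊ : ℝ) -
      Chebyshev.theta x / Real.log x) / (x / Real.log x)) atTop (𝓝 0) := by
    refine Asymptotics.IsLittleO.tendsto_div_nhds_zero ?_
    refine Chebyshev.primeCounting_sub_theta_div_log_isBigO.trans_isLittleO ?_
    rw [Asymptotics.isLittleO_iff_tendsto']
    · refine hlog.congr' ?_
      filter_upwards [eventually_gt_atTop 1] with x hx
      have := Real.log_pos hx
      field_simp
    · filter_upwards [eventually_gt_atTop 1] with x hx h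
      have := Real.log_pos hx
      have : 0 < x / Real.log x := by positivity
      exact absurd h this.ne'
  have := h3.add h2
  rw [zero_add] at this
  refine this.congr' ?_
  filter_upwards [eventually_gt_atTop 1] with x hx
  have := Real.log_pos hx
  field_simp
  ring

end PeterssonAverage

end

noncomputable section

namespace PeterssonAverage

open Filter Topology Finset

/-! ### Primes in short intervals -/

lemma tendsto_sum_inv_primesBelow :
    Tendsto (fun n : ℕ => ∑ p ∈ n.primesBelow, (1 / p : ℝ)) atTop atTop := by
  have h0 : ∀ n : ℕ, 0 ≤ Set.indicator {p : ℕ | p.Prime} (fun n : ℕ => (1 : ℝ) / n) n :=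
    fun n => Set.indicator_nonneg (fun _ _ => by positivity) n
  refine ((not_summable_iff_tendsto_nat_atTop_of_nonneg h0).mp
    not_summable_one_div_on_primes).congr fun n => ?_
  rw [Nat.primesBelow_eq_filter_range, sum_filter]
  exact sum_congr rfl fun p _ => by simp [Set.indicator_apply]

/-- The ratio is `∏ (1 - 1/p) ≤ exp(-∑ 1/p)`, and the sum of reciprocals of primes diverges. -/
lemma tendsto_totient_primorial_div :
    Tendsto (fun n : ℕ => (Nat.totient (primorial n) : ℝ) / primorial n) atTop (𝓝 0) := by
  have hup : Tendsto (fun n : ℕ => Real.exp (-∑ p ∈ (n + 1).primesBelow, (1 / p : ℝ)))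
      atTop (𝓝 0) :=
    Real.tendsto_exp_atBot.comp (tendsto_neg_atTop_atBot.comp
      (tendsto_sum_inv_primesBelow.comp (tendsto_add_atTop_nat 1)))
  refine squeeze_zero (fun n => by positivity) (fun n => ?_) hup
  have hpos : (0 : ℝ) < primorial n := by exact_mod_cast primorial_pos n
  have h := Nat.totient_eq_mul_prod_factors (primorial n)
  have h' : (Nat.totient (primorial n) : ℝ) =
      primorial n * ∏ p ∈ (n + 1).primesBelow, (1 - (p : ℝ)⁻¹) := by
    rw [primeFactors_primorial] at h
    have h2 := congrArg (fun q : ℚ => (q : ℝ)) h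
    push_cast at h2
    exact h2
  rw [h', mul_div_cancel_left₀ _ hpos.ne', ← sum_neg_distrib, Real.exp_sum]
  refine prod_le_prod (fun p hp => ?_) fun p hp => ?_
  · have : (1 : ℝ) ≤ p := by exact_mod_cast (Nat.prime_of_mem_primesBelow hp).one_lt.le
    linarith [inv_le_one_of_one_le₀ this]
  · have := Real.add_one_le_exp (-(1 / p : ℝ))
    rw [one_div] at this ⊢
    linarith

/-- The primes `p` with `n - y ≤ p ≤ n`. -/
def primeWindow (n : ℕ) (y : ℝ) : Finset ℕ :=
  (Icc 1 n).filter (fun p : ℕ => p.Prime ∧ (n : ℝ) - y ≤ (p : ℝ))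

lemma primeWindow_subset (n : ℕ) (y : ℝ) :
    primeWindow n y ⊆ Icc (n - ⌊y⌋₊) n := by
  intro p hp
  simp only [primeWindow, mem_filter, mem_Icc] at hp ⊢
  refine ⟨?_, hp.1.2⟩
  have h : ((n - p : ℕ) : ℝ) ≤ y := by rw [Nat.cast_sub hp.1.2]; linarith
  have := Nat.le_floor h
  omega

lemma card_primeWindow_le (n : ℕ) {y : ℝ} (hy : 0 ≤ y) :
    ((primeWindow n y).card : ℝ) ≤ y + 1 := by
  have h := card_le_card (primeWindow_subset n y)
  rw [Nat.card_Icc] at h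
  have h2 : (primeWindow n y).card ≤ ⌊y⌋₊ + 1 := by omega
  have h3 : ((primeWindow n y).card : ℝ) ≤ ⌊y⌋₊ + 1 := by exact_mod_cast h2
  linarith [Nat.floor_le hy]

/-- A sieve bound for the number of primes in a short interval. -/
lemma card_primeWindow_le_sieve (n : ℕ) (y : ℝ) {a : ℕ} (ha : a ≠ 0) :
    (primeWindow n y).card ≤ (a + 1) + Nat.totient a * ((⌊y⌋₊ + 1) / a + 1) := by
  set k := max (n - ⌊y⌋₊) (a + 1) with hk
  have hsub : primeWindow n y ⊆ range (a + 1) ∪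
      ((Ico k (k + (⌊y⌋₊ + 1))).filter fun b => a.Coprime b) := by
    intro p hp
    have h1 := primeWindow_subset n y hp
    simp only [primeWindow, mem_filter, mem_Icc] at hp h1
    simp only [mem_union, mem_range, mem_filter, mem_Ico]
    by_cases hpa : p < a + 1
    · exact Or.inl hpa
    · refine Or.inr ⟨⟨?_, ?_⟩, ?_⟩
      · omega
      · omega
      · rw [Nat.coprime_comm]
        exact Nat.coprime_of_lt_prime ha (by omega) hp.2.1
  calc _ ≤ _ := card_le_card hsub
    _ ≤ _ := card_union_le _ _
    _ ≤ _ := by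
      rw [card_range]
      exact Nat.add_le_add_left (Nat.Ico_filter_coprime_le k _ ha) _

/-- Sieve by a primorial `a` with `φ(a)/a < ε/2`, fixed before `y` grows. The trivial bound `y + 1`
would just fail later: multiplied by `π(N)` exceptional `n` it gives `O(N)`, where `o(N)` is
required. -/
lemma eventually_card_primeWindow_le {ε : ℝ} (hε : 0 < ε) :
    ∀ᶠ y : ℝ in atTop, ∀ n, ((primeWindow n y).card : ℝ) ≤ ε * y := by
  obtain ⟨m, hm⟩ := (tendsto_totient_primorial_div.eventually (gt_mem_nhds (half_pos hε))).exists
  set a := primorial m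
  have ha : a ≠ 0 := primorial_ne_zero m
  have ha' : (0 : ℝ) < a := by positivity
  filter_upwards [eventually_ge_atTop (0 : ℝ),
    eventually_ge_atTop (2 * (a + 1 + ε / 2 + Nat.totient a) / ε)] with y hy hy2 n
  have h := card_primeWindow_le_sieve n y ha
  have h' : ((primeWindow n y).card : ℝ) ≤
      (a + 1) + Nat.totient a * (((⌊y⌋₊ + 1) / a : ℕ) + 1) := by exact_mod_cast h
  have hd : (((⌊y⌋₊ + 1) / a : ℕ) : ℝ) ≤ (y + 1) / a := by
    refine Nat.cast_div_le.trans ?_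
    push_cast
    gcongr
    exact Nat.floor_le hy
  rw [div_le_iff₀ hε] at hy2
  have h3 : (Nat.totient a : ℝ) * (((⌊y⌋₊ + 1) / a : ℕ) + 1) ≤
      ε / 2 * (y + 1) + Nat.totient a := by
    calc _ ≤ (Nat.totient a : ℝ) * ((y + 1) / a + 1) := by gcongr
      _ = (Nat.totient a : ℝ) / a * (y + 1) + Nat.totient a := by ring
      _ ≤ _ := by gcongr
  nlinarith

/-- Whether the left end point of the window is a prime. -/
lemma card_primeWindow_eq (n : ℕ) {y : ℝ} (hy : 0 ≤ y) :
    ((primeWindow n y).card : ℝ) = primePi n - primePi (n - y) +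
      (((Icc 1 n).filter fun p : ℕ => p.Prime ∧ (p : ℝ) = n - y).card : ℝ) := by
  have h1 : primePi n = (((Icc 1 n).filter fun p : ℕ => p.Prime).card : ℝ) := by
    rw [primePi, Nat.floor_natCast, ← Nat.primesLE_card_eq_primeCounting,
      Nat.primesLE_eq_filter_Icc_one]
  have h2 : primePi (n - y) = (((Icc 1 n).filter fun p : ℕ => p.Prime ∧ (p : ℝ) ≤ n - y).card : ℝ) := by
    rw [primePi, ← Nat.primesLE_card_eq_primeCounting]
    congr 2
    ext p
    simp only [Nat.mem_primesLE, mem_filter, mem_Icc]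
    constructor
    · rintro ⟨h, hp⟩
      have h0 := (Nat.le_floor_iff' hp.ne_zero).mp h
      refine ⟨⟨hp.one_lt.le, ?_⟩, hp, h0⟩
      have : (p : ℝ) ≤ n := by linarith
      exact_mod_cast this
    · rintro ⟨_, hp, h⟩
      exact ⟨Nat.le_floor h, hp⟩
  -- The window and the primes up to `n - y` cover all primes up to `n` and overlap exactly in a
  -- prime left end point.
  have h3 : ((Icc 1 n).filter fun p : ℕ => p.Prime).card +
      ((Icc 1 n).filter fun p : ℕ => p.Prime ∧ (p : ℝ) = n - y).card =
      (primeWindow n y).card + ((Icc 1 n).filter fun p : ℕ => p.Prime ∧ (p : ℝ) ≤ n - y).card := by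
    rw [primeWindow, ← card_union_add_card_inter, ← card_union_add_card_inter (s := filter _ _)]
    congr 2 <;> ext p <;> simp only [mem_union, mem_inter, mem_filter, mem_Icc]
    · constructor
      · rintro (⟨h, hp⟩ | ⟨h, hp, _⟩)
        · rcases le_total (p : ℝ) (n - y) with h' | h'
          · exact Or.inr ⟨h, hp, h'⟩
          · exact Or.inl ⟨h, hp, h'⟩
        · exact Or.inr ⟨h, hp, by linarith⟩
      · rintro (⟨h, hp, _⟩ | ⟨h, hp, _⟩) <;> exact Or.inl ⟨h, hp⟩
    · constructor
      · rintro ⟨_, h, hp, he⟩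
        exact ⟨⟨h, hp, he.ge⟩, h, hp, he.le⟩
      · rintro ⟨⟨h, hp, h1⟩, _, _, h2⟩
        exact ⟨⟨h, hp⟩, h, hp, le_antisymm h2 h1⟩
  have h4 := congrArg (fun k : ℕ => (k : ℝ)) h3
  push_cast at h4
  rw [h1, h2]
  linarith

/-- Few windows with right end point at most `m` have a prime as left end point. -/
lemma sum_card_endpoint_le (m : ℕ) (y : ℝ) :
    ∑ n ∈ Icc 1 m, ((Icc 1 n).filter fun p : ℕ => p.Prime ∧ (p : ℝ) = n - y).card ≤
      Nat.primeCounting m := by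
  rw [← card_sigma, ← Nat.primesLE_card_eq_primeCounting]
  refine card_le_card_of_injOn (fun x => x.2) (fun x hx => ?_) fun x hx x' hx' h => ?_
  · simp only [coe_sigma, Set.mem_sigma_iff, mem_coe, mem_filter, mem_Icc] at hx
    exact Nat.mem_primesLE.mpr ⟨hx.2.1.2.trans hx.1.2, hx.2.2.1⟩
  · simp only [coe_sigma, Set.mem_sigma_iff, mem_coe, mem_filter, mem_Icc] at hx hx'
    obtain ⟨n, p⟩ := x
    obtain ⟨n', p'⟩ := x'
    simp only at h hx hx'
    subst h
    have : (n : ℝ) = n' := by linarith [hx.2.2.2, hx'.2.2.2]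
    have : n = n' := by exact_mod_cast this
    subst this
    rfl

lemma sum_card_primeWindow (m : ℕ) (y : ℝ) :
    ∑ n ∈ Icc 1 m, (primeWindow n y).card =
      ∑ p ∈ Nat.primesLE m, ((Icc p m).filter fun n : ℕ => (n : ℝ) - y ≤ p).card := by
  simp only [card_eq_sum_ones]
  refine sum_comm' fun n p => ?_
  simp only [primeWindow, mem_filter, mem_Icc, Nat.mem_primesLE]
  constructor
  · rintro ⟨⟨_, h2⟩, ⟨_, h4⟩, hp, h5⟩
    exact ⟨⟨⟨h4, h2⟩, h5⟩, h4.trans h2, hp⟩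
  · rintro ⟨⟨⟨h1, h2⟩, h3⟩, _, hp⟩
    exact ⟨⟨hp.one_lt.le.trans h1, h2⟩, ⟨hp.one_lt.le, h1⟩, hp, h3⟩

/-- Double counting: a prime `p` lies only in windows with `p ≤ n ≤ p + y`. -/
lemma sum_card_primeWindow_le (m : ℕ) {y : ℝ} (hy : 0 ≤ y) :
    (∑ n ∈ Icc 1 m, (primeWindow n y).card : ℝ) ≤ Nat.primeCounting m * (y + 1) := by
  have h := sum_card_primeWindow m y
  have h' : (∑ n ∈ Icc 1 m, (primeWindow n y).card : ℝ) =
    ∑ p ∈ Nat.primesLE m, (((Icc p m).filter fun n : ℕ => (n : ℝ) - y ≤ p).card : ℝ) := by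
    exact_mod_cast h
  rw [h', ← Nat.primesLE_card_eq_primeCounting, ← nsmul_eq_mul]
  refine sum_le_card_nsmul _ _ _ fun p _ => ?_
  have hs : ((Icc p m).filter fun n : ℕ => (n : ℝ) - y ≤ p) ⊆ Icc p (p + ⌊y⌋₊) := by
    intro n hn
    simp only [mem_filter, mem_Icc] at hn ⊢
    refine ⟨hn.1.1, ?_⟩
    have h : ((n - p : ℕ) : ℝ) ≤ y := by rw [Nat.cast_sub hn.1.1]; linarith
    have := Nat.le_floor h
    omega
  have h1 := card_le_card hs
  rw [Nat.card_Icc] at h1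
  have h2 : ((Icc p m).filter fun n : ℕ => (n : ℝ) - y ≤ p).card ≤ ⌊y⌋₊ + 1 := by omega
  have h3 : (((Icc p m).filter fun n : ℕ => (n : ℝ) - y ≤ p).card : ℝ) ≤ ⌊y⌋₊ + 1 := by
    exact_mod_cast h2
  linarith [Nat.floor_le hy]

/-- A prime up to `m - ⌊y⌋` lies in at least `⌊y⌋ + 1 ≥ y` windows, and at most `⌊y⌋` primes lie
beyond that point. -/
lemma le_sum_card_primeWindow (m : ℕ) {y : ℝ} (hy : 0 ≤ y) :
    (Nat.primeCounting m - y) * y ≤ (∑ n ∈ Icc 1 m, (primeWindow n y).card : ℝ) := by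
  have h := sum_card_primeWindow m y
  have h' : (∑ n ∈ Icc 1 m, (primeWindow n y).card : ℝ) =
    ∑ p ∈ Nat.primesLE m, (((Icc p m).filter fun n : ℕ => (n : ℝ) - y ≤ p).card : ℝ) := by
    exact_mod_cast h
  set s := (Nat.primesLE m).filter fun p => p + ⌊y⌋₊ ≤ m with hs
  have h1 : (Nat.primeCounting m : ℝ) - y ≤ s.card := by
    have : Nat.primesLE m ⊆ s ∪ Ioc (m - ⌊y⌋₊) m := by
      intro p hp
      have := (Nat.mem_primesLE.mp hp).1
      have := (Nat.mem_primesLE.mp hp).2.pos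
      simp only [hs, mem_union, mem_filter, mem_Ioc]
      by_cases h : p + ⌊y⌋₊ ≤ m
      · exact Or.inl ⟨hp, h⟩
      · exact Or.inr (by omega)
    have h1 := (card_le_card this).trans (card_union_le _ _)
    rw [Nat.primesLE_card_eq_primeCounting, Nat.card_Ioc] at h1
    have h2 : Nat.primeCounting m ≤ s.card + ⌊y⌋₊ := by omega
    have h3 : (Nat.primeCounting m : ℝ) ≤ s.card + ⌊y⌋₊ := by exact_mod_cast h2
    linarith [Nat.floor_le hy]
  have h2 : (s.card : ℝ) * y ≤
      ∑ p ∈ Nat.primesLE m, (((Icc p m).filter fun n : ℕ => (n : ℝ) - y ≤ p).card : ℝ) := by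
    rw [← nsmul_eq_mul]
    refine (card_nsmul_le_sum s _ _ fun p hp => ?_).trans
      (sum_le_sum_of_subset_of_nonneg (filter_subset _ _) fun _ _ _ => by positivity)
    simp only [hs, mem_filter] at hp
    have hsub : Icc p (p + ⌊y⌋₊) ⊆ (Icc p m).filter fun n : ℕ => (n : ℝ) - y ≤ p := by
      intro n hn
      simp only [mem_filter, mem_Icc] at hn ⊢
      refine ⟨⟨hn.1, hn.2.trans hp.2⟩, ?_⟩
      have : (n : ℝ) ≤ p + ⌊y⌋₊ := by exact_mod_cast hn.2
      linarith [Nat.floor_le hy]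
    have h1 := card_le_card hsub
    rw [Nat.card_Icc] at h1
    have h2 : ⌊y⌋₊ + 1 ≤ ((Icc p m).filter fun n : ℕ => (n : ℝ) - y ≤ p).card := by omega
    have h3 : (⌊y⌋₊ + 1 : ℝ) ≤ ((Icc p m).filter fun n : ℕ => (n : ℝ) - y ≤ p).card := by
      exact_mod_cast h2
    linarith [Nat.lt_floor_add_one y]
  rw [h']
  exact (mul_le_mul_of_nonneg_right h1 hy).trans h2

/-- The sum is `π(N) · η log N` up to lower order, so this is the prime number theorem. It evaluates
the diagonal `p = q` of the second moment. -/
lemma tendsto_sum_card_primeWindow_div {η : ℝ} (hη : 0 < η) :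
    Tendsto (fun N : ℝ => (∑ n ∈ Icc 1 ⌊N⌋₊, ((primeWindow n (η * Real.log N)).card : ℝ)) / N)
      atTop (𝓝 η) := by
  have hpi := tendsto_primeCounting_mul_log_div
  have hlog : Tendsto (fun N : ℝ => Real.log N ^ 2 / N) atTop (𝓝 0) :=
    Real.isLittleO_pow_log_id_atTop.tendsto_div_nhds_zero
  have hlog' : Tendsto (fun x : ℝ => (Real.log x)⁻¹) atTop (𝓝 0) :=
    tendsto_inv_atTop_zero.comp Real.tendsto_log_atTop
  have hlo : Tendsto (fun N : ℝ => η * ((Nat.primeCounting ⌊N⌋₊ : ℝ) * Real.log N / N)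
      - η ^ 2 * (Real.log N ^ 2 / N)) atTop (𝓝 η) := by
    simpa using (hpi.const_mul η).sub (hlog.const_mul (η ^ 2))
  have hup : Tendsto (fun N : ℝ => ((Nat.primeCounting ⌊N⌋₊ : ℝ) * Real.log N / N)
      * (η + (Real.log N)⁻¹)) atTop (𝓝 η) := by
    simpa using hpi.mul (hlog'.const_add η)
  refine tendsto_of_tendsto_of_tendsto_of_le_of_le' hlo hup ?_ ?_
  · filter_upwards [eventually_gt_atTop 1] with N hN
    have hl := Real.log_pos hN
    have hN0 : 0 < N := by linarith
    have h := le_sum_card_primeWindow ⌊N⌋₊ (y := η * Real.log N) (by positivity)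
    rw [le_div_iff₀ hN0]
    refine le_trans (le_of_eq ?_) h
    field_simp
  · filter_upwards [eventually_gt_atTop 1] with N hN
    have hl := Real.log_pos hN
    have hN0 : 0 < N := by linarith
    have h := sum_card_primeWindow_le ⌊N⌋₊ (y := η * Real.log N) (by positivity)
    rw [div_le_iff₀ hN0]
    refine h.trans (le_of_eq ?_)
    field_simp

/-- If `M = D + b`, with `b` counting the end point, then `0 ≤ M² - D² = b(M + D) ≤ 2gb`, and `b`
sums to at most `π(m)`. -/
lemma abs_sum_sq_card_primeWindow_sub_le {m : ℕ} {y g : ℝ} (hy : 0 ≤ y)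
    (hg : ∀ n, ((primeWindow n y).card : ℝ) ≤ g) :
    |∑ n ∈ Icc 1 m, (((primeWindow n y).card : ℝ) ^ 2 -
      (primePi ((n : ℝ) - y) - primePi n) ^ 2)| ≤ 2 * g * Nat.primeCounting m := by
  have hg0 : 0 ≤ g := (Nat.cast_nonneg _).trans (hg 0)
  have hb := sum_card_endpoint_le m y
  set b : ℕ → ℕ := fun n => ((Icc 1 n).filter fun p : ℕ => p.Prime ∧ (p : ℝ) = n - y).card with hbdef
  have hb' : ∑ n ∈ Icc 1 m, (b n : ℝ) ≤ Nat.primeCounting m := by exact_mod_cast hb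
  calc _ ≤ ∑ n ∈ Icc 1 m, 2 * g * (b n : ℝ) := by
        refine (abs_sum_le_sum_abs _ _).trans (sum_le_sum fun n _ => ?_)
        have h1 : ((primeWindow n y).card : ℝ) = primePi n - primePi (n - y) + b n :=
          card_primeWindow_eq n hy
        have h2 : 0 ≤ primePi n - primePi (n - y) := by
          unfold primePi
          rw [sub_nonneg]
          exact_mod_cast Nat.monotone_primeCounting (Nat.floor_mono (by linarith))
        have h3 := hg n
        have h4 : (0 : ℝ) ≤ b n := by positivity
        set D := primePi n - primePi (n - y)
        have h5 : (primePi ((n : ℝ) - y) - primePi n) ^ 2 = D ^ 2 := by ring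
        rw [h5, abs_of_nonneg (by rw [h1]; nlinarith)]
        rw [h1] at h3 ⊢
        nlinarith
    _ ≤ _ := by
        rw [← mul_sum]
        exact mul_le_mul_of_nonneg_left hb' (by positivity)

/-- The average over `n ≤ N` of `M(n)² + M(n)`, with `M(n)` the number of primes in
`[n - η log N, n]`, is `(π(n) - π(n - η log N))² + η + o(1)` on average. -/
theorem tendsto_average_primeWindow {η : ℝ} (hη : 0 < η) :
    Tendsto (fun N : ℝ => (∑ n ∈ Icc 1 ⌊N⌋₊, (((primeWindow n (η * Real.log N)).card : ℝ) ^ 2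
      + ((primeWindow n (η * Real.log N)).card : ℝ)
      - ((primePi ((n : ℝ) - η * Real.log N) - primePi n) ^ 2 + η))) / N) atTop (𝓝 0) := by
  have h1 := tendsto_sum_card_primeWindow_div hη
  have h2 : Tendsto (fun N : ℝ => η * ((⌊N⌋₊ : ℝ) / N)) atTop (𝓝 η) := by
    simpa using (tendsto_nat_floor_div_atTop (R := ℝ)).const_mul η
  have h3 : Tendsto (fun N : ℝ => (∑ n ∈ Icc 1 ⌊N⌋₊,
      (((primeWindow n (η * Real.log N)).card : ℝ) ^ 2
      - (primePi ((n : ℝ) - η * Real.log N) - primePi n) ^ 2)) / N) atTop (𝓝 0) := by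
    rw [Metric.tendsto_nhds]
    intro ε hε
    have hy : Tendsto (fun N : ℝ => η * Real.log N) atTop atTop :=
      Real.tendsto_log_atTop.const_mul_atTop hη
    have hpi := tendsto_primeCounting_mul_log_div.eventually (gt_mem_nhds one_lt_two)
    -- With `π(N) log N < 2N`, the factor `ε / (8η)` turns `2 g π(N)` into less than `εN/2`.
    filter_upwards [hy.eventually (eventually_card_primeWindow_le
      (ε := ε / (8 * η)) (by positivity)), hpi, eventually_gt_atTop 1] with N h4 h5 hN
    have hl := Real.log_pos hN
    have hN0 : 0 < N := by linarith
    have h6 := abs_sum_sq_card_primeWindow_sub_le (m := ⌊N⌋₊) (by positivity) h4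
    rw [dist_zero_right, norm_div, Real.norm_of_nonneg hN0.le, div_lt_iff₀ hN0]
    rw [div_lt_iff₀ hN0] at h5
    refine h6.trans_lt ?_
    have : 2 * (ε / (8 * η) * (η * Real.log N)) * (Nat.primeCounting ⌊N⌋₊ : ℝ) =
        ε / 4 * ((Nat.primeCounting ⌊N⌋₊ : ℝ) * Real.log N) := by field_simp; ring
    rw [this]
    nlinarith
  have := (h3.add h1).sub h2
  simp only [zero_add, sub_self] at this
  refine this.congr fun N => ?_
  have : ∑ n ∈ Icc 1 ⌊N⌋₊, (((primeWindow n (η * Real.log N)).card : ℝ) ^ 2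
      + ((primeWindow n (η * Real.log N)).card : ℝ)
      - ((primePi ((n : ℝ) - η * Real.log N) - primePi n) ^ 2 + η)) =
      ∑ n ∈ Icc 1 ⌊N⌋₊, (((primeWindow n (η * Real.log N)).card : ℝ) ^ 2
      - (primePi ((n : ℝ) - η * Real.log N) - primePi n) ^ 2) +
      ∑ n ∈ Icc 1 ⌊N⌋₊, ((primeWindow n (η * Real.log N)).card : ℝ) - ⌊N⌋₊ * η := by
    rw [← sum_add_distrib]
    have : (⌊N⌋₊ : ℝ) * η = ∑ n ∈ Icc 1 ⌊N⌋₊, η := by simp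
    rw [this, ← sum_sub_distrib]
    exact sum_congr rfl fun n _ => by ring
  rw [this]
  ring

end PeterssonAverage

end

noncomputable section

namespace PeterssonAverage

open MeasureTheory UpperHalfPlane ModularGroup

/-! ### Unfolding over the fundamental domain -/

lemma measurePreserving_SL_smul (γ : SL(2, ℤ)) :
    MeasurePreserving (fun z : ℍ => γ • z) volume volume :=
  measurePreserving_smul (γ : GL (Fin 2) ℝ) volume

lemma measurableEmbedding_SL_smul (γ : SL(2, ℤ)) :
    MeasurableEmbedding (fun z : ℍ => γ • z) :=
  measurableEmbedding_const_smul (γ : GL (Fin 2) ℝ)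

lemma volume_eq_zero_of_image {s : Set ℍ} (h : volume ((↑) '' s : Set ℂ) = 0) :
    volume s = 0 := by
  rw [volume_eq_lintegral, Measure.restrict_eq_zero.mpr h, lintegral_zero_measure]

lemma volume_re_eq (c : ℝ) : volume {z : ℂ | z.re = c} = 0 := by
  have h : {z : ℂ | z.re = c} = Complex.measurableEquivRealProd ⁻¹' ({c} ×ˢ Set.univ) := by
    ext z; simp [Complex.measurableEquivRealProd_apply]
  rw [h, Complex.volume_preserving_equiv_real_prod.measure_preimage
    ((measurableSet_singleton c).prod MeasurableSet.univ).nullMeasurableSet,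
    Measure.volume_eq_prod, Measure.prod_prod]
  simp

lemma volume_fd_diff_fdo : volume (𝒟 \ 𝒟ᵒ) = 0 := by
  apply volume_eq_zero_of_image
  refine measure_mono_null (t := Metric.sphere (0:ℂ) 1 ∪ ({z | z.re = 1 / 2} ∪
    {z | z.re = -(1 / 2)})) ?_ ?_
  · rintro _ ⟨z, ⟨⟨h1, h2⟩, h3⟩, rfl⟩
    by_cases hn : Complex.normSq z = 1
    · left
      rw [mem_sphere_zero_iff_norm, ← sq_eq_sq₀ (norm_nonneg _) zero_le_one,
        ← Complex.normSq_eq_norm_sq, hn, one_pow]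
    · right
      have h4 : ¬ |z.re| < 1 / 2 := fun h => h3 ⟨lt_of_le_of_ne h1 (Ne.symm hn), h⟩
      have h5 : |z.re| = 1 / 2 := le_antisymm h2 (not_lt.mp h4)
      rcases abs_eq (by norm_num) |>.mp h5 with h | h
      · exact Or.inl h
      · exact Or.inr h
  · exact measure_union_null (Measure.addHaar_sphere _ _ _)
      (measure_union_null (volume_re_eq _) (volume_re_eq _))

instance countable_SL : Countable SL(2, ℤ) :=
  Subtype.countable (α := Fin 2 → Fin 2 → ℤ)

lemma neg_one_ne_one_SL : (-1 : SL(2, ℤ)) ≠ 1 := by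
  intro h
  have := congrArg (fun g : SL(2, ℤ) => g 0 0) h
  simp at this

/-- Almost every point lies in exactly two translates of the fundamental domain. -/
lemma ae_tsum_indicator_fd :
    ∀ᵐ z : ℍ, ∑' γ : SL(2, ℤ), Set.indicator 𝒟 (fun _ => (1 : ENNReal)) (γ • z) = 2 := by
  have hnull : ∀ᵐ z : ℍ, ∀ γ : SL(2, ℤ), γ • z ∉ 𝒟 \ 𝒟ᵒ := by
    rw [ae_all_iff]
    intro γ
    have h0 : ∀ᵐ w : ℍ, w ∉ 𝒟 \ 𝒟ᵒ := measure_eq_zero_iff_ae_notMem.mp volume_fd_diff_fdo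
    exact (measurePreserving_SL_smul γ).quasiMeasurePreserving.ae
      (p := fun w : ℍ => w ∉ 𝒟 \ 𝒟ᵒ) h0
  filter_upwards [hnull] with z hz
  obtain ⟨g, hg⟩ := exists_smul_mem_fd z
  have hgo : g • z ∈ 𝒟ᵒ := by
    by_contra h
    exact hz g ⟨hg, h⟩
  -- The two matrices `±g` act identically; this is the source of the multiplicity `2`.
  have hne : g ≠ -g := fun h => neg_one_ne_one_SL (by
    have := congrArg (· * g⁻¹) h
    simpa using this.symm)
  rw [tsum_eq_sum (s := {g, -g}), Finset.sum_pair hne]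
  · rw [ModularGroup.SL_neg_smul, Set.indicator_of_mem hg]
    norm_num
  · intro γ hγ
    rw [Set.indicator_of_notMem]
    intro hmem
    have h1 : (γ * g⁻¹) • (g • z) ∈ 𝒟 := by rwa [smul_smul, inv_mul_cancel_right]
    rcases eq_one_or_neg_one_of_mem_fdo_mem_fd hgo h1 with h | h
    · exact hγ (by rw [mul_inv_eq_one.mp h]; simp)
    · have : γ = -g := by rw [mul_inv_eq_iff_eq_mul.mp h, neg_one_mul]
      exact hγ (by rw [this]; simp)

/-- The double covering of the half-plane by translates of `𝒟`, stated for measures so that every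
integrable function can be unfolded at once. -/
lemma sum_map_restrict_fd :
    Measure.sum (fun γ : SL(2, ℤ) => (volume.restrict 𝒟).map (fun z : ℍ => γ⁻¹ • z)) =
      (2 : ENNReal) • (volume : Measure ℍ) := by
  have hfd : MeasurableSet 𝒟 := isClosed_fd.measurableSet
  ext s hs
  rw [Measure.sum_apply _ hs, Measure.smul_apply, smul_eq_mul]
  have h (γ : SL(2, ℤ)) : (volume.restrict 𝒟).map (fun z : ℍ => γ⁻¹ • z) s =
      ∫⁻ z in s, Set.indicator 𝒟 (fun _ => (1 : ENNReal)) (γ • z) := by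
    have hm := (measurePreserving_SL_smul γ⁻¹).measurable
    have hm' := (measurePreserving_SL_smul γ).measurable
    rw [Measure.map_apply hm hs, Measure.restrict_apply (hm hs)]
    have e : (fun z : ℍ => Set.indicator 𝒟 (fun _ => (1 : ENNReal)) (γ • z)) =
        ((fun z : ℍ => γ • z) ⁻¹' 𝒟).indicator (fun _ => 1) := rfl
    rw [e, lintegral_indicator (hm' hfd), lintegral_one, Measure.restrict_apply_univ,
      Measure.restrict_apply (hm' hfd)]
    rw [← (measurePreserving_SL_smul γ).measure_preimage ((hm hs).inter hfd).nullMeasurableSet]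
    congr 1
    ext z
    simp only [Set.mem_inter_iff, Set.mem_preimage, inv_smul_smul]
    exact and_comm
  simp_rw [h]
  rw [← lintegral_tsum (fun γ => ?_)]
  · rw [lintegral_congr_ae (ae_restrict_of_ae ae_tsum_indicator_fd), lintegral_const,
      Measure.restrict_apply_univ]
  · exact ((measurable_const.indicator hfd).comp
      (measurePreserving_SL_smul γ).measurable).aemeasurable

lemma hasSum_integral_fd_smul {E : Type*} [NormedAddCommGroup E] [NormedSpace ℝ E]
    {h : ℍ → E} (hh : Integrable h) :
    HasSum (fun γ : SL(2, ℤ) => ∫ z in 𝒟, h (γ • z)) ((2 : ℝ) • ∫ z, h z) := by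
  have h2 : Integrable h (Measure.sum fun γ : SL(2, ℤ) =>
      (volume.restrict 𝒟).map (fun z : ℍ => γ⁻¹ • z)) := by
    rw [sum_map_restrict_fd]
    exact hh.smul_measure (by norm_num)
  have := hasSum_integral_measure h2
  rw [sum_map_restrict_fd, integral_smul_measure] at this
  simp_rw [(measurableEmbedding_SL_smul _).integral_map] at this
  rw [← (Equiv.inv SL(2, ℤ)).hasSum_iff]
  exact this

/-- The rows `(c, d)` that occur as bottom rows in `SL(2, ℤ)`. -/
abbrev CoprimePair := {v : Fin 2 → ℤ // IsCoprime (v 0) (v 1)}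

/-- The bottom row of a matrix. -/
def bottomRow (γ : SL(2, ℤ)) : CoprimePair := ⟨γ 1, bottom_row_coprime γ⟩

lemma bottomRow_surjective : Function.Surjective bottomRow := fun v => by
  obtain ⟨g, -, hg⟩ := bottom_row_surj v.2
  exact ⟨g, Subtype.ext hg⟩

/-- A matrix with a given bottom row. -/
def rowRep (v : CoprimePair) : SL(2, ℤ) := Function.surjInv bottomRow_surjective v

lemma bottomRow_rowRep (v : CoprimePair) : bottomRow (rowRep v) = v :=
  Function.surjInv_eq bottomRow_surjective v

/-- `γ' γ⁻¹` has bottom row `(0, 1)`, hence is a power of `T`; the exponent is its upper right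
entry. So bottom rows parametrize the cosets of the group generated by `T`. -/
lemma exists_eq_T_zpow_mul {γ γ' : SL(2, ℤ)} (h : bottomRow γ = bottomRow γ') :
    ∃ n : ℤ, γ' = T ^ n * γ := by
  have h0 : γ 1 0 = γ' 1 0 := congrFun (congrArg Subtype.val h) 0
  have h1 : γ 1 1 = γ' 1 1 := congrFun (congrArg Subtype.val h) 1
  have hd := γ.det_coe
  have hd' := γ'.det_coe
  rw [Matrix.det_fin_two] at hd hd'
  refine ⟨γ 0 0 * γ' 0 1 - γ' 0 0 * γ 0 1, ?_⟩
  ext i j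
  rw [Matrix.SpecialLinearGroup.coe_mul, coe_T_zpow]
  fin_cases i <;> fin_cases j <;>
    simp only [Matrix.mul_apply, Fin.sum_univ_two, Fin.isValue, Fin.zero_eta, Fin.mk_one,
      Matrix.of_apply, Matrix.cons_val', Matrix.cons_val_zero, Matrix.cons_val_one,
      Matrix.cons_val_fin_one]
  · rw [← h0, ← h1] at hd'
    linear_combination γ 0 0 * hd' - γ' 0 0 * hd
  · rw [← h0, ← h1] at hd'
    linear_combination γ 0 1 * hd' - γ' 0 1 * hd
  · linarith
  · linarith

lemma bottomRow_T_zpow_mul (n : ℤ) (γ : SL(2, ℤ)) : bottomRow (T ^ n * γ) = bottomRow γ := by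
  apply Subtype.ext
  funext j
  simp only [bottomRow, Matrix.SpecialLinearGroup.coe_mul, coe_T_zpow, Matrix.mul_apply,
    Fin.sum_univ_two]
  simp

/-- A half-open vertical strip of width one. -/
def strip : Set ℍ := {z | z.re ∈ Set.Ioc 0 1}

lemma measurableSet_strip : MeasurableSet strip :=
  continuous_re.measurable measurableSet_Ioc

lemma exists_unique_zpow_smul_mem_strip (z : ℍ) : ∃! n : ℤ, T ^ n • z ∈ strip := by
  have := existsUnique_add_zsmul_mem_Ioc (zero_lt_one' ℝ) z.re 0
  simpa only [strip, Set.mem_ofPred_eq, re_T_zpow_smul, zsmul_eq_mul, mul_one, zero_add] using this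

/-- The fibre over `v` consists of the `T ^ n * rowRep v`, and exactly one `n` moves the point into
the strip, so a single term survives. -/
lemma hasSum_fiber_strip {E : Type*} [NormedAddCommGroup E] {F : ℍ → E}
    (hF : ∀ (n : ℤ) z, F (T ^ n • z) = F z) (v : CoprimePair) (z : ℍ) :
    HasSum (fun γ : {γ // bottomRow γ = v} => strip.indicator F (γ.1 • z))
      (F (rowRep v • z)) := by
  obtain ⟨n, hn, hu⟩ := exists_unique_zpow_smul_mem_strip (rowRep v • z)
  have hmem : bottomRow (T ^ n * rowRep v) = v := by
    rw [bottomRow_T_zpow_mul, bottomRow_rowRep]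
  have := hasSum_single (f := fun γ : {γ // bottomRow γ = v} => strip.indicator F (γ.1 • z))
    ⟨T ^ n * rowRep v, hmem⟩ (fun γ hγ => ?_)
  · rwa [Set.indicator_of_mem (by rwa [mul_smul]), mul_smul, hF] at this
  · rw [Set.indicator_of_notMem]
    intro hs
    obtain ⟨m, hm⟩ := exists_eq_T_zpow_mul ((bottomRow_rowRep v).trans γ.2.symm)
    rw [hm, mul_smul] at hs
    have := hu m hs
    exact hγ (Subtype.ext (by rw [hm, this]))

/-- Unfolding: the integral over the fundamental domain of a sum over bottom rows is an integral
over the strip. -/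
theorem integral_fd_tsum_rowRep {F : ℍ → ℂ} (hF : ∀ (n : ℤ) z, F (T ^ n • z) = F z)
    (hi : IntegrableOn F strip) (hs : ∀ z, Summable fun v => F (rowRep v • z)) :
    ∫ z in 𝒟, ∑' v, F (rowRep v • z) = 2 * ∫ z in strip, F z := by
  have hi' : Integrable (strip.indicator F) := hi.integrable_indicator measurableSet_strip
  have hpt (z : ℍ) : ∑' γ : SL(2, ℤ), strip.indicator F (γ • z) = ∑' v, F (rowRep v • z) := by
    have hnF : ∀ (n : ℤ) z, ‖F (T ^ n • z)‖ = ‖F z‖ := fun n z => by rw [hF]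
    have hsum : Summable fun x : Σ v, {γ // bottomRow γ = v} => strip.indicator F (x.2.1 • z) := by
      apply Summable.of_norm
      rw [summable_sigma_of_nonneg (fun _ => norm_nonneg _)]
      have key (v : CoprimePair) := hasSum_fiber_strip (F := fun z => ‖F z‖) hnF v z
      have e (γ : SL(2, ℤ)) : ‖strip.indicator F (γ • z)‖ =
        strip.indicator (fun z => ‖F z‖) (γ • z) := by rw [norm_indicator_eq_indicator_norm]
      simp_rw [e]
      refine ⟨fun v => (key v).summable, ?_⟩
      simp_rw [(key _).tsum_eq]
      exact (hs z).norm
    -- Group the sum over all matrices by bottom row; each fibre collapses to one term.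
    have h1 := hsum.hasSum.sigma (fun v => hasSum_fiber_strip hF v z)
    rw [h1.tsum_eq]
    exact ((Equiv.sigmaFiberEquiv bottomRow).tsum_eq
      (fun γ : SL(2, ℤ) => strip.indicator F (γ • z))).symm
  have hint (γ : SL(2, ℤ)) : Integrable (fun z => strip.indicator F (γ • z)) (volume.restrict 𝒟) :=
    ((measurePreserving_SL_smul γ).integrable_comp_emb (measurableEmbedding_SL_smul γ)).mpr hi'
      |>.integrableOn
  have h1 := hasSum_integral_of_summable_integral_norm hint
    ((hasSum_integral_fd_smul hi'.norm).summable)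
  have h2 := h1.unique (hasSum_integral_fd_smul hi')
  simp_rw [hpt] at h2
  rw [h2, integral_indicator measurableSet_strip, Complex.real_smul]
  norm_num

end PeterssonAverage

end

noncomputable section

namespace PeterssonAverage

open MeasureTheory UpperHalfPlane ModularGroup Filter Topology
open scoped ModularForm ComplexConjugate Manifold

/-! ### The first Poincaré series -/

/-- The function `e(z) = exp(2πiz)`. -/
def expq (z : ℍ) : ℂ := Function.Periodic.qParam 1 z

lemma expq_eq (z : ℍ) : expq z = Complex.exp (2 * Real.pi * Complex.I * z) := by
  simp [expq, Function.Periodic.qParam]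

lemma norm_expq (z : ℍ) : ‖expq z‖ = Real.exp (-(2 * Real.pi * z.im)) := by
  rw [expq_eq, Complex.norm_exp]
  congr 1
  simp

lemma norm_expq_le_one (z : ℍ) : ‖expq z‖ ≤ 1 := by
  rw [norm_expq, Real.exp_le_one_iff]
  have := z.im_pos
  have := Real.pi_pos
  rw [neg_nonpos]; positivity

lemma expq_T_zpow_smul (n : ℤ) (z : ℍ) : expq (T ^ n • z) = expq z := by
  rw [expq_eq, expq_eq, coe_T_zpow_smul_eq, mul_add, Complex.exp_add,
    show 2 * Real.pi * Complex.I * n = n * (2 * Real.pi * Complex.I) by ring,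
    Complex.exp_int_mul_two_pi_mul_I, mul_one]

lemma mdifferentiable_expq : MDiff expq := by
  rw [UpperHalfPlane.mdifferentiable_iff]
  refine DifferentiableOn.congr (f := fun z => Complex.exp (2 * Real.pi * Complex.I * z))
    (by fun_prop) fun z hz => ?_
  simp only [Function.comp, expq_eq, ofComplex_apply_of_im_pos hz]

/-- The terms of the Poincaré series. -/
def poincareTerm (k : ℤ) (v : CoprimePair) : ℍ → ℂ := expq ∣[k] rowRep v

lemma expq_slash_T_zpow (k n : ℤ) : expq ∣[k] (T ^ n) = expq := by
  funext z
  rw [ModularForm.SL_slash_apply, expq_T_zpow_smul]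
  have : denom (T ^ n : SL(2, ℤ)) z = 1 := by
    rw [denom_apply, coe_T_zpow]
    simp
  rw [this, one_zpow, mul_one]

/-- Since `expq` is invariant under `T`, the term does not depend on the chosen representative of
the coset. -/
lemma expq_slash_eq_poincareTerm (k : ℤ) (γ : SL(2, ℤ)) :
    expq ∣[k] γ = poincareTerm k (bottomRow γ) := by
  obtain ⟨n, hn⟩ := exists_eq_T_zpow_mul (bottomRow_rowRep (bottomRow γ))
  conv_lhs => rw [hn]
  rw [SlashAction.slash_mul, expq_slash_T_zpow]
  rfl

lemma poincareTerm_apply (k : ℤ) (v : CoprimePair) (z : ℍ) :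
    poincareTerm k v z = expq (rowRep v • z) * ((v.1 0 : ℂ) * z + v.1 1) ^ (-k) := by
  rw [poincareTerm, ModularForm.SL_slash_apply, denom_apply]
  have h : (rowRep v).1 1 = v.1 := congrArg Subtype.val (bottomRow_rowRep v)
  have h0 : (rowRep v) 1 0 = v.1 0 := congrFun h 0
  have h1 : (rowRep v) 1 1 = v.1 1 := congrFun h 1
  rw [h0, h1]

lemma norm_poincareTerm_le (k : ℤ) (v : CoprimePair) (z : ℍ) :
    ‖poincareTerm k v z‖ ≤ ‖(v.1 0 : ℂ) * z + v.1 1‖ ^ (-k) := by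
  rw [poincareTerm_apply, norm_mul, norm_zpow]
  exact mul_le_of_le_one_left (by positivity) (norm_expq_le_one _)

lemma summable_norm_poincareTerm {k : ℤ} (hk : 3 ≤ k) (z : ℍ) :
    Summable fun v => ‖poincareTerm k v z‖ := by
  refine Summable.of_nonneg_of_le (fun _ => norm_nonneg _) (fun v => norm_poincareTerm_le k v z) ?_
  have := (EisensteinSeries.summable_norm_eisSummand hk z).subtype {v | IsCoprime (v 0) (v 1)}
  simpa only [EisensteinSeries.eisSummand, norm_zpow] using! this

/-- The first Poincaré series, summed over all coprime pairs. -/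
def poincareFun (k : ℤ) (z : ℍ) : ℂ := ∑' v, poincareTerm k v z

/-- Right multiplication on the set of bottom rows. -/
def rowMul (γ : SL(2, ℤ)) : CoprimePair ≃ CoprimePair where
  toFun v := bottomRow (rowRep v * γ)
  invFun v := bottomRow (rowRep v * γ⁻¹)
  left_inv v := by
    obtain ⟨n, hn⟩ := exists_eq_T_zpow_mul (bottomRow_rowRep (bottomRow (rowRep v * γ))).symm
    dsimp only
    rw [hn, mul_assoc, mul_assoc, mul_inv_cancel, mul_one, bottomRow_T_zpow_mul, bottomRow_rowRep]
  right_inv v := by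
    obtain ⟨n, hn⟩ := exists_eq_T_zpow_mul (bottomRow_rowRep (bottomRow (rowRep v * γ⁻¹))).symm
    dsimp only
    rw [hn, mul_assoc, mul_assoc, inv_mul_cancel, mul_one, bottomRow_T_zpow_mul, bottomRow_rowRep]

/-- Right multiplication by `γ` permutes the bottom rows, hence the terms of the series. -/
lemma poincareFun_slash (k : ℤ) (γ : SL(2, ℤ)) : poincareFun k ∣[k] γ = poincareFun k := by
  funext z
  rw [ModularForm.SL_slash_apply]
  unfold poincareFun
  rw [← tsum_mul_right, ← (rowMul γ).tsum_eq (fun v => poincareTerm k v z)]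
  refine tsum_congr fun v => ?_
  have h1 : poincareTerm k (rowMul γ v) = poincareTerm k v ∣[k] γ := by
    rw [rowMul, Equiv.coe_fn_mk, ← expq_slash_eq_poincareTerm, SlashAction.slash_mul, poincareTerm]
  rw [h1, ModularForm.SL_slash_apply]

/-- Because `|expq| ≤ 1`, the Eisenstein majorant gives uniform convergence on vertical strips, and
locally uniform limits are holomorphic. -/
lemma mdifferentiable_poincareFun {k : ℤ} (hk : 3 ≤ k) : MDiff (poincareFun k) := by
  have hk' : (2 : ℝ) < k := by exact_mod_cast hk
  have p_sum : Summable fun v : CoprimePair => ‖v.1‖ ^ (-k) :=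
    mod_cast (EisensteinSeries.summable_one_div_norm_rpow hk').subtype {v | IsCoprime (v 0) (v 1)}
  have hloc : TendstoLocallyUniformly (fun (s : Finset CoprimePair) (z : ℍ) =>
      ∑ v ∈ s, poincareTerm k v z) (poincareFun k) atTop := by
    rw [tendstoLocallyUniformly_iff_forall_isCompact]
    intro K hK
    obtain ⟨A, B, hB, HABK⟩ := subset_verticalStrip_of_isCompact hK
    refine (tendstoUniformlyOn_tsum (hu := p_sum.mul_left <|
      EisensteinSeries.r ⟨⟨A, B⟩, hB⟩ ^ (-k : ℝ)) (fun v z hz => ?_)).mono HABK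
    refine (norm_poincareTerm_le k v z).trans ?_
    have := EisensteinSeries.summand_bound_of_mem_verticalStrip (k := k) (by positivity) v.1 hB hz
    exact_mod_cast this
  rw [UpperHalfPlane.mdifferentiable_iff]
  have hlocOn : TendstoLocallyUniformlyOn (fun (s : Finset CoprimePair) =>
      (fun z : ℍ => ∑ v ∈ s, poincareTerm k v z) ∘ ofComplex) (poincareFun k ∘ ofComplex) atTop
      {z : ℂ | 0 < z.im} := by
    rw [← upperHalfPlaneSet, ← range_coe, ← Set.image_univ]
    apply TendstoLocallyUniformlyOn.comp (s := ⊤) _ _ _ (OpenPartialHomeomorph.continuousOn_symm _)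
    · simpa only [Set.top_eq_univ, tendstoLocallyUniformlyOn_univ] using hloc
    · simp only [Topology.IsOpenEmbedding.toOpenPartialHomeomorph_target, Set.top_eq_univ,
        Set.mapsTo_range_iff, Set.mem_univ, forall_const]
  refine hlocOn.differentiableOn (.of_forall fun s => ?_) isOpen_upperHalfPlaneSet
  have h1 (v : CoprimePair) : DifferentiableOn ℂ (poincareTerm k v ∘ ofComplex)
      {z : ℂ | 0 < z.im} := by
    rw [← UpperHalfPlane.mdifferentiable_iff]
    exact mdifferentiable_expq.slash k _
  exact DifferentiableOn.fun_sum fun v _ => h1 v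

/-- The part of the Poincaré series with nonzero lower left entry. -/
def poincareTail (k : ℤ) (z : ℍ) : ℂ :=
  ∑' v : CoprimePair, if v.1 0 = 0 then 0 else poincareTerm k v z

/-- If `|d| ≥ 2|c|`, the real part of `cz + d` is at least `|d|/2`; otherwise its imaginary part
`cy` controls both entries. -/
lemma linear_norm_ge {z : ℍ} (hz : |z.re| ≤ 1) (v : Fin 2 → ℤ) :
    min z.im 1 * ‖v‖ / 2 ≤ ‖(v 0 : ℂ) * z + v 1‖ := by
  set w : ℂ := (v 0 : ℂ) * z + v 1 with hw
  have him : |w.im| ≤ ‖w‖ := Complex.abs_im_le_norm w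
  have hre : |w.re| ≤ ‖w‖ := Complex.abs_re_le_norm w
  have e1 : w.im = v 0 * z.im := by simp [hw]
  have e2 : w.re = v 0 * z.re + v 1 := by simp [hw]
  have hy := z.im_pos
  have hm1 : min z.im 1 ≤ z.im := min_le_left _ _
  have hm2 : min z.im 1 ≤ 1 := min_le_right _ _
  have hm0 : 0 < min z.im 1 := lt_min hy one_pos
  have hnorm : ‖v‖ = max |(v 0 : ℝ)| |(v 1 : ℝ)| := by
    rw [EisensteinSeries.norm_eq_max_natAbs]
    push_cast
    simp
  have a0 : (0 : ℝ) ≤ |(v 0 : ℝ)| := abs_nonneg _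
  have a1 : (0 : ℝ) ≤ |(v 1 : ℝ)| := abs_nonneg _
  rw [hnorm]
  rw [e1, abs_mul, abs_of_pos hy] at him
  rw [e2] at hre
  have hre' : |(v 1 : ℝ)| - |(v 0 : ℝ)| ≤ ‖w‖ := by
    have h3 : |(v 1 : ℝ)| ≤ |(v 0 : ℝ) * z.re + v 1| + |(v 0 : ℝ) * z.re| := by
      have := abs_sub ((v 0 : ℝ) * z.re + v 1) ((v 0 : ℝ) * z.re)
      simpa using this
    have h4 : |(v 0 : ℝ) * z.re| ≤ |(v 0 : ℝ)| := by
      rw [abs_mul]; exact mul_le_of_le_one_right a0 hz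
    linarith
  rcases le_total (2 * |(v 0 : ℝ)|) |(v 1 : ℝ)| with h | h
  · rw [max_eq_right (by linarith)]
    have : min z.im 1 * |(v 1 : ℝ)| ≤ |(v 1 : ℝ)| := mul_le_of_le_one_left a1 hm2
    linarith
  · have h5 : max |(v 0 : ℝ)| |(v 1 : ℝ)| ≤ 2 * |(v 0 : ℝ)| := max_le (by linarith) h
    have h6 : min z.im 1 * max |(v 0 : ℝ)| |(v 1 : ℝ)| ≤ z.im * (2 * |(v 0 : ℝ)|) :=
      mul_le_mul hm1 h5 (le_max_of_le_left a0) hy.le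
    linarith

/-- The constant in the bound for the tail of the Poincaré series. -/
def tailConst : ℝ := 8 * ∑' v : CoprimePair, ‖v.1‖ ^ (-3 : ℤ)

lemma summable_norm_coprimePair : Summable fun v : CoprimePair => ‖v.1‖ ^ (-3 : ℤ) :=
  mod_cast (EisensteinSeries.summable_one_div_norm_rpow (k := (3 : ℤ)) (by norm_num)).subtype
    {v | IsCoprime (v 0) (v 1)}

lemma tailConst_nonneg : 0 ≤ tailConst :=
  mul_nonneg (by norm_num) (tsum_nonneg fun _ => by positivity)

/-- The exponent is split as `k = (k - 3) + 3`. Since `c ≠ 0` gives `|cz + d| ≥ y`, the first part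
yields `y^{-(k-3)}`; the other three powers make the sum converge with a constant independent of
`k`. -/
lemma norm_tail_term_le {k : ℕ} (hk : 3 ≤ k) {z : ℍ} (hz : |z.re| ≤ 1) (v : CoprimePair) :
    ‖if v.1 0 = 0 then 0 else poincareTerm k v z‖ ≤
      ((z.im ^ (k - 3))⁻¹ * (1 + (z.im ^ 3)⁻¹) * 8) * ‖v.1‖ ^ (-3 : ℤ) := by
  have hy := z.im_pos
  split_ifs with h0
  · rw [norm_zero]; positivity
  refine (norm_poincareTerm_le k v z).trans ?_
  set w : ℂ := (v.1 0 : ℂ) * z + v.1 1 with hw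
  have hv0 : (1 : ℝ) ≤ |(v.1 0 : ℝ)| := by exact_mod_cast Int.one_le_abs h0
  have hvn : 1 ≤ ‖v.1‖ := by
    refine hv0.trans ?_
    have := norm_le_pi_norm v.1 0
    rwa [Int.norm_eq_abs] at this
  have h1 : z.im ≤ ‖w‖ := by
    have him : |w.im| ≤ ‖w‖ := Complex.abs_im_le_norm w
    have e1 : w.im = v.1 0 * z.im := by simp [hw]
    rw [e1, abs_mul, abs_of_pos hy] at him
    nlinarith
  have h2 := linear_norm_ge hz v.1
  have hm0 : 0 < min z.im 1 := lt_min hy one_pos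
  have hw0 : 0 < ‖w‖ := hy.trans_le h1
  have h3 : ((min z.im 1) ^ 3)⁻¹ ≤ 1 + (z.im ^ 3)⁻¹ := by
    rcases le_total z.im 1 with h | h
    · rw [min_eq_left h]; linarith
    · rw [min_eq_right h]
      have : 0 ≤ (z.im ^ 3)⁻¹ := by positivity
      simpa using this
  have e : ‖w‖ ^ (-(k : ℤ)) = (‖w‖ ^ (k - 3))⁻¹ * (‖w‖ ^ 3)⁻¹ := by
    rw [zpow_neg, zpow_natCast, ← mul_inv, ← pow_add, Nat.sub_add_cancel hk]
  rw [e]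
  have h4 : (‖w‖ ^ (k - 3))⁻¹ ≤ (z.im ^ (k - 3))⁻¹ :=
    inv_anti₀ (by positivity) (pow_le_pow_left₀ hy.le h1 _)
  have h5 : (‖w‖ ^ 3)⁻¹ ≤ (1 + (z.im ^ 3)⁻¹) * 8 * ‖v.1‖ ^ (-3 : ℤ) := by
    calc (‖w‖ ^ 3)⁻¹ ≤ ((min z.im 1 * ‖v.1‖ / 2) ^ 3)⁻¹ :=
          inv_anti₀ (by positivity) (pow_le_pow_left₀ (by positivity) h2 _)
      _ = ((min z.im 1) ^ 3)⁻¹ * 8 * ‖v.1‖ ^ (-3 : ℤ) := by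
          rw [zpow_neg]
          norm_cast
          rw [div_pow, mul_pow, inv_div]
          field_simp
          norm_num
      _ ≤ _ := by gcongr
  calc _ ≤ (z.im ^ (k - 3))⁻¹ * ((1 + (z.im ^ 3)⁻¹) * 8 * ‖v.1‖ ^ (-3 : ℤ)) :=
        mul_le_mul h4 h5 (by positivity) (by positivity)
    _ = _ := by ring

lemma norm_poincareTail_le {k : ℕ} (hk : 3 ≤ k) {z : ℍ} (hz : |z.re| ≤ 1) :
    ‖poincareTail k z‖ ≤ tailConst * ((z.im ^ (k - 3))⁻¹ * (1 + (z.im ^ 3)⁻¹)) := by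
  have h := tsum_of_norm_bounded
    ((summable_norm_coprimePair.mul_left
      ((z.im ^ (k - 3))⁻¹ * (1 + (z.im ^ 3)⁻¹) * 8)).hasSum) (norm_tail_term_le hk hz)
  rw [tsum_mul_left] at h
  refine h.trans (le_of_eq ?_)
  rw [tailConst]; ring

/-- The rows with `c = 0` are `(0, 1)` and `(0, -1)`; for even `k` each contributes `e(z)`. -/
lemma poincareFun_eq {k : ℕ} (hk : 3 ≤ k) (hev : Even k) (z : ℍ) :
    poincareFun k z = 2 * expq z + poincareTail k z := by
  have hk' : (3 : ℤ) ≤ k := by exact_mod_cast hk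
  have hs := (summable_norm_poincareTerm hk' z).of_norm
  have hs2 : Summable fun v : CoprimePair => if v.1 0 = 0 then 0 else poincareTerm k v z := by
    refine Summable.of_norm_bounded (summable_norm_poincareTerm hk' z) fun v => ?_
    split_ifs <;> simp
  have h1 : poincareFun k z - poincareTail k z =
      ∑' v : CoprimePair, if v.1 0 = 0 then poincareTerm k v z else 0 := by
    rw [poincareFun, poincareTail, ← hs.tsum_sub hs2]
    exact tsum_congr fun v => by split_ifs <;> simp
  set v1 : CoprimePair := ⟨![0, 1], by simp [isCoprime_zero_left]⟩
  set v2 : CoprimePair := ⟨![0, -1], by simp [isCoprime_zero_left]⟩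
  have hne : v1 ≠ v2 := fun h => by
    have := congrFun (congrArg Subtype.val h) 1
    simp [v1, v2] at this
  have e1 : v1 = bottomRow 1 := by
    apply Subtype.ext; funext j; fin_cases j <;> simp [v1, bottomRow]
  have e2 : v2 = bottomRow (-1) := by
    apply Subtype.ext; funext j; fin_cases j <;> simp [v2, bottomRow]
  have t1 : poincareTerm k v1 z = expq z := by
    rw [e1, ← expq_slash_eq_poincareTerm, SlashAction.slash_one]
  have t2 : poincareTerm k v2 z = expq z := by
    rw [e2, ← expq_slash_eq_poincareTerm, ModularForm.SL_slash_apply, denom_apply]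
    rw [ModularGroup.SL_neg_smul, one_smul]
    have : ((k : ℤ)) = ((k : ℕ) : ℤ) := rfl
    simp [hev.neg_one_pow]
  have h2 : (∑' v : CoprimePair, if v.1 0 = 0 then poincareTerm k v z else 0) = 2 * expq z := by
    rw [tsum_eq_sum (s := {v1, v2}), Finset.sum_pair hne]
    · have a1 : v1.1 0 = 0 := rfl
      have a2 : v2.1 0 = 0 := rfl
      rw [if_pos a1, if_pos a2, t1, t2]; ring
    · intro v hv
      rw [if_neg]
      intro h0
      have hu : IsUnit (v.1 1) := by
        have := v.2
        rwa [h0, isCoprime_zero_left] at this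
      apply hv
      rcases Int.isUnit_iff.mp hu with h | h
      · have : v = v1 := by
          apply Subtype.ext; funext j; fin_cases j <;> simp [v1, h0, h]
        rw [this]; simp
      · have : v = v2 := by
          apply Subtype.ext; funext j; fin_cases j <;> simp [v2, h0, h]
        rw [this]; simp
  rw [h2] at h1
  linear_combination h1

lemma poincareFun_T_zpow_smul (k n : ℤ) (z : ℍ) : poincareFun k (T ^ n • z) = poincareFun k z := by
  have h := congrFun (poincareFun_slash k (T ^ n)) z
  rw [ModularForm.SL_slash_apply] at h
  have : denom (T ^ n : SL(2, ℤ)) z = 1 := by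
    rw [denom_apply, coe_T_zpow]
    simp
  rwa [this, one_zpow, mul_one] at h

lemma isZeroAtImInfty_poincareFun {k : ℕ} (hk : 4 ≤ k) (hev : Even k) :
    IsZeroAtImInfty (poincareFun k) := by
  -- The tail estimate needs `|Re z| ≤ 1`, so `z` is first translated into the strip; periodicity
  -- makes the bound global.
  have hb : ∀ z : ℍ, ‖poincareFun k z‖ ≤ 2 * Real.exp (-(2 * Real.pi * z.im)) +
      tailConst * ((z.im ^ (k - 3))⁻¹ * (1 + (z.im ^ 3)⁻¹)) := by
    intro z
    obtain ⟨n, hn, -⟩ := exists_unique_zpow_smul_mem_strip z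
    have hre : |(T ^ n • z).re| ≤ 1 := by
      have h : (T ^ n • z).re ∈ Set.Ioc (0:ℝ) 1 := hn
      rw [abs_of_pos h.1]; exact h.2
    rw [← poincareFun_T_zpow_smul k n z, poincareFun_eq (by omega) hev]
    refine (norm_add_le _ _).trans (add_le_add ?_ ?_)
    · rw [norm_mul, norm_expq, im_T_zpow_smul]; simp
    · have := norm_poincareTail_le (k := k) (by omega) hre
      rwa [im_T_zpow_smul] at this
  have hlim : Tendsto (fun y : ℝ => 2 * Real.exp (-(2 * Real.pi * y)) +
      tailConst * ((y ^ (k - 3))⁻¹ * (1 + (y ^ 3)⁻¹))) atTop (𝓝 0) := by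
    have h1 : Tendsto (fun y : ℝ => Real.exp (-(2 * Real.pi * y))) atTop (𝓝 0) :=
      Real.tendsto_exp_neg_atTop_nhds_zero.comp (tendsto_id.const_mul_atTop (by positivity))
    have h2 : Tendsto (fun y : ℝ => (y ^ (k - 3))⁻¹) atTop (𝓝 0) :=
      tendsto_inv_atTop_zero.comp (tendsto_pow_atTop (by omega))
    have h3 : Tendsto (fun y : ℝ => (y ^ 3)⁻¹) atTop (𝓝 0) :=
      tendsto_inv_atTop_zero.comp (tendsto_pow_atTop (by norm_num))
    simpa using (h1.const_mul 2).add ((h2.mul (h3.const_add 1)).const_mul tailConst)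
  exact squeeze_zero_norm hb (hlim.comp tendsto_comap)

/-- The first Poincaré series as a cusp form. -/
def poincare {k : ℕ} (hk : 4 ≤ k) (hev : Even k) : CuspForm 𝒮ℒ (k : ℤ) where
  toFun := poincareFun k
  slash_action_eq' A hA := by
    obtain ⟨A, rfl⟩ := hA
    exact poincareFun_slash k A
  holo' := mdifferentiable_poincareFun (k := (k : ℤ)) (by omega)
  zero_at_cusps' hc := by
    rw [Subgroup.IsArithmetic.isCusp_iff_isCusp_SL2Z] at hc
    rw [OnePoint.isZeroAt_iff_forall_SL2Z hc]
    intro γ _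
    rw [poincareFun_slash]
    exact isZeroAtImInfty_poincareFun hk hev

lemma coe_poincare {k : ℕ} (hk : 4 ≤ k) (hev : Even k) (z : ℍ) :
    poincare hk hev z = poincareFun k z := rfl

end PeterssonAverage

end

noncomputable section

namespace PeterssonAverage

open MeasureTheory UpperHalfPlane ModularGroup Filter Topology
open scoped ModularForm ComplexConjugate Manifold

/-! ### Fourier coefficients of the Poincaré series -/

lemma integral_qParam_pow (n : ℕ) (y : ℝ) :
    ∫ u in (0:ℝ)..1, 1 / Function.Periodic.qParam 1 (u + y * Complex.I) ^ n *
      (2 * Function.Periodic.qParam 1 (u + y * Complex.I)) = if n = 1 then 2 else 0 := by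
  have hq (u : ℝ) : Function.Periodic.qParam 1 (u + y * Complex.I) ≠ 0 := Complex.exp_ne_zero _
  split_ifs with hn
  · subst hn
    have : ∀ u : ℝ, 1 / Function.Periodic.qParam 1 (u + y * Complex.I) ^ 1 *
      (2 * Function.Periodic.qParam 1 (u + y * Complex.I)) = 2 := fun u => by
        have := hq u
        field_simp
    rw [intervalIntegral.integral_congr fun u _ => this u]
    simp
  · have hn' : ((1 - n : ℤ) : ℂ) ≠ 0 := by
      rw [Ne, Int.cast_eq_zero]; omega
    set c : ℂ := 2 * Real.pi * Complex.I * (1 - n : ℤ) with hc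
    have hc0 : c ≠ 0 := mul_ne_zero Complex.two_pi_I_ne_zero hn'
    have : ∀ u : ℝ, 1 / Function.Periodic.qParam 1 (u + y * Complex.I) ^ n *
      (2 * Function.Periodic.qParam 1 (u + y * Complex.I)) =
        2 * Complex.exp (c * (y * Complex.I)) * Complex.exp (c * u) := fun u => by
      rw [div_mul_eq_mul_div, div_eq_iff (pow_ne_zero _ (hq u))]
      simp only [Function.Periodic.qParam]
      rw [← Complex.exp_nat_mul]
      have hx : Complex.exp (2 * Real.pi * Complex.I * (u + y * Complex.I) / (1 : ℝ)) =
          Complex.exp (c * (y * Complex.I)) * Complex.exp (c * u) *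
            Complex.exp (n * (2 * Real.pi * Complex.I * (u + y * Complex.I) / (1 : ℝ))) := by
        rw [← Complex.exp_add, ← Complex.exp_add]
        congr 1
        rw [hc]
        push_cast
        ring
      linear_combination 2 * hx
    simp_rw [this]
    rw [intervalIntegral.integral_const_mul, integral_exp_mul_complex hc0]
    have h1 : Complex.exp (c * (1 : ℝ)) = 1 := by
      rw [hc, Complex.ofReal_one, mul_one, mul_comm, Complex.exp_int_mul_two_pi_mul_I]
    rw [h1]
    simp

lemma continuous_poincareTail {k : ℕ} (hk : 3 ≤ k) (hev : Even k) :
    Continuous (poincareTail k) := by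
  have h1 : Continuous (poincareFun k) :=
    (mdifferentiable_poincareFun (k := (k : ℤ)) (by omega)).continuous
  have h2 : Continuous expq := mdifferentiable_expq.continuous
  have : poincareTail k = fun z => poincareFun k z - 2 * expq z := by
    funext z
    rw [poincareFun_eq hk hev]; ring
  rw [this]
  fun_prop

/-- The `n`-th Fourier coefficient of the Poincaré series. -/
lemma norm_coeff_poincare_sub_le {k : ℕ} (hk : 4 ≤ k) (hev : Even k) (n : ℕ) {y : ℝ} (hy : 0 < y) :
    ‖(qExpansion 1 (poincare hk hev)).coeff n - (if n = 1 then 2 else 0)‖ ≤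
      Real.exp (2 * Real.pi * n * y) *
        (tailConst * ((y ^ (k - 3))⁻¹ * (1 + (y ^ 3)⁻¹))) := by
  have hk3 : 3 ≤ k := by omega
  set Z : ℝ → ℍ := fun u => ⟨u + y * Complex.I, by simpa using hy⟩ with hZ
  have hZc : Continuous Z := by
    rw [isOpenEmbedding_coe.continuous_iff]
    have : UpperHalfPlane.coe ∘ Z = fun u : ℝ => (u : ℂ) + y * Complex.I := rfl
    rw [this]
    fun_prop
  have hqc : Continuous fun u : ℝ => Function.Periodic.qParam 1 (u + y * Complex.I) := by
    unfold Function.Periodic.qParam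
    fun_prop
  have hq (u : ℝ) : Function.Periodic.qParam 1 (u + y * Complex.I) ≠ 0 := Complex.exp_ne_zero _
  have h := ModularFormClass.qExpansion_coeff_eq_intervalIntegral (poincare hk hev) one_pos
    one_mem_strictPeriods_SL n hy
  have hinv : Continuous fun u : ℝ => 1 / Function.Periodic.qParam 1 (u + y * Complex.I) ^ n :=
    continuous_const.div (hqc.pow n) fun u => pow_ne_zero _ (hq u)
  have htail : Continuous fun u : ℝ => poincareTail k (Z u) :=
    (continuous_poincareTail hk3 hev).comp hZc
  have e : ∀ u : ℝ, 1 / Function.Periodic.qParam 1 (u + y * Complex.I) ^ n *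
      poincare hk hev (Z u) =
      1 / Function.Periodic.qParam 1 (u + y * Complex.I) ^ n *
        (2 * Function.Periodic.qParam 1 (u + y * Complex.I)) +
      1 / Function.Periodic.qParam 1 (u + y * Complex.I) ^ n * poincareTail k (Z u) := fun u => by
    rw [coe_poincare, poincareFun_eq hk3 hev, mul_add]
    rfl
  -- The term `2e(z)` contributes its coefficient exactly, so only the tail needs estimating. The
  -- height `y` stays free and is optimized later.
  have h' : (qExpansion 1 (poincare hk hev)).coeff n = (if n = 1 then 2 else 0) +
      ∫ u in (0:ℝ)..1, 1 / Function.Periodic.qParam 1 (u + y * Complex.I) ^ n *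
        poincareTail k (Z u) := by
    have i1 : IntervalIntegrable (fun u : ℝ => 1 / Function.Periodic.qParam 1
        (u + y * Complex.I) ^ n * (2 * Function.Periodic.qParam 1 (u + y * Complex.I)))
        volume 0 1 := (hinv.mul (continuous_const.mul hqc)).intervalIntegrable _ _
    have i2 : IntervalIntegrable (fun u : ℝ => 1 / Function.Periodic.qParam 1
        (u + y * Complex.I) ^ n * poincareTail k (Z u)) volume 0 1 :=
      (hinv.mul htail).intervalIntegrable _ _
    rw [h, ← integral_qParam_pow n y, ← intervalIntegral.integral_add i1 i2]
    simp only [Complex.ofReal_one, div_one, one_mul]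
    exact intervalIntegral.integral_congr fun u _ => by simpa using e u
  rw [h', add_sub_cancel_left]
  refine (intervalIntegral.norm_integral_le_of_norm_le_const (C := Real.exp (2 * Real.pi * n * y) *
        (tailConst * ((y ^ (k - 3))⁻¹ * (1 + (y ^ 3)⁻¹)))) fun u hu => ?_).trans (by simp)
  rw [Set.uIoc_of_le zero_le_one] at hu
  rw [norm_mul]
  have hre : (Z u).re = u := by simp [hZ, UpperHalfPlane.re]
  have him : (Z u).im = y := by simp [hZ, UpperHalfPlane.im]
  refine mul_le_mul (le_of_eq ?_) ?_ (norm_nonneg _) (Real.exp_pos _).le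
  · rw [norm_div, norm_one, norm_pow, Function.Periodic.norm_qParam, one_div, ← inv_pow,
      ← Real.exp_neg, ← Real.exp_nat_mul]
    congr 1
    simp
    ring
  · have := norm_poincareTail_le (k := k) hk3 (z := Z u) (by
      rw [hre, abs_of_pos hu.1]; exact hu.2)
    rwa [him] at this

/-! ### Symmetry under `z ↦ -conj z` and reality of the coefficients. -/

/-- The reflection `(c, d) ↦ (-c, d)` on bottom rows. -/
def rowNeg : CoprimePair ≃ CoprimePair :=
  Function.Involutive.toPerm (fun v => ⟨![-v.1 0, v.1 1], v.2.neg_left⟩) fun v => by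
    apply Subtype.ext; funext j; fin_cases j <;> simp

/-- Conjugation of a matrix by `diag(-1, 1)`. -/
def conjNeg (γ : SL(2, ℤ)) : SL(2, ℤ) :=
  ⟨!![γ 0 0, -γ 0 1; -γ 1 0, γ 1 1], by
    have := γ.det_coe
    rw [Matrix.det_fin_two] at this
    rw [Matrix.det_fin_two_of]; linarith⟩

lemma J_mul_conjNeg (γ : SL(2, ℤ)) :
    (γ : GL (Fin 2) ℝ) * J = J * (conjNeg γ : GL (Fin 2) ℝ) := by
  have h (g : SL(2, ℤ)) (i j) : (g : GL (Fin 2) ℝ).val i j = ((g i j : ℤ) : ℝ) := rfl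
  ext i j
  rw [Matrix.GeneralLinearGroup.coe_mul, Matrix.GeneralLinearGroup.coe_mul, Matrix.mul_apply,
    Matrix.mul_apply, Fin.sum_univ_two, Fin.sum_univ_two]
  simp only [h, val_J]
  fin_cases i <;> fin_cases j <;> simp [conjNeg]

lemma slash_J_apply (f : ℍ → ℂ) (k : ℤ) (z : ℍ) : (f ∣[k] J) z = conj (f (J • z)) := by
  rw [ModularForm.slash_apply]
  simp

lemma expq_slash_J (k : ℤ) : expq ∣[k] J = expq := by
  funext z
  rw [slash_J_apply, expq_eq, expq_eq, coe_J_smul, ← Complex.exp_conj]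
  congr 1
  simp [Complex.conj_ofNat]

/-- Reflection followed by conjugation is the slash action of `J = diag(-1, 1)`. It fixes `expq`,
and moving it past a matrix changes `c` to `-c`. The resulting reality of the coefficients is needed
because the final error `r` must be real. -/
lemma conj_poincareTerm_J (k : ℤ) (v : CoprimePair) (z : ℍ) :
    conj (poincareTerm k v (J • z)) = poincareTerm k (rowNeg v) z := by
  rw [← slash_J_apply _ k, poincareTerm, ModularForm.SL_slash, ← SlashAction.slash_mul,
    J_mul_conjNeg, SlashAction.slash_mul, expq_slash_J, ← ModularForm.SL_slash,
    expq_slash_eq_poincareTerm]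
  congr 1
  have h : (rowRep v).1 1 = v.1 := congrArg Subtype.val (bottomRow_rowRep v)
  apply Subtype.ext
  funext j
  fin_cases j <;> simp [bottomRow, conjNeg, rowNeg, h, Function.Involutive.toPerm]

lemma conj_poincareFun_J (k : ℤ) (z : ℍ) : conj (poincareFun k (J • z)) = poincareFun k z := by
  unfold poincareFun
  rw [Complex.conj_tsum, ← rowNeg.tsum_eq (fun v => poincareTerm k v z)]
  exact tsum_congr fun v => conj_poincareTerm_J k v z

/-- The Fourier coefficients of the Poincaré series are real. -/
lemma conj_coeff_poincare {k : ℕ} (hk : 4 ≤ k) (hev : Even k) (n : ℕ) :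
    conj ((qExpansion 1 (poincare hk hev)).coeff n) = (qExpansion 1 (poincare hk hev)).coeff n := by
  refine ModularFormClass.qExpansion_coeff_unique (f := poincare hk hev)
    (c := fun n => conj ((qExpansion 1 (poincare hk hev)).coeff n)) one_pos
    one_mem_strictPeriods_SL (fun z => ?_) n
  have h := (ModularForm.hasSum_qExpansion (poincare hk hev) one_pos one_mem_strictPeriods_SL
    (J • z)).map (starRingEnd ℂ) Complex.continuous_conj
  rw [coe_poincare, conj_poincareFun_J] at h
  have hq : conj (Function.Periodic.qParam 1 (J • z : ℍ)) = Function.Periodic.qParam 1 z := by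
    have := congrFun (expq_slash_J 0) z
    rwa [slash_J_apply] at this
  rw [coe_poincare]
  refine h.congr_fun fun m => ?_
  simp only [Function.comp, map_mul, map_pow, hq, smul_eq_mul]

/-! ### Integrals over the strip -/

/-- The measure `dx dy` on `(0, 1] × (0, ∞)`. -/
def stripMeasure : Measure (ℝ × ℝ) :=
  (volume.restrict (Set.Ioc 0 1)).prod (volume.restrict (Set.Ioi 0))

/-- The parametrization of the upper half-plane by Cartesian coordinates. -/
def ofXY (p : ℝ × ℝ) : ℍ := ofComplex (p.1 + p.2 * Complex.I)

lemma coe_ofXY {p : ℝ × ℝ} (hp : 0 < p.2) : (ofXY p : ℂ) = p.1 + p.2 * Complex.I := by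
  rw [ofXY, ofComplex_apply_of_im_pos (by simpa using hp)]

lemma measurable_ofXY : Measurable ofXY := by
  refine measurable_comap_iff.mpr ?_
  have : UpperHalfPlane.coe ∘ ofXY = fun p : ℝ × ℝ => if 0 < p.2 then
      (p.1 + p.2 * Complex.I : ℂ) else ((ofComplex 0 : ℍ) : ℂ) := by
    funext p
    simp only [Function.comp]
    split_ifs with hp
    · exact coe_ofXY hp
    · rw [ofXY, ofComplex_apply_of_im_nonpos (by simpa using hp),
        ofComplex_apply_of_im_nonpos (by simp)]
  rw [this]
  exact Measurable.ite (measurableSet_lt measurable_const measurable_snd) (by fun_prop)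
    measurable_const

lemma map_stripMeasure :
    stripMeasure.map ofXY = (volume.comap UpperHalfPlane.coe).restrict strip := by
  ext s hs
  rw [Measure.map_apply measurable_ofXY hs, Measure.restrict_apply hs,
    measurableEmbedding_coe.comap_apply, stripMeasure, Measure.prod_restrict,
    Measure.restrict_apply (measurable_ofXY hs), ← Measure.volume_eq_prod,
    ← Complex.volume_preserving_equiv_real_prod.measure_preimage
      ((measurable_ofXY hs).inter (measurableSet_Ioc.prod measurableSet_Ioi)).nullMeasurableSet]
  congr 1
  ext z
  simp only [Complex.measurableEquivRealProd_apply, Set.mem_preimage, Set.mem_inter_iff,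
    Set.mem_prod, Set.mem_Ioi, Set.mem_image]
  constructor
  · rintro ⟨h1, h2, h3⟩
    refine ⟨⟨z, h3⟩, ⟨?_, h2⟩, rfl⟩
    have : ofXY (z.re, z.im) = ⟨z, h3⟩ := by
      ext
      rw [coe_ofXY h3]
      exact Complex.re_add_im z
    rwa [this] at h1
  · rintro ⟨w, ⟨h1, h2⟩, rfl⟩
    refine ⟨?_, h2, w.im_pos⟩
    have : ofXY ((w : ℂ).re, (w : ℂ).im) = w := by
      ext
      rw [coe_ofXY w.im_pos]
      exact Complex.re_add_im _
    rwa [this]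

lemma volume_restrict_strip :
    (volume : Measure ℍ).restrict strip = (stripMeasure.map ofXY).withDensity
      fun z ↦ (((1 / NNReal.mk z.im z.im_pos.le) ^ 2 : NNReal) : ENNReal) := by
  rw [volume_def, restrict_withDensity measurableSet_strip, map_stripMeasure]

end PeterssonAverage

end

noncomputable section

namespace PeterssonAverage

open MeasureTheory UpperHalfPlane ModularGroup Filter Topology
open scoped ModularForm ComplexConjugate Manifold

/-! ### Hyperbolic integrals in Cartesian coordinates and the area of the fundamental domain. -/

lemma ae_stripMeasure : ∀ᵐ p ∂stripMeasure, p.1 ∈ Set.Ioc (0:ℝ) 1 ∧ 0 < p.2 := by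
  rw [stripMeasure, Measure.prod_restrict]
  exact ae_restrict_mem (measurableSet_Ioc.prod measurableSet_Ioi)

lemma measurable_density :
    Measurable fun z : ℍ ↦ (1 / NNReal.mk z.im z.im_pos.le : NNReal) ^ 2 := by
  have : Measurable fun z : ℍ => NNReal.mk z.im z.im_pos.le :=
    (continuous_im.measurable).subtype_mk
  fun_prop

lemma measurable_density_smul {F : ℍ → ℂ} (hF : Measurable F) :
    Measurable fun z : ℍ ↦ ((1 / NNReal.mk z.im z.im_pos.le : NNReal) ^ 2) • F z :=
  measurable_density.smul hF

lemma smul_density_ofXY {p : ℝ × ℝ} (hp : 0 < p.2) (F : ℍ → ℂ) :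
    ((1 / NNReal.mk (ofXY p).im (ofXY p).im_pos.le : NNReal) ^ 2) • F (ofXY p) =
      (((p.2 ^ 2)⁻¹ : ℝ) : ℂ) * F (ofXY p) := by
  have him : (ofXY p).im = p.2 := by
    rw [UpperHalfPlane.im, coe_ofXY hp]; simp
  rw [NNReal.smul_def, Complex.real_smul]
  congr 2
  simp [him]

lemma integrableOn_strip_iff {F : ℍ → ℂ} (hF : Measurable F) :
    IntegrableOn F strip ↔
      Integrable (fun p => (((p.2 ^ 2)⁻¹ : ℝ) : ℂ) * F (ofXY p)) stripMeasure := by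
  rw [IntegrableOn, volume_restrict_strip,
    integrable_withDensity_iff_integrable_smul measurable_density,
    integrable_map_measure (measurable_density_smul hF).aestronglyMeasurable
      measurable_ofXY.aemeasurable]
  exact integrable_congr (ae_stripMeasure.mono fun p hp => smul_density_ofXY hp.2 F)

lemma integral_strip_eq {F : ℍ → ℂ} (hF : Measurable F) :
    ∫ z in strip, F z = ∫ p, (((p.2 ^ 2)⁻¹ : ℝ) : ℂ) * F (ofXY p) ∂stripMeasure := by
  rw [volume_restrict_strip, integral_withDensity_eq_integral_smul measurable_density,
    integral_map measurable_ofXY.aemeasurable (measurable_density_smul hF).aestronglyMeasurable]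
  exact integral_congr_ae (ae_stripMeasure.mono fun p hp => smul_density_ofXY hp.2 F)

lemma measurableSet_le_im : MeasurableSet {z : ℍ | 1 / 2 ≤ z.im} :=
  measurableSet_le measurable_const continuous_im.measurable

/-- The integral of `y⁻²` over `y ≥ 1/2` converges, and this height is below the minimum `√3/2` on
`𝒟`. -/
lemma volume_strip_inter_lt_top : volume (strip ∩ {z : ℍ | 1 / 2 ≤ z.im}) < ⊤ := by
  set F : ℍ → ℂ := Set.indicator {z : ℍ | 1 / 2 ≤ z.im} (fun _ => 1)
  have hF : Measurable F := measurable_const.indicator measurableSet_le_im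
  have h : IntegrableOn F strip := by
    rw [integrableOn_strip_iff hF]
    have h2 : IntegrableOn (fun y : ℝ => Set.indicator (Set.Ici (1/2:ℝ))
        (fun y => (((y ^ 2)⁻¹ : ℝ) : ℂ)) y) (Set.Ioi 0) := by
      have h3 : IntegrableOn (fun y : ℝ => (((y ^ 2)⁻¹ : ℝ) : ℂ)) (Set.Ici (1/2)) := by
        have := (integrableOn_Ioi_rpow_of_lt (a := -2) (by norm_num) (c := 1/2) (by norm_num))
        rw [integrableOn_Ici_iff_integrableOn_Ioi]
        refine (this.congr_fun (fun y hy => ?_) measurableSet_Ioi).ofReal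
        have hy' : (0:ℝ) ≤ y := by have : (1/2:ℝ) < y := hy; linarith
        change y ^ (-2 : ℝ) = (y ^ 2)⁻¹
        rw [Real.rpow_neg hy']
        norm_cast
      exact (h3.integrable_indicator measurableSet_Ici).integrableOn
    have h1 : IntegrableOn (fun _ : ℝ => (1:ℂ)) (Set.Ioc 0 1) := integrableOn_const (by simp)
    refine (h1.mul_prod h2).congr (ae_stripMeasure.mono fun p hp => ?_)
    have him : (ofXY p).im = p.2 := by
      rw [UpperHalfPlane.im, coe_ofXY hp.2]; simp
    simp only [F, Set.indicator, Set.mem_Ici, Set.mem_ofPred_eq, him]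
    split_ifs <;> simp
  rw [IntegrableOn, integrable_indicator_iff measurableSet_le_im, IntegrableOn,
    Measure.restrict_restrict measurableSet_le_im, Set.inter_comm] at h
  have := (integrable_const_iff_isFiniteMeasure (one_ne_zero (α := ℂ))).mp h
  simpa using this.measure_univ_lt_top

/-- The fundamental domain has finite hyperbolic area. -/
lemma volume_fd_lt_top : volume (𝒟 : Set ℍ) < ⊤ := by
  set A : Set ℍ := strip ∩ {z : ℍ | 1 / 2 ≤ z.im} with hA
  -- The strip has real parts in `(0, 1]`, so the half of `𝒟` with `Re z ≤ 0` is shifted into it by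
  -- `T`.
  have hsub : (𝒟 : Set ℍ) ⊆ A ∪ (fun z => T • z) ⁻¹' A := by
    intro z hz
    have him : 1 / 2 ≤ z.im := by
      have := three_le_four_mul_im_sq_of_mem_fd hz
      nlinarith [z.im_pos]
    have hre : |z.re| ≤ 1 / 2 := hz.2
    rw [abs_le] at hre
    rcases lt_or_ge 0 z.re with h | h
    · exact Or.inl ⟨⟨h, by linarith⟩, him⟩
    · refine Or.inr ⟨?_, ?_⟩
      · change (T • z).re ∈ Set.Ioc (0:ℝ) 1
        rw [re_T_smul]
        constructor <;> linarith
      · change 1 / 2 ≤ (T • z).im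
        rwa [im_T_smul]
  refine (measure_mono hsub).trans_lt ((measure_union_le _ _).trans_lt (ENNReal.add_lt_top.mpr
    ⟨volume_strip_inter_lt_top, ?_⟩))
  rw [(measurePreserving_SL_smul T).measure_preimage
    (measurableSet_strip.inter measurableSet_le_im).nullMeasurableSet]
  exact volume_strip_inter_lt_top

lemma continuous_cuspForm {k : ℤ} (f : CuspForm 𝒮ℒ k) : Continuous f :=
  (CuspFormClass.holo f).continuous

lemma integrableOn_petersson {k : ℕ} (f g : CuspForm 𝒮ℒ (k : ℤ)) :
    IntegrableOn (UpperHalfPlane.petersson (k : ℤ) f g) 𝒟 := by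
  obtain ⟨C, hC⟩ := CuspFormClass.petersson_bounded_left (k : ℤ) 𝒮ℒ f g
  exact Measure.integrableOn_of_bounded (M := C) volume_fd_lt_top.ne
    (petersson_continuous _ (continuous_cuspForm f) (continuous_cuspForm g)).aestronglyMeasurable
    (Eventually.of_forall hC)

/-! ### The inner product with the Poincaré series -/

/-- The constant in the Petersson formula. -/
def poincareConst (k : ℕ) : ℝ :=
  2 * ∫ y in Set.Ioi (0:ℝ), Real.exp (-(4 * Real.pi * y)) * y ^ (k - 2)

lemma integrableOn_exp_mul_pow {a : ℝ} (ha : 0 < a) (n : ℕ) :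
    IntegrableOn (fun y : ℝ => Real.exp (-(a * y)) * y ^ n) (Set.Ioi 0) := by
  have := integrableOn_rpow_mul_exp_neg_mul_rpow (p := 1) (s := n) (b := a)
    (by have : (0:ℝ) ≤ n := n.cast_nonneg
        linarith) one_pos ha
  refine this.congr_fun (fun y _ => ?_) measurableSet_Ioi
  simp only [Real.rpow_natCast, Real.rpow_one]
  rw [mul_comm, neg_mul]

lemma poincareConst_pos (k : ℕ) : 0 < poincareConst k := by
  refine mul_pos two_pos ?_
  rw [setIntegral_pos_iff_support_of_nonneg_ae]
  · have : Function.support (fun y : ℝ => Real.exp (-(4 * Real.pi * y)) * y ^ (k - 2)) ∩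
        Set.Ioi 0 = Set.Ioi 0 := by
      refine Set.inter_eq_right.mpr fun y hy => ?_
      have hy : 0 < y := hy
      exact (mul_pos (Real.exp_pos _) (pow_pos hy _)).ne'
    rw [this]; simp
  · refine (ae_restrict_mem measurableSet_Ioi).mono fun y hy => ?_
    have hy : 0 < y := hy
    exact (mul_pos (Real.exp_pos _) (pow_pos hy _)).le
  · exact integrableOn_exp_mul_pow (by positivity) _

/-- From `conj q = |q|² / q`. The conjugate becomes the factor `1/q` that extracts the first Fourier
coefficient. -/
lemma conj_expq (z : ℍ) :
    conj (expq z) = Real.exp (-(4 * Real.pi * z.im)) * (1 / expq z) := by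
  have h0 : expq z ≠ 0 := Complex.exp_ne_zero _
  have h := Complex.conj_mul' (expq z)
  rw [mul_one_div, eq_div_iff h0, h, norm_expq, ← Complex.ofReal_pow, ← Real.exp_nat_mul]
  congr 2
  push_cast; ring

section Unfold

variable {k : ℕ}

lemma petersson_expq_ofXY (g : CuspForm 𝒮ℒ (k : ℤ)) {p : ℝ × ℝ} (hp : 0 < p.2) (hk : 4 ≤ k) :
    (((p.2 ^ 2)⁻¹ : ℝ) : ℂ) * UpperHalfPlane.petersson (k : ℤ) expq g (ofXY p) =
      ((Real.exp (-(4 * Real.pi * p.2)) * p.2 ^ (k - 2) : ℝ) : ℂ) *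
        (1 / expq (ofXY p) * g (ofXY p)) := by
  have him : (ofXY p).im = p.2 := by
    rw [UpperHalfPlane.im, coe_ofXY hp]; simp
  have hp' : (p.2 : ℂ) ≠ 0 := by exact_mod_cast hp.ne'
  have hpow : (p.2 : ℂ) ^ k = (p.2 : ℂ) ^ (k - 2) * (p.2 : ℂ) ^ 2 := by
    rw [← pow_add]; congr 1; omega
  rw [UpperHalfPlane.petersson, conj_expq, him, zpow_natCast, hpow]
  push_cast
  field_simp

/-- The cusp form bound `|g| ≤ C y^{-k/2}` leaves `y^{k/2 - 2} e^{-2πy}`, which is integrable at `0`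
because `k ≥ 4`. -/
lemma integrableOn_petersson_expq (hk : 4 ≤ k) (hev : Even k) (g : CuspForm 𝒮ℒ (k : ℤ)) :
    IntegrableOn (UpperHalfPlane.petersson (k : ℤ) expq g) strip := by
  have hc : Continuous (UpperHalfPlane.petersson (k : ℤ) expq g) :=
    petersson_continuous _ mdifferentiable_expq.continuous (continuous_cuspForm g)
  rw [integrableOn_strip_iff hc.measurable]
  obtain ⟨C, hC⟩ := CuspFormClass.exists_bound g
  obtain ⟨m, hm⟩ := hev
  have h1 : IntegrableOn (fun _ : ℝ => (1:ℝ)) (Set.Ioc 0 1) := integrableOn_const (by simp)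
  have h2 := (integrableOn_exp_mul_pow (a := 2 * Real.pi) (by positivity) (m - 2)).const_mul C
  refine (h1.mul_prod h2).mono' ?_ (ae_stripMeasure.mono fun p hp => ?_)
  · refine (Measurable.mul ?_ (hc.measurable.comp measurable_ofXY)).aestronglyMeasurable
    fun_prop
  · have him : (ofXY p).im = p.2 := by
      rw [UpperHalfPlane.im, coe_ofXY hp.2]; simp
    have hp2 := hp.2
    have hg := hC (ofXY p)
    have he : ((k : ℤ) : ℝ) / 2 = m := by rw [hm]; push_cast; ring
    rw [him, he, Real.rpow_natCast] at hg
    rw [UpperHalfPlane.petersson, norm_mul, norm_mul, norm_mul, Complex.norm_conj, norm_expq, him,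
      Complex.norm_real, norm_zpow, Complex.norm_real, zpow_natCast, Real.norm_of_nonneg hp2.le,
      Real.norm_of_nonneg (by positivity)]
    have e1 : p.2 ^ k = p.2 ^ 2 * (p.2 ^ (m - 2) * p.2 ^ m) := by
      rw [← pow_add, ← pow_add]; congr 1; omega
    calc (p.2 ^ 2)⁻¹ * (Real.exp (-(2 * Real.pi * p.2)) * ‖g (ofXY p)‖ * p.2 ^ k)
        ≤ (p.2 ^ 2)⁻¹ * (Real.exp (-(2 * Real.pi * p.2)) * (C / p.2 ^ m) * p.2 ^ k) := by gcongr
      _ = 1 * (C * (Real.exp (-(2 * Real.pi * p.2)) * p.2 ^ (m - 2))) := by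
          rw [e1]; field_simp

/-- For fixed `y` the integral over `x` is the Cauchy formula for the first coefficient; the
remaining `y`-integral defines `poincareConst`. -/
lemma integral_strip_petersson_expq (hk : 4 ≤ k) (hev : Even k) (g : CuspForm 𝒮ℒ (k : ℤ)) :
    2 * ∫ z in strip, UpperHalfPlane.petersson (k : ℤ) expq g z =
      poincareConst k * (qExpansion 1 g).coeff 1 := by
  have hc : Continuous (UpperHalfPlane.petersson (k : ℤ) expq g) :=
    petersson_continuous _ mdifferentiable_expq.continuous (continuous_cuspForm g)
  have hi := (integrableOn_strip_iff hc.measurable).mp (integrableOn_petersson_expq hk hev g)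
  rw [integral_strip_eq hc.measurable, stripMeasure, integral_prod_symm _ hi, poincareConst]
  have key : ∀ y : ℝ, 0 < y → ∫ x in Set.Ioc (0:ℝ) 1, (((y ^ 2)⁻¹ : ℝ) : ℂ) *
      UpperHalfPlane.petersson (k : ℤ) expq g (ofXY (x, y)) =
      ((Real.exp (-(4 * Real.pi * y)) * y ^ (k - 2) : ℝ) : ℂ) * (qExpansion 1 g).coeff 1 := by
    intro y hy
    have h := ModularFormClass.qExpansion_coeff_eq_intervalIntegral g one_pos
      one_mem_strictPeriods_SL 1 hy
    rw [h, ← intervalIntegral.integral_of_le zero_le_one]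
    simp only [Complex.ofReal_one, div_one, one_mul]
    rw [← intervalIntegral.integral_const_mul]
    refine intervalIntegral.integral_congr fun x _ => ?_
    have e : ofXY (x, y) = ⟨x + y * Complex.I, by simpa using hy⟩ := by
      ext; exact coe_ofXY hy
    have := petersson_expq_ofXY g (p := (x, y)) hy hk
    simp only at this ⊢
    rw [this, e, pow_one]
    rfl
  rw [setIntegral_congr_fun measurableSet_Ioi (fun y hy => key y hy), integral_mul_const,
    integral_complex_ofReal]
  push_cast
  ring

/-- The Petersson product with the Poincaré series picks out the first Fourier coefficient. -/
theorem peterssonInner_poincare (hk : 4 ≤ k) (hev : Even k) (g : CuspForm 𝒮ℒ (k : ℤ)) :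
    peterssonInner k (poincare hk hev) g = poincareConst k * (qExpansion 1 g).coeff 1 := by
  rw [← integral_strip_petersson_expq hk hev g]
  set F : ℍ → ℂ := UpperHalfPlane.petersson (k : ℤ) expq g with hF
  have hg (γ : SL(2, ℤ)) : (g : ℍ → ℂ) ∣[(k : ℤ)] γ = g := g.slash_action_eq' _ ⟨γ, rfl⟩
  -- The Petersson integrand transforms by slashing both arguments, and `g` is invariant, so
  -- unfolding acts on `expq` alone.
  have hterm (v : CoprimePair) (z : ℍ) :
      F (rowRep v • z) = UpperHalfPlane.petersson (k : ℤ) (poincareTerm k v) g z := by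
    rw [hF, ← petersson_slash_SL, hg]; rfl
  have hT (n : ℤ) (z : ℍ) : F (T ^ n • z) = F z := by
    rw [hF, ← petersson_slash_SL, hg, expq_slash_T_zpow]
  have hk3 : (3 : ℤ) ≤ k := by omega
  have hs (z : ℍ) : Summable fun v => F (rowRep v • z) := by
    simp_rw [hterm]
    have := (summable_norm_poincareTerm hk3 z).of_norm
    exact ((Complex.hasSum_conj'.mpr this.hasSum).summable.mul_right _).mul_right _
  rw [← integral_fd_tsum_rowRep hT (integrableOn_petersson_expq hk hev g) hs, peterssonInner]
  congr 1
  funext z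
  simp_rw [hterm, UpperHalfPlane.petersson]
  rw [tsum_mul_right, tsum_mul_right, coe_poincare, poincareFun, Complex.conj_tsum]

end Unfold

end PeterssonAverage

end

noncomputable section

namespace PeterssonAverage

open MeasureTheory UpperHalfPlane ModularGroup Filter Topology
open scoped ModularForm ComplexConjugate Manifold

/-! ### The Petersson formula -/

/-- The `n`-th Fourier coefficient as a linear functional. -/
def coeffLin (k n : ℕ) : CuspForm 𝒮ℒ (k : ℤ) →ₗ[ℂ] ℂ where
  toFun f := (qExpansion 1 f).coeff n
  map_add' f g := by
    rw [FunLike.coe_add, ModularForm.qExpansion_add one_pos one_mem_strictPeriods_SL f g, map_add]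
  map_smul' c f := by
    rw [FunLike.coe_smul, ModularForm.qExpansion_smul one_pos one_mem_strictPeriods_SL c f]
    simp

lemma coeffLin_apply (k n : ℕ) (f : CuspForm 𝒮ℒ (k : ℤ)) :
    coeffLin k n f = (qExpansion 1 f).coeff n := rfl

/-- The Petersson product as a semilinear functional of its first argument. -/
def innerLeft (k : ℕ) (g : CuspForm 𝒮ℒ (k : ℤ)) : CuspForm 𝒮ℒ (k : ℤ) →ₛₗ[starRingEnd ℂ] ℂ where
  toFun f := peterssonInner k f g
  map_add' f₁ f₂ := by
    rw [peterssonInner, peterssonInner, peterssonInner,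
      ← integral_add (integrableOn_petersson f₁ g) (integrableOn_petersson f₂ g)]
    congr 1
    funext z
    simp [UpperHalfPlane.petersson, add_mul]
  map_smul' c f := by
    rw [peterssonInner, peterssonInner, smul_eq_mul, ← integral_const_mul]
    congr 1
    funext z
    simp [UpperHalfPlane.petersson, mul_assoc]

lemma innerLeft_apply (k : ℕ) (f g : CuspForm 𝒮ℒ (k : ℤ)) :
    innerLeft k g f = peterssonInner k f g := rfl

/-- `peterssonNorm` takes the square root of a real part; no information is lost, because the
self-product is real and nonnegative. -/
lemma peterssonInner_self (k : ℕ) (f : CuspForm 𝒮ℒ (k : ℤ)) :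
    peterssonInner k f f = ((peterssonNorm k f ^ 2 : ℝ) : ℂ) := by
  have h : peterssonInner k f f = ((∫ z in 𝒟, ‖f z‖ ^ 2 * z.im ^ k : ℝ) : ℂ) := by
    rw [peterssonInner, ← integral_complex_ofReal]
    congr 1
    funext z
    rw [UpperHalfPlane.petersson, Complex.conj_mul']
    push_cast
    rfl
  have h0 : 0 ≤ ∫ z in 𝒟, ‖f z‖ ^ 2 * z.im ^ k :=
    integral_nonneg fun z => mul_nonneg (by positivity) (pow_nonneg z.im_pos.le _)
  rw [peterssonNorm, h, Complex.ofReal_re, Real.sq_sqrt h0]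

section Formula

variable {k : ℕ} {S : Finset (CuspForm 𝒮ℒ (k : ℤ))}

/-- Pairing with the Poincaré series gives `poincareConst k ≠ 0` as a multiple of the self-product
of `f`, which is therefore nonzero. The weights `1/‖f‖²` are thus genuine quotients. -/
lemma peterssonNorm_pos (hS : IsHeckeBasis k S) (hk : 4 ≤ k) (hev : Even k)
    {f : CuspForm 𝒮ℒ (k : ℤ)} (hf : f ∈ S) : 0 < peterssonNorm k f ^ 2 := by
  obtain ⟨c, -, hc⟩ := Submodule.mem_span_finset.mp
    (hS.span_eq_top ▸ Submodule.mem_top : poincare hk hev ∈ Submodule.span ℂ (S : Set _))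
  have h1 : peterssonInner k (poincare hk hev) f = conj (c f) * peterssonInner k f f := by
    rw [← innerLeft_apply, ← hc, map_sum, Finset.sum_eq_single_of_mem f hf]
    · rw [map_smulₛₗ, smul_eq_mul, innerLeft_apply]
    · intro g hg hgf
      rw [map_smulₛₗ, innerLeft_apply, hS.orthogonal g hg f hf hgf, smul_zero]
  rw [peterssonInner_poincare, hS.normalized f hf, mul_one, peterssonInner_self] at h1
  refine lt_of_le_of_ne (sq_nonneg _) fun h => ?_
  rw [← h, Complex.ofReal_zero, mul_zero, Complex.ofReal_eq_zero] at h1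
  exact (poincareConst_pos k).ne' h1

/-- The Petersson formula for the first Poincaré series. -/
theorem poincareConst_mul_sum_coeff (hS : IsHeckeBasis k S) (hk : 4 ≤ k) (hev : Even k) (n : ℕ) :
    (poincareConst k : ℂ) * ∑ f ∈ S, ((1 / peterssonNorm k f ^ 2 : ℝ) : ℂ) *
      (qExpansion 1 f).coeff n = (qExpansion 1 (poincare hk hev)).coeff n := by
  obtain ⟨c, -, hc⟩ := Submodule.mem_span_finset.mp
    (hS.span_eq_top ▸ Submodule.mem_top : poincare hk hev ∈ Submodule.span ℂ (S : Set _))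
  -- Orthogonality isolates the coordinate of the Poincaré series along `f`.
  have hcf : ∀ f ∈ S, c f = (poincareConst k * (1 / peterssonNorm k f ^ 2) : ℝ) := fun f hf => by
    have h1 : peterssonInner k (poincare hk hev) f = conj (c f) * peterssonInner k f f := by
      rw [← innerLeft_apply, ← hc, map_sum, Finset.sum_eq_single_of_mem f hf]
      · rw [map_smulₛₗ, smul_eq_mul, innerLeft_apply]
      · intro g hg hgf
        rw [map_smulₛₗ, innerLeft_apply, hS.orthogonal g hg f hf hgf, smul_zero]
    rw [peterssonInner_poincare, hS.normalized f hf, mul_one, peterssonInner_self] at h1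
    have h0 : ((peterssonNorm k f ^ 2 : ℝ) : ℂ) ≠ 0 := by
      exact_mod_cast (peterssonNorm_pos hS hk hev hf).ne'
    have h2 : conj (c f) = (poincareConst k * (1 / peterssonNorm k f ^ 2) : ℝ) := by
      rw [Complex.ofReal_mul, Complex.ofReal_div, Complex.ofReal_one, mul_one_div, eq_div_iff h0,
        h1]
    rw [← Complex.conj_conj (c f), h2, Complex.conj_ofReal]
  rw [← coeffLin_apply k n (poincare hk hev), ← hc, map_sum, Finset.mul_sum]
  refine Finset.sum_congr rfl fun f hf => ?_
  rw [map_smul, coeffLin_apply, hcf f hf, smul_eq_mul]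
  push_cast
  ring

end Formula

/-- The Fourier coefficient of a weight `k` form normalized by `n ^ ((k - 1) / 2)`. -/
def normCoeff (k : ℕ) (f : CuspForm 𝒮ℒ (k : ℤ)) (n : ℕ) : ℂ :=
  (qExpansion 1 f).coeff n / ((√n ^ (k - 1) : ℝ) : ℂ)

/-- The constant in the error term of the Petersson formula. -/
def errConst : ℝ := tailConst * (Real.exp 9 + 1)

lemma errConst_nonneg : 0 ≤ errConst := mul_nonneg tailConst_nonneg (by positivity)

/-- Here `s = √n` and `t = 2πs/k ≤ e⁻³`, so `t^k ≤ e^{-3k}`. One factor `e^k` comes from the Fourier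
integral and another from `s ≤ k ≤ e^k`; the exponent `3` is chosen so that `e^{-k}` is left. -/
lemma tail_estimate {k : ℕ} (hk : 4 ≤ k) {s : ℝ} (hs : 1 ≤ s)
    (hsk : 2 * Real.pi * Real.exp 3 * s ≤ k) :
    Real.exp k * ((((k : ℝ) / (2 * Real.pi * s ^ 2)) ^ (k - 3))⁻¹ *
      (1 + (((k : ℝ) / (2 * Real.pi * s ^ 2)) ^ 3)⁻¹)) / s ^ (k - 1) ≤
      (Real.exp 9 + 1) * Real.exp (-k) := by
  have hk0 : (0:ℝ) < k := by exact_mod_cast (by omega : 0 < k)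
  have hs0 : 0 < s := by linarith
  have hpi := Real.pi_gt_three
  set t : ℝ := 2 * Real.pi * s / k with ht
  have ht0 : 0 < t := by positivity
  have hte : t ≤ Real.exp (-3) := by
    rw [ht, div_le_iff₀ hk0, Real.exp_neg, inv_mul_eq_div, le_div_iff₀ (Real.exp_pos _)]
    linarith
  have hsk' : s ≤ k := by
    refine le_trans ?_ hsk
    have h1 : 1 ≤ Real.exp 3 := Real.one_le_exp (by norm_num)
    have : 1 ≤ 2 * Real.pi * Real.exp 3 := by nlinarith
    nlinarith
  have hy : (k : ℝ) / (2 * Real.pi * s ^ 2) = (t * s)⁻¹ := by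
    rw [ht]; field_simp
  rw [hy, inv_pow, inv_pow, inv_inv, inv_inv]
  have hsplit : Real.exp k * ((t * s) ^ (k - 3) * (1 + (t * s) ^ 3)) / s ^ (k - 1) =
      Real.exp k * (t ^ (k - 3) / s ^ 2 + t ^ k * s) := by
    obtain ⟨m, rfl⟩ := Nat.exists_eq_add_of_le hk
    have e1 : 4 + m - 3 = m + 1 := by omega
    have e2 : 4 + m - 1 = m + 3 := by omega
    rw [e1, e2]
    field_simp
    ring
  rw [hsplit]
  have h1 : t ^ (k - 3) / s ^ 2 ≤ Real.exp (9 - 3 * k) := by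
    calc t ^ (k - 3) / s ^ 2 ≤ t ^ (k - 3) := div_le_self (by positivity) (one_le_pow₀ hs)
      _ ≤ Real.exp (-3) ^ (k - 3) := by gcongr
      _ = Real.exp (9 - 3 * k) := by
        rw [← Real.exp_nat_mul, Nat.cast_sub (by omega)]
        congr 1; push_cast; ring
  have h2 : t ^ k * s ≤ Real.exp (-3 * k) * Real.exp k := by
    have h3 : t ^ k ≤ Real.exp (-3 * k) := by
      calc t ^ k ≤ Real.exp (-3) ^ k := by gcongr
        _ = _ := by rw [← Real.exp_nat_mul]; congr 1; ring
    have h4 : s ≤ Real.exp k := by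
      have := Real.add_one_le_exp (k : ℝ); linarith
    gcongr
  calc Real.exp k * (t ^ (k - 3) / s ^ 2 + t ^ k * s)
      ≤ Real.exp k * (Real.exp (9 - 3 * k) + Real.exp (-3 * k) * Real.exp k) := by gcongr
    _ = Real.exp 9 * Real.exp (-(2 * k)) + Real.exp (-k) := by
      rw [mul_add, ← Real.exp_add, ← Real.exp_add, ← Real.exp_add, ← Real.exp_add]
      ring_nf
    _ ≤ _ := by
      rw [add_mul, one_mul]
      gcongr
      linarith

lemma norm_coeff_poincare_div_le {k : ℕ} (hk : 4 ≤ k) (hev : Even k) {n : ℕ} (hn : 1 ≤ n)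
    (hnk : 2 * Real.pi * Real.exp 3 * √n ≤ k) :
    ‖(qExpansion 1 (poincare hk hev)).coeff n - (if n = 1 then 2 else 0)‖ / √n ^ (k - 1) ≤
      errConst * Real.exp (-k) := by
  have hk0 : (0:ℝ) < k := by exact_mod_cast (by omega : 0 < k)
  have hn0 : (0:ℝ) < n := by exact_mod_cast hn
  have hs : 1 ≤ √(n : ℝ) := Real.one_le_sqrt.mpr (by exact_mod_cast hn)
  -- This height minimizes `e^{2πny} y^{-k}` and makes the exponential exactly `e^k`.
  have h := norm_coeff_poincare_sub_le hk hev n (y := k / (2 * Real.pi * n)) (by positivity)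
  have he : 2 * Real.pi * n * (k / (2 * Real.pi * n)) = k := by field_simp
  rw [he] at h
  have h2 := tail_estimate hk hs hnk
  rw [Real.sq_sqrt hn0.le] at h2
  calc _ ≤ _ := div_le_div_of_nonneg_right h (by positivity)
    _ = tailConst * (Real.exp k * (((k / (2 * Real.pi * n) : ℝ) ^ (k - 3))⁻¹ *
          (1 + ((k / (2 * Real.pi * n) : ℝ) ^ 3)⁻¹)) / √n ^ (k - 1)) := by ring
    _ ≤ tailConst * ((Real.exp 9 + 1) * Real.exp (-k)) :=
        mul_le_mul_of_nonneg_left h2 tailConst_nonneg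
    _ = _ := by rw [errConst]; ring

/-- The harmonic weights have positive total mass, and the harmonic average of the normalized
`n`-th Fourier coefficient is exponentially small for `1 < n ≪ k ^ 2`. -/
theorem harmonic_average {k : ℕ} (hk : 4 ≤ k) (hev : Even k)
    (hsmall : errConst * Real.exp (-k) ≤ 1) (hk1 : 2 * Real.pi * Real.exp 3 ≤ k)
    {S : Finset (CuspForm 𝒮ℒ (k : ℤ))} (hS : IsHeckeBasis k S) :
    0 < ∑ f ∈ S, 1 / peterssonNorm k f ^ 2 ∧
    ∀ n : ℕ, 1 < n → 2 * Real.pi * Real.exp 3 * √n ≤ k →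
      ∃ E : ℝ, |E| ≤ errConst * Real.exp (-k) ∧
        ∑ f ∈ S, ((1 / peterssonNorm k f ^ 2 : ℝ) : ℂ) * normCoeff k f n =
          (((∑ f ∈ S, 1 / peterssonNorm k f ^ 2) * E : ℝ) : ℂ) := by
  set W : ℝ := ∑ f ∈ S, 1 / peterssonNorm k f ^ 2 with hW
  have hC := poincareConst_pos k
  have h1 := poincareConst_mul_sum_coeff hS hk hev 1
  have h1' : (qExpansion 1 (poincare hk hev)).coeff 1 = ((poincareConst k * W : ℝ) : ℂ) := by
    rw [← h1, Complex.ofReal_mul, hW, Complex.ofReal_sum]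
    congr 1
    exact Finset.sum_congr rfl fun f hf => by rw [hS.normalized f hf, mul_one]
  have hb := norm_coeff_poincare_div_le hk hev le_rfl (by simpa using hk1)
  -- The first coefficient of the Poincaré series is `poincareConst k * W`, and it differs from `2`
  -- by at most `1`.
  have hCW : 1 ≤ poincareConst k * W := by
    rw [h1', if_pos rfl, Nat.cast_one, Real.sqrt_one, one_pow, div_one] at hb
    have h2 : ‖((poincareConst k * W : ℝ) : ℂ) - 2‖ = |poincareConst k * W - 2| := by
      rw [← Real.norm_eq_abs, ← Complex.norm_real]; push_cast; rfl
    rw [h2] at hb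
    have := (abs_le.mp (hb.trans hsmall)).1
    linarith
  have hWpos : 0 < W := by
    by_contra h
    have : poincareConst k * W ≤ 0 := mul_nonpos_of_nonneg_of_nonpos hC.le (not_lt.mp h)
    linarith
  refine ⟨hWpos, fun n hn hnk => ?_⟩
  have hn0 : (0:ℝ) < √n := Real.sqrt_pos.mpr (by exact_mod_cast (by omega : 0 < n))
  obtain ⟨a, ha⟩ : ∃ a : ℝ, (qExpansion 1 (poincare hk hev)).coeff n = a :=
    ⟨_, (Complex.conj_eq_iff_re.mp (conj_coeff_poincare hk hev n)).symm⟩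
  have hb := norm_coeff_poincare_div_le hk hev hn.le hnk
  rw [if_neg hn.ne', sub_zero, ha, Complex.norm_real, Real.norm_eq_abs] at hb
  -- Dividing the formula at `n` by the one at `1` removes the unknown constant; the denominator is
  -- at least `1`, so the bound survives.
  refine ⟨a / √n ^ (k - 1) / (poincareConst k * W), ?_, ?_⟩
  · rw [abs_div, abs_div, abs_of_pos (pow_pos hn0 _),
      abs_of_pos (a := poincareConst k * W) (by linarith)]
    exact (div_le_self (by positivity) hCW).trans hb
  · have h := poincareConst_mul_sum_coeff hS hk hev n
    rw [ha] at h
    have hC' : (poincareConst k : ℂ) ≠ 0 := by exact_mod_cast hC.ne'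
    have hW' : (W : ℂ) ≠ 0 := by exact_mod_cast hWpos.ne'
    have hn' : ((√n : ℝ) : ℂ) ≠ 0 := by exact_mod_cast hn0.ne'
    unfold normCoeff
    simp_rw [← mul_div_assoc]
    rw [← Finset.sum_div, eq_comm]
    push_cast at h ⊢
    rw [← h]
    field_simp

end PeterssonAverage

end

noncomputable section

namespace PeterssonAverage

open UpperHalfPlane Filter Topology
open scoped ModularForm ComplexConjugate Manifold

/-! ### Hecke relations -/

lemma heckeOp_eigenvalue {k n : ℕ} {f : CuspForm 𝒮ℒ (k : ℤ)} (hf : IsHeckeEigenfunction k f)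
    (hn : 1 ≤ n) (z : ℍ) : heckeOp k n f z = heckeEigenvalue k f n * f z := by
  have h := hf n hn
  rw [heckeEigenvalue, dif_pos h]
  exact h.choose_spec z

lemma sum_pow_root_of_unity {p : ℕ} (hp : p ≠ 0) (m : ℕ) :
    ∑ b ∈ Finset.range p, Complex.exp (2 * Real.pi * Complex.I / p) ^ (m * b) =
      if p ∣ m then (p : ℂ) else 0 := by
  have hζ := Complex.isPrimitiveRoot_exp p hp
  set ζ := Complex.exp (2 * Real.pi * Complex.I / p)
  simp_rw [pow_mul]
  split_ifs with h
  · have h1 : ζ ^ m = 1 := (hζ.pow_eq_one_iff_dvd m).mpr h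
    simp [h1]
  · have h1 : ζ ^ m ≠ 1 := fun h' => h ((hζ.pow_eq_one_iff_dvd m).mp h')
    have h2 := mul_neg_geom_sum (ζ ^ m) p
    have h3 : (ζ ^ m) ^ p = 1 := by rw [← pow_mul, mul_comm, pow_mul, hζ.pow_eq_one, one_pow]
    rw [h3, sub_self] at h2
    exact (mul_eq_zero.mp h2).resolve_left (sub_ne_zero.mpr h1.symm)

section

variable {k : ℕ} (f : CuspForm 𝒮ℒ (k : ℤ)) {p : ℕ}

lemma hasSum_cuspForm (z : ℍ) : HasSum (fun m => (qExpansion 1 f).coeff m *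
    Function.Periodic.qParam 1 z ^ m) (f z) :=
  ModularForm.hasSum_qExpansion f one_pos one_mem_strictPeriods_SL z

/-- Summing over `b` modulo `p` is orthogonality of additive characters: only exponents divisible by
`p` remain, each with weight `p`. -/
lemma hasSum_sum_translates (hp : 0 < p) (z : ℍ) :
    HasSum (fun m => (p * (qExpansion 1 f).coeff (p * m)) * Function.Periodic.qParam 1 z ^ m)
      (∑ b ∈ Finset.range p, f (ofComplex (((1 : ℕ) * (z : ℂ) + b) / p))) := by
  have hp0 : (p : ℂ) ≠ 0 := by exact_mod_cast hp.ne'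
  set ζ := Complex.exp (2 * Real.pi * Complex.I / p)
  set Q := Complex.exp (2 * Real.pi * Complex.I * z / p) with hQ
  have h (b : ℕ) : HasSum (fun m => (qExpansion 1 f).coeff m * Q ^ m * ζ ^ (m * b))
      (f (ofComplex (((1 : ℕ) * (z : ℂ) + b) / p))) := by
    have him : 0 < (((1 : ℕ) * (z : ℂ) + b) / p).im := by
      rw [Complex.div_natCast_im]
      have : 0 < (z : ℂ).im := z.im_pos
      have hp' : (0:ℝ) < p := by exact_mod_cast hp
      simpa using by positivity
    have := hasSum_cuspForm f (ofComplex (((1 : ℕ) * (z : ℂ) + b) / p))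
    refine this.congr_fun fun m => ?_
    rw [ofComplex_apply_of_im_pos him, mul_assoc]
    congr 1
    rw [mul_comm m b, pow_mul, ← mul_pow]
    congr 1
    rw [Function.Periodic.qParam, hQ, ← Complex.exp_nat_mul, ← Complex.exp_add]
    congr 1
    simp only [Complex.ofReal_one]
    field_simp
    push_cast
    ring
  have hs := hasSum_sum fun b (_ : b ∈ Finset.range p) => h b
  simp_rw [← Finset.mul_sum, ζ, sum_pow_root_of_unity hp.ne'] at hs
  have hinj : Function.Injective fun m : ℕ => p * m := fun a b hab => Nat.eq_of_mul_eq_mul_left hp hab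
  rw [← hinj.hasSum_iff] at hs
  · refine hs.congr_fun fun m => ?_
    simp only [Function.comp, dvd_mul_right, if_true, pow_mul]
    have : Q ^ p = Function.Periodic.qParam 1 z := by
      rw [Function.Periodic.qParam, hQ, ← Complex.exp_nat_mul]
      congr 1
      simp only [Complex.ofReal_one]
      field_simp
    rw [this]
    ring
  · intro m hm
    rw [if_neg, mul_zero]
    rintro ⟨c, rfl⟩
    exact hm ⟨c, rfl⟩

lemma hasSum_dilate (hp : 0 < p) (z : ℍ) :
    HasSum (fun m => (if p ∣ m then (qExpansion 1 f).coeff (m / p) else 0) *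
        Function.Periodic.qParam 1 z ^ m)
      (∑ b ∈ Finset.range 1, f (ofComplex ((p * (z : ℂ) + b) / (1 : ℕ)))) := by
  have hinj : Function.Injective fun m : ℕ => p * m := fun a b hab => Nat.eq_of_mul_eq_mul_left hp hab
  rw [Finset.sum_range_one, ← hinj.hasSum_iff]
  · have him : 0 < ((p * (z : ℂ) + (0 : ℕ)) / (1 : ℕ)).im := by
      have : 0 < (z : ℂ).im := z.im_pos
      have hp' : (0:ℝ) < p := by exact_mod_cast hp
      simpa using by positivity
    refine (hasSum_cuspForm f _).congr_fun fun m => ?_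
    simp only [Function.comp, dvd_mul_right, if_true, pow_mul, Nat.mul_div_cancel_left m hp]
    rw [ofComplex_apply_of_im_pos him]
    congr 2
    rw [Function.Periodic.qParam, Function.Periodic.qParam, ← Complex.exp_nat_mul]
    congr 1
    simp only [Complex.ofReal_one]
    push_cast
    ring
  · intro m hm
    rw [if_neg, zero_mul]
    rintro ⟨c, rfl⟩
    exact hm ⟨c, rfl⟩

lemma heckeOp_prime (hp : p.Prime) (z : ℍ) :
    heckeOp k p f z = (((√p)⁻¹ : ℝ) : ℂ) *
      ((((√p ^ k)⁻¹ : ℝ) : ℂ) *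
          ∑ b ∈ Finset.range p, f (ofComplex (((1 : ℕ) * (z : ℂ) + b) / p)) +
        ((√p ^ k : ℝ) : ℂ) * ∑ b ∈ Finset.range 1, f (ofComplex ((p * (z : ℂ) + b) / (1 : ℕ)))) := by
  have hp0 : (0:ℝ) ≤ p := Nat.cast_nonneg p
  have e1 : (p : ℝ) ^ (-(1/2) : ℝ) = (√p)⁻¹ := by
    rw [Real.rpow_neg hp0, Real.sqrt_eq_rpow]
  have e2 : (p : ℝ) ^ ((k : ℝ) / 2) = √p ^ k := by
    rw [Real.sqrt_eq_rpow, ← Real.rpow_mul_natCast hp0]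
    congr 1; ring
  have e3 : (1 / (p : ℝ)) ^ ((k : ℝ) / 2) = (√p ^ k)⁻¹ := by
    rw [one_div, Real.inv_rpow hp0, e2]
  have hne : ((1, p) : ℕ × ℕ) ≠ (p, 1) := fun h => hp.one_lt.ne (congrArg Prod.fst h)
  have hd : p.divisorsAntidiagonal = {(1, p), (p, 1)} := by
    rw [← Nat.map_div_right_divisors, hp.divisors]
    ext ⟨a, b⟩
    have e : p / p = 1 := Nat.div_self hp.pos
    rw [Finset.map_insert, Finset.map_singleton]
    change (a, b) ∈ ({(1, p / 1), (p, p / p)} : Finset (ℕ × ℕ)) ↔ _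
    rw [Nat.div_one, e]
  rw [heckeOp, hd, Finset.sum_pair hne, e1]
  simp only [Nat.cast_one, div_one] at e2 e3 ⊢
  rw [e2, e3]

/-- The action of a Hecke operator of prime index on Fourier coefficients. -/
lemma heckeEigenvalue_mul_coeff (hf : IsHeckeEigenfunction k f) (hp : p.Prime) (n : ℕ) :
    heckeEigenvalue k f p * (qExpansion 1 f).coeff n =
      (((√p)⁻¹ : ℝ) : ℂ) * ((((√p ^ k)⁻¹ : ℝ) : ℂ) * (p * (qExpansion 1 f).coeff (p * n)) +
        ((√p ^ k : ℝ) : ℂ) * (if p ∣ n then (qExpansion 1 f).coeff (n / p) else 0)) := by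
  have h := ModularFormClass.qExpansion_coeff_unique (f := heckeEigenvalue k f p • f) (k := (k : ℤ))
    (c := fun n => (((√p)⁻¹ : ℝ) : ℂ) * ((((√p ^ k)⁻¹ : ℝ) : ℂ) *
      (p * (qExpansion 1 f).coeff (p * n)) +
        ((√p ^ k : ℝ) : ℂ) * (if p ∣ n then (qExpansion 1 f).coeff (n / p) else 0))) one_pos
    one_mem_strictPeriods_SL (fun z => ?_) n
  · rw [h, ← coeffLin_apply, ← coeffLin_apply, map_smul, smul_eq_mul]
  · have e : (heckeEigenvalue k f p • f) z = heckeOp k p f z := by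
      rw [heckeOp_eigenvalue hf hp.one_le]; rfl
    rw [e, heckeOp_prime f hp]
    have := (((hasSum_sum_translates f hp.pos z).mul_left (((√p ^ k)⁻¹ : ℝ) : ℂ)).add
      ((hasSum_dilate f hp.pos z).mul_left ((√p ^ k : ℝ) : ℂ))).mul_left (((√p)⁻¹ : ℝ) : ℂ)
    refine this.congr_fun fun m => ?_
    rw [smul_eq_mul]
    ring

/-- The Hecke relation at primes for normalized Fourier coefficients. -/
lemma heckeEigenvalue_mul_normCoeff (hk : 1 ≤ k) (hf : IsHeckeEigenfunction k f) (hp : p.Prime)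
    (n : ℕ) (hn : 1 ≤ n) : heckeEigenvalue k f p * normCoeff k f n =
      normCoeff k f (p * n) + if p ∣ n then normCoeff k f (n / p) else 0 := by
  have hs : ((√p : ℝ) : ℂ) ≠ 0 := by
    exact_mod_cast (Real.sqrt_pos.mpr (by exact_mod_cast hp.pos : (0:ℝ) < p)).ne'
  have hpp : (p : ℂ) = ((√p : ℝ) : ℂ) ^ 2 := by
    rw [← Complex.ofReal_pow, Real.sq_sqrt (Nat.cast_nonneg p)]; rfl
  obtain ⟨m, rfl⟩ := Nat.exists_eq_add_of_le hk
  have hn' : ((√n : ℝ) : ℂ) ≠ 0 := by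
    exact_mod_cast (Real.sqrt_pos.mpr (by exact_mod_cast hn : (0:ℝ) < n)).ne'
  have hpn : √((p * n : ℕ) : ℝ) = √p * √n := by
    rw [Nat.cast_mul, Real.sqrt_mul (Nat.cast_nonneg p)]
  have h := heckeEigenvalue_mul_coeff f hf hp n
  unfold normCoeff
  rw [← mul_div_assoc, h, hpn, Nat.add_sub_cancel_left]
  split_ifs with hd
  · obtain ⟨c, rfl⟩ := hd
    have hc' : ((√c : ℝ) : ℂ) ≠ 0 := by
      have : 0 < c := Nat.pos_of_mul_pos_left hn
      exact_mod_cast (Real.sqrt_pos.mpr (by exact_mod_cast this : (0:ℝ) < c)).ne'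
    have hpc : √((p * c : ℕ) : ℝ) = √p * √c := by
      rw [Nat.cast_mul, Real.sqrt_mul (Nat.cast_nonneg p)]
    rw [Nat.mul_div_cancel_left c hp.pos, hpc, hpp]
    push_cast
    field_simp
    ring
  · rw [hpp]
    push_cast
    field_simp
    ring

variable {f}

lemma normCoeff_one (h1 : (qExpansion 1 f).coeff 1 = 1) : normCoeff k f 1 = 1 := by
  simp [normCoeff, h1]

lemma heckeEigenvalue_sq_mul_normCoeff (hk : 1 ≤ k) (hf : IsHeckeEigenfunction k f) (hp : p.Prime)
    {n : ℕ} (hn : 1 ≤ n) (hpn : ¬ p ∣ n) : heckeEigenvalue k f p ^ 2 * normCoeff k f n =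
      normCoeff k f (p ^ 2 * n) + normCoeff k f n := by
  have h1 := heckeEigenvalue_mul_normCoeff f hk hf hp n hn
  have h2 := heckeEigenvalue_mul_normCoeff f hk hf hp (p * n) (Nat.mul_pos hp.pos hn)
  rw [if_neg hpn, add_zero] at h1
  rw [if_pos (dvd_mul_right _ _), Nat.mul_div_cancel_left n hp.pos, ← mul_assoc, ← sq] at h2
  rw [sq, mul_assoc, h1, h2]

lemma heckeEigenvalue_sq (hk : 1 ≤ k) (hf : IsHeckeEigenfunction k f)
    (h1 : (qExpansion 1 f).coeff 1 = 1) (hp : p.Prime) :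
    heckeEigenvalue k f p ^ 2 = 1 + normCoeff k f (p ^ 2) := by
  have := heckeEigenvalue_sq_mul_normCoeff hk hf hp le_rfl hp.not_dvd_one
  rw [normCoeff_one h1, mul_one, mul_one] at this
  rw [this, add_comm]

/-- The relation at `p` is applied twice, to the coefficients at `1` and at `q²`. The constant term
is `1`, in contrast with the case of equal primes. -/
lemma heckeEigenvalue_sq_mul_sq (hk : 1 ≤ k) (hf : IsHeckeEigenfunction k f)
    (h1 : (qExpansion 1 f).coeff 1 = 1) (hp : p.Prime) {q : ℕ} (hq : q.Prime) (hpq : p ≠ q) :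
    heckeEigenvalue k f p ^ 2 * heckeEigenvalue k f q ^ 2 =
      1 + normCoeff k f (p ^ 2) + normCoeff k f (q ^ 2) + normCoeff k f (p ^ 2 * q ^ 2) := by
  have hd : ¬ p ∣ q ^ 2 := fun h => hpq ((Nat.prime_dvd_prime_iff_eq hp hq).mp
    (hp.dvd_of_dvd_pow h))
  rw [heckeEigenvalue_sq hk hf h1 hq, mul_add, mul_one, heckeEigenvalue_sq hk hf h1 hp,
    ← heckeEigenvalue_sq hk hf h1 hp,
    heckeEigenvalue_sq_mul_normCoeff hk hf hp (pow_pos hq.pos 2) hd,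
    heckeEigenvalue_sq hk hf h1 hp]
  ring

/-- The Chebyshev identity `x⁴ = 2 + 3U₂ + U₄`, where `U_j` stands for the coefficient at `p^j`. The
constant `2` instead of `1` is what produces `η` in the end. -/
lemma heckeEigenvalue_sq_sq (hk : 1 ≤ k) (hf : IsHeckeEigenfunction k f)
    (h1 : (qExpansion 1 f).coeff 1 = 1) (hp : p.Prime) :
    heckeEigenvalue k f p ^ 2 * heckeEigenvalue k f p ^ 2 =
      2 + 3 * normCoeff k f (p ^ 2) + normCoeff k f (p ^ 4) := by
  have e0 := normCoeff_one h1
  have e1 := heckeEigenvalue_mul_normCoeff f hk hf hp 1 le_rfl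
  have e2 := heckeEigenvalue_mul_normCoeff f hk hf hp (p ^ 2) (pow_pos hp.pos 2)
  have e3 := heckeEigenvalue_mul_normCoeff f hk hf hp (p ^ 3) (pow_pos hp.pos 3)
  have hsq := heckeEigenvalue_sq hk hf h1 hp
  rw [if_neg hp.not_dvd_one, e0, mul_one, mul_one, add_zero] at e1
  rw [if_pos (dvd_pow_self _ two_ne_zero), ← pow_succ', show p ^ 2 / p = p by
    rw [sq, Nat.mul_div_cancel_left p hp.pos]] at e2
  rw [if_pos (dvd_pow_self _ three_ne_zero), ← pow_succ', show p ^ 3 / p = p ^ 2 by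
    rw [pow_succ' p 2, Nat.mul_div_cancel_left _ hp.pos]] at e3
  rw [← e1] at e2
  linear_combination (2 + heckeEigenvalue k f p ^ 2) * hsq + heckeEigenvalue k f p * e2 + e3

end

end PeterssonAverage

end

noncomputable section

namespace PeterssonAverage

open Filter Topology

/-! ### The second moment -/

section

variable {k : ℕ} {S : Finset (CuspForm 𝒮ℒ (k : ℤ))}

/-- The indices that occur are `p²`, `q²`, `p²q²` and `p⁴`, all at most `X⁴`. The total weight of
the coefficients is `3` off the diagonal and `3 + 1` on it, hence `4 * D`. -/
lemma average_sq_mul_sq (hk : 4 ≤ k) (hS : IsHeckeBasis k S) {W D : ℝ}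
    (hW : W = ∑ f ∈ S, 1 / peterssonNorm k f ^ 2) {X : ℕ}
    (hE : ∀ n : ℕ, 1 < n → n ≤ X ^ 4 → ∃ E : ℝ, |E| ≤ D ∧
      ∑ f ∈ S, ((1 / peterssonNorm k f ^ 2 : ℝ) : ℂ) * normCoeff k f n = ((W * E : ℝ) : ℂ))
    {p q : ℕ} (hp : p.Prime) (hq : q.Prime) (hpX : p ≤ X) (hqX : q ≤ X) :
    ∃ R : ℝ, |R| ≤ 4 * D ∧ ∑ f ∈ S, ((1 / peterssonNorm k f ^ 2 : ℝ) : ℂ) *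
      (heckeEigenvalue k f p ^ 2 * heckeEigenvalue k f q ^ 2) =
        ((W * (1 + (if p = q then 1 else 0) + R) : ℝ) : ℂ) := by
  have hk1 : 1 ≤ k := by omega
  have hX : 1 ≤ X := hp.one_le.trans hpX
  have hWc : (W : ℂ) = ∑ f ∈ S, ((1 / peterssonNorm k f ^ 2 : ℝ) : ℂ) := by
    rw [hW, Complex.ofReal_sum]
  have hsq {p : ℕ} (hp : p.Prime) (hpX : p ≤ X) := hE (p ^ 2) (one_lt_pow₀ hp.one_lt two_ne_zero)
    ((Nat.pow_le_pow_left hpX 2).trans (Nat.pow_le_pow_right hX (by norm_num)))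
  obtain ⟨E₁, h₁, e₁⟩ := hsq hp hpX
  have hD : 0 ≤ D := (abs_nonneg _).trans h₁
  by_cases hpq : p = q
  · subst hpq
    obtain ⟨E₂, h₂, e₂⟩ := hE (p ^ 4) (one_lt_pow₀ hp.one_lt four_ne_zero)
      (Nat.pow_le_pow_left hpX 4)
    refine ⟨3 * E₁ + E₂, ?_, ?_⟩
    · rw [abs_le] at *
      constructor <;> linarith
    · have : ∀ f ∈ S, ((1 / peterssonNorm k f ^ 2 : ℝ) : ℂ) *
          (heckeEigenvalue k f p ^ 2 * heckeEigenvalue k f p ^ 2) =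
          2 * ((1 / peterssonNorm k f ^ 2 : ℝ) : ℂ) +
          3 * (((1 / peterssonNorm k f ^ 2 : ℝ) : ℂ) * normCoeff k f (p ^ 2)) +
          ((1 / peterssonNorm k f ^ 2 : ℝ) : ℂ) * normCoeff k f (p ^ 4) := fun f hf => by
        rw [heckeEigenvalue_sq_sq hk1 (hS.eigen f hf) (hS.normalized f hf) hp]; ring
      rw [Finset.sum_congr rfl this, Finset.sum_add_distrib, Finset.sum_add_distrib,
        ← Finset.mul_sum, ← Finset.mul_sum, e₁, e₂, ← hWc, if_pos rfl]
      push_cast; ring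
  · obtain ⟨E₂, h₂, e₂⟩ := hsq hq hqX
    obtain ⟨E₃, h₃, e₃⟩ := hE (p ^ 2 * q ^ 2)
      (one_lt_mul'' (one_lt_pow₀ hp.one_lt two_ne_zero) (one_lt_pow₀ hq.one_lt two_ne_zero))
      (by
        calc p ^ 2 * q ^ 2 ≤ X ^ 2 * X ^ 2 :=
              Nat.mul_le_mul (Nat.pow_le_pow_left hpX 2) (Nat.pow_le_pow_left hqX 2)
          _ = X ^ 4 := by ring)
    refine ⟨E₁ + E₂ + E₃, ?_, ?_⟩
    · rw [abs_le] at *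
      constructor <;> linarith
    · have : ∀ f ∈ S, ((1 / peterssonNorm k f ^ 2 : ℝ) : ℂ) *
          (heckeEigenvalue k f p ^ 2 * heckeEigenvalue k f q ^ 2) =
          ((1 / peterssonNorm k f ^ 2 : ℝ) : ℂ) +
          ((1 / peterssonNorm k f ^ 2 : ℝ) : ℂ) * normCoeff k f (p ^ 2) +
          ((1 / peterssonNorm k f ^ 2 : ℝ) : ℂ) * normCoeff k f (q ^ 2) +
          ((1 / peterssonNorm k f ^ 2 : ℝ) : ℂ) * normCoeff k f (p ^ 2 * q ^ 2) := fun f hf => by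
        rw [heckeEigenvalue_sq_mul_sq hk1 (hS.eigen f hf) (hS.normalized f hf) hp hq hpq]; ring
      rw [Finset.sum_congr rfl this, Finset.sum_add_distrib, Finset.sum_add_distrib,
        Finset.sum_add_distrib, e₁, e₂, e₃, ← hWc, if_neg hpq]
      push_cast; ring

/-- The harmonic average of the square of a short sum over primes. -/
lemma average_shortSum_sq (hk : 4 ≤ k) (hS : IsHeckeBasis k S) {W D : ℝ}
    (hW : W = ∑ f ∈ S, 1 / peterssonNorm k f ^ 2) {X : ℕ}
    (hE : ∀ n : ℕ, 1 < n → n ≤ X ^ 4 → ∃ E : ℝ, |E| ≤ D ∧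
      ∑ f ∈ S, ((1 / peterssonNorm k f ^ 2 : ℝ) : ℂ) * normCoeff k f n = ((W * E : ℝ) : ℂ))
    {n : ℕ} (hn : n ≤ X) (y : ℝ) :
    ∃ R : ℝ, |R| ≤ 4 * D * ((primeWindow n y).card : ℝ) ^ 2 ∧
      ∑ f ∈ S, ((1 / peterssonNorm k f ^ 2 : ℝ) : ℂ) * shortSum k f n y ^ 2 =
        ((W * (((primeWindow n y).card : ℝ) ^ 2 + (primeWindow n y).card + R) : ℝ) : ℂ) := by
  set P := primeWindow n y with hP
  have hprime : ∀ p ∈ P, p.Prime ∧ p ≤ X := fun p hp => by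
    rw [hP, primeWindow, Finset.mem_filter, Finset.mem_Icc] at hp
    exact ⟨hp.2.1, hp.1.2.trans hn⟩
  have key : ∀ x ∈ P ×ˢ P, ∃ R : ℝ, |R| ≤ 4 * D ∧
      ∑ f ∈ S, ((1 / peterssonNorm k f ^ 2 : ℝ) : ℂ) *
        (heckeEigenvalue k f x.1 ^ 2 * heckeEigenvalue k f x.2 ^ 2) =
        ((W * (1 + (if x.1 = x.2 then 1 else 0) + R) : ℝ) : ℂ) := fun x hx => by
    rw [Finset.mem_product] at hx
    exact average_sq_mul_sq hk hS hW hE (hprime _ hx.1).1 (hprime _ hx.2).1 (hprime _ hx.1).2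
      (hprime _ hx.2).2
  choose! R hR using key
  refine ⟨∑ x ∈ P ×ˢ P, R x, ?_, ?_⟩
  · refine (Finset.abs_sum_le_sum_abs _ _).trans ((Finset.sum_le_card_nsmul _ _ _
      fun x hx => (hR x hx).1).trans (le_of_eq ?_))
    rw [Finset.card_product, nsmul_eq_mul]
    push_cast; ring
  · have h1 : ∀ f, shortSum k f n y ^ 2 =
        ∑ x ∈ P ×ˢ P, heckeEigenvalue k f x.1 ^ 2 * heckeEigenvalue k f x.2 ^ 2 := fun f => by
      rw [sq, Finset.sum_product]
      exact Finset.sum_mul_sum P P _ _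
    simp_rw [h1, Finset.mul_sum]
    rw [Finset.sum_comm, Finset.sum_congr rfl fun x hx => (hR x hx).2, ← Complex.ofReal_sum,
      ← Finset.mul_sum, Finset.sum_add_distrib, Finset.sum_add_distrib]
    congr 3
    have h2 : ∑ x ∈ P ×ˢ P, (if x.1 = x.2 then (1:ℝ) else 0) = P.card := by
      rw [Finset.sum_product]
      simp
    rw [h2]
    simp [Finset.card_product, sq]

end

lemma tendsto_error (D η : ℝ) :
    Tendsto (fun N : ℝ => 4 * (D * Real.exp (-N)) * (η * N + 1) ^ 2) atTop (𝓝 0) := by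
  have h (n : ℕ) := Real.tendsto_pow_mul_exp_neg_atTop_nhds_zero n
  have := (((h 2).const_mul (4 * D * η ^ 2)).add ((h 1).const_mul (8 * D * η))).add
    ((h 0).const_mul (4 * D))
  simp only [mul_zero, add_zero] at this
  refine this.congr fun N => ?_
  ring

/-- The second moment of short sums of Hecke eigenvalues over primes. -/
theorem second_moment_shortSum (ε η : ℝ) (hε : 0 < ε) (hη : 0 < η) :
    ∀ δ : ℝ, 0 < δ → ∃ c N₀ : ℝ, 0 < c ∧ 1 ≤ N₀ ∧
      ∀ N : ℝ, N₀ ≤ N → ∀ k : ℕ, Even k → N ^ (2 + ε) ≤ c * (k : ℝ) →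
        ∀ S : Finset (CuspForm 𝒮ℒ (k : ℤ)), IsHeckeBasis k S →
          ∃ r : ℝ, |r| ≤ δ ∧
            ∑ f ∈ S, ((1 / peterssonNorm k f ^ 2 : ℝ) : ℂ) *
                ∑ n ∈ Finset.Icc 1 ⌊N⌋₊,
                  shortSum k f n (η * Real.log N) ^ 2 =
              ((∑ f ∈ S, (1 / peterssonNorm k f ^ 2) *
                ∑ n ∈ Finset.Icc 1 ⌊N⌋₊,
                  ((primePi ((n : ℝ) - η * Real.log N)
                    - primePi (n : ℝ)) ^ 2 + η + r) : ℝ) : ℂ) := by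
  intro δ hδ
  have hA : 0 < 2 * Real.pi * Real.exp 3 := by positivity
  have hA1 : 6 ≤ 2 * Real.pi * Real.exp 3 := by
    have h1 : 1 ≤ Real.exp 3 := Real.one_le_exp (by norm_num)
    nlinarith [Real.pi_gt_three]
  have ev1 : ∀ᶠ N : ℝ in atTop, errConst * Real.exp (-N) ≤ 1 := by
    have := (Real.tendsto_exp_neg_atTop_nhds_zero).const_mul errConst
    rw [mul_zero] at this
    exact this.eventually_le_const one_pos
  have ev2 : ∀ᶠ N : ℝ in atTop, 4 * (errConst * Real.exp (-N)) * (η * N + 1) ^ 2 ≤ δ / 2 :=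
    (tendsto_error errConst η).eventually_le_const (by positivity)
  have ev3 := (tendsto_average_primeWindow hη).abs
  rw [abs_zero] at ev3
  obtain ⟨N₁, hN₁⟩ := eventually_atTop.mp
    (ev1.and (ev2.and (ev3.eventually_le_const (show (0:ℝ) < δ / 4 by positivity))))
  -- This `c` is the threshold of `harmonic_average`: for `n ≤ N⁴` one has `√n ≤ N² ≤ N^{2+ε}`, so
  -- `2πe³√n ≤ k`.
  refine ⟨(2 * Real.pi * Real.exp 3)⁻¹, max 1 N₁, inv_pos.mpr hA, le_max_left _ _,
    fun N hN k hev hNk S hS => ?_⟩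
  obtain ⟨b1, b2, b3⟩ := hN₁ N ((le_max_right _ _).trans hN)
  have hN1 : 1 ≤ N := (le_max_left _ _).trans hN
  have hN0 : 0 < N := by linarith
  have hkN : 2 * Real.pi * Real.exp 3 * N ^ 2 ≤ k := by
    rw [inv_mul_eq_div, le_div_iff₀ hA] at hNk
    refine le_trans ?_ hNk
    rw [mul_comm]
    refine mul_le_mul_of_nonneg_right ?_ hA.le
    rw [← Real.rpow_natCast]
    exact Real.rpow_le_rpow_of_exponent_le hN1 (by push_cast; linarith)
  have hN2 : N ≤ N ^ 2 := by nlinarith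
  have hkN' : N ≤ k := by nlinarith
  have hk4 : 4 ≤ k := by
    have : (4:ℝ) ≤ k := by nlinarith
    exact_mod_cast this
  have hexp : Real.exp (-(k:ℝ)) ≤ Real.exp (-N) := Real.exp_le_exp.mpr (by linarith)
  have hDN : errConst * Real.exp (-k) ≤ errConst * Real.exp (-N) :=
    mul_le_mul_of_nonneg_left hexp errConst_nonneg
  obtain ⟨hWpos, hE⟩ := harmonic_average hk4 hev (hDN.trans b1) (by nlinarith) hS
  set W : ℝ := ∑ f ∈ S, 1 / peterssonNorm k f ^ 2 with hW
  set X : ℕ := ⌊N⌋₊ with hX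
  set y : ℝ := η * Real.log N with hy
  have hXN : (X : ℝ) ≤ N := Nat.floor_le hN0.le
  have hX1 : 1 ≤ X := Nat.le_floor (by exact_mod_cast hN1)
  have hX0 : (0:ℝ) < X := by exact_mod_cast hX1
  -- Converts errors of size `δN/4` into `δX/2`, since the sum over `n` has `X = ⌊N⌋` terms.
  have hNX : N ≤ 2 * X := by
    have h1 : N < X + 1 := Nat.lt_floor_add_one N
    have h2 : (1:ℝ) ≤ X := by exact_mod_cast hX1
    linarith
  have hy0 : 0 ≤ y := mul_nonneg hη.le (Real.log_nonneg hN1)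
  have hyN : y ≤ η * N := mul_le_mul_of_nonneg_left ((Real.log_le_sub_one_of_pos hN0).trans
    (by linarith)) hη.le
  have hE' : ∀ n : ℕ, 1 < n → n ≤ X ^ 4 → ∃ E : ℝ, |E| ≤ errConst * Real.exp (-N) ∧
      ∑ f ∈ S, ((1 / peterssonNorm k f ^ 2 : ℝ) : ℂ) * normCoeff k f n = ((W * E : ℝ) : ℂ) := by
    intro n hn hnX
    have hsqrt : √(n : ℝ) ≤ N ^ 2 := by
      refine Real.sqrt_le_iff.mpr ⟨by positivity, ?_⟩
      calc (n : ℝ) ≤ (X : ℝ) ^ 4 := by exact_mod_cast hnX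
        _ ≤ N ^ 4 := by gcongr
        _ = (N ^ 2) ^ 2 := by ring
    obtain ⟨E, h1, h2⟩ := hE n hn ((mul_le_mul_of_nonneg_left hsqrt hA.le).trans hkN)
    exact ⟨E, h1.trans hDN, h2⟩
  have key : ∀ n ∈ Finset.Icc 1 X, ∃ R : ℝ, |R| ≤ δ / 2 ∧
      ∑ f ∈ S, ((1 / peterssonNorm k f ^ 2 : ℝ) : ℂ) * shortSum k f n y ^ 2 =
        ((W * (((primeWindow n y).card : ℝ) ^ 2 + (primeWindow n y).card + R) : ℝ) : ℂ) := by
    intro n hn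
    obtain ⟨R, h1, h2⟩ := average_shortSum_sq hk4 hS hW hE' (Finset.mem_Icc.mp hn).2 y
    refine ⟨R, h1.trans (le_trans ?_ b2), h2⟩
    have h3 : ((primeWindow n y).card : ℝ) ≤ η * N + 1 :=
      (card_primeWindow_le n hy0).trans (by linarith)
    have := errConst_nonneg
    gcongr
  choose! R hR using key
  set A : ℝ := ∑ n ∈ Finset.Icc 1 X, (((primeWindow n y).card : ℝ) ^ 2
    + ((primeWindow n y).card : ℝ) - ((primePi ((n : ℝ) - y) - primePi n) ^ 2 + η)) with hAdef
  -- The same `r` must serve every `f` and `n`, so it is the mean over `n` of the whole discrepancy: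
  -- `A` from counting primes, `R n` from the Petersson formula.
  refine ⟨(A + ∑ n ∈ Finset.Icc 1 X, R n) / X, ?_, ?_⟩
  · have hA' : |A| ≤ δ / 4 * N := by
      rw [abs_div, abs_of_pos hN0, div_le_iff₀ hN0] at b3
      exact b3
    have hR' : |∑ n ∈ Finset.Icc 1 X, R n| ≤ X * (δ / 2) := by
      refine (Finset.abs_sum_le_sum_abs _ _).trans ((Finset.sum_le_card_nsmul _ _ _
        fun n hn => (hR n hn).1).trans (le_of_eq ?_))
      simp
    rw [abs_div, abs_of_pos hX0, div_le_iff₀ hX0]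
    refine (abs_add_le _ _).trans ?_
    nlinarith
  · simp_rw [Finset.mul_sum]
    rw [Finset.sum_comm, Finset.sum_congr rfl fun n hn => (hR n hn).2, ← Complex.ofReal_sum]
    congr 1
    rw [Finset.sum_comm]
    simp_rw [← Finset.sum_mul]
    rw [← Finset.mul_sum, ← Finset.mul_sum, ← hW]
    congr 1
    rw [Finset.sum_add_distrib, Finset.sum_add_distrib (f := fun n : ℕ =>
      (primePi ((n : ℝ) - y) - primePi n) ^ 2 + η), Finset.sum_const, Nat.card_Icc,
      Nat.add_sub_cancel, nsmul_eq_mul, mul_div_cancel₀ _ hX0.ne', hAdef, Finset.sum_sub_distrib]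
    ring

end PeterssonAverage

end

theorem proposition3p1 (ε η : ℝ) (hε : 0 < ε) (hη : 0 < η) :
    ∀ δ : ℝ, 0 < δ → ∃ c N₀ : ℝ, 0 < c ∧ 1 ≤ N₀ ∧
      ∀ N : ℝ, N₀ ≤ N → ∀ k : ℕ, Even k → N ^ (2 + ε) ≤ c * (k : ℝ) →
        ∀ S : Finset (CuspForm 𝒮ℒ (k : ℤ)), PeterssonAverage.IsHeckeBasis k S →
          ∃ r : ℝ, |r| ≤ δ ∧
            ∑ f ∈ S, ((1 / PeterssonAverage.peterssonNorm k f ^ 2 : ℝ) : ℂ) *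
                ∑ n ∈ Finset.Icc 1 ⌊N⌋₊,
                  PeterssonAverage.shortSum k f n (η * Real.log N) ^ 2 =
              ((∑ f ∈ S, (1 / PeterssonAverage.peterssonNorm k f ^ 2) *
                ∑ n ∈ Finset.Icc 1 ⌊N⌋₊,
                  ((PeterssonAverage.primePi ((n : ℝ) - η * Real.log N)
                    - PeterssonAverage.primePi (n : ℝ)) ^ 2 + η + r) : ℝ) : ℂ) :=
  PeterssonAverage.second_moment_shortSum ε η hε hη
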